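/- **Theorem.** For an algebraically closed field $K$ of arbitrary characteristic, let $\operatorname{GL}_n(K)$ act on $\operatorname{Mat}_{n,n}(K)^m$ by simultaneous conjugation, $g\cdot(X_1,\dots,X_m)=(gX_1g^{-1},\dots,gX_mg^{-1})$, and write $A\sim_C B$ if the Zariski closures of the orbits of $A$ and $B$ intersect. Let $S(n,m)$ be the ring of polynomial functions on $\operatorname{Mat}_{n,n}(K)^m$ that are constant on orbits. For a word $w=i_1\cdots i_k$ in the letters $1,\dots,m$ put $X_w=X_{i_1}\cdots X_{i_k}$ (the identity for the empty word), and let $\sigma_{j,w}(X)$ be the coefficient of $t^j$ in $\det(\mathrm{Id}+tX_w)$. There is an algorithm in the unit-cost arithmetic model (a random access machine over $K$ that performs the field operations, tests whether a field element is zero, and adds, subtracts and compares natural numbers, each at unit cost), given by a single program which uses no field constants except $0$ and $1$ and does not depend on $n$, $m$, $K$ or its characteristic, and there is a polynomial $b$ with natural number coefficients such that, for all such $K$, all $n,m\ge 0$ and all input tuples $A,B\in\operatorname{Mat}_{n,n}(K)^m$, the algorithm halts after at most $b(n+m)$ steps and decides whether $A\sim_C B$. Moreover, if $A\not\sim_C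 B$, the algorithm outputs in the same run an integer $j$ with $1\le j\le n$ and a word $w$ such that $\sigma_{j,w}\in S(n,m)$ and $\sigma_{j,w}(A)\ne\sigma_{j,w}(B)$. The word $w$ is a pivot of the block-diagonal matrices $C_i=\operatorname{diag}(A_i,B_i)$: $C_w$ does not lie in the linear span of the $C_u$ with $u$ smaller than $w$, where words are ordered first by length and then lexicographically. -/

import Mathlib

/-! ## Tuples of matrices, orbit closures, matrix invariants -/

namespace MatInv

/-- The space `Mat_{n,n}^m` of `m`-tuples of `n × n` matrices. -/
abbrev Tuple (K : Type*) (n m : ℕ) : Type _ := Fin m → Matrix (Fin n) (Fin n) K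

/-- Index set of the coordinates of `Mat_{n,n}^m`: `(i, a, b)` is entry `(a, b)` of matrix `i`. -/
abbrev Coord (n m : ℕ) : Type := Fin m × Fin n × Fin n

/-- The coordinate vector of a tuple. -/
def coords {K : Type*} {n m : ℕ} (X : Tuple K n m) : Coord n m → K :=
  fun p => X p.1 p.2.1 p.2.2

/-- Value of a polynomial function on `Mat_{n,n}^m` at a tuple. -/
noncomputable def evalAt {K : Type*} [CommRing K] {n m : ℕ} (X : Tuple K n m)
    (f : MvPolynomial (Coord n m) K) : K :=
  MvPolynomial.eval (coords X) f

/-- Simultaneous conjugation `g · (X₁, …, X_m) = (g X₁ g⁻¹, …, g X_m g⁻¹)`. -/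
def conj {K : Type*} [Field K] {n m : ℕ} (g : GL (Fin n) K) (X : Tuple K n m) : Tuple K n m :=
  fun i => (g : Matrix (Fin n) (Fin n) K) * X i * ((g⁻¹ : GL (Fin n) K) : Matrix (Fin n) (Fin n) K)

/-- The orbit of a tuple under simultaneous conjugation by `GL_n`. -/
def orbit {K : Type*} [Field K] {n m : ℕ} (X : Tuple K n m) : Set (Tuple K n m) :=
  Set.range fun g : GL (Fin n) K => conj g X

/-- Zariski closure in `Mat_{n,n}^m`: the common zeros of all polynomials vanishing on the set. -/
def zariskiClosure {K : Type*} [Field K] {n m : ℕ} (S : Set (Tuple K n m)) : Set (Tuple K n m) :=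
  {X | ∀ f : MvPolynomial (Coord n m) K, (∀ Y ∈ S, evalAt Y f = 0) → evalAt X f = 0}

/-- `A ∼_C B`: the closures of the two orbits intersect. -/
def ClosureEquiv {K : Type*} [Field K] {n m : ℕ} (A B : Tuple K n m) : Prop :=
  (zariskiClosure (orbit A) ∩ zariskiClosure (orbit B)).Nonempty

/-- The ring `S(n,m)` of matrix invariants: the polynomials that are constant on orbits. -/
def invariantRing (K : Type*) [Field K] (n m : ℕ) :
    Subalgebra K (MvPolynomial (Coord n m) K) where
  carrier := {f | ∀ (g : GL (Fin n) K) (X : Tuple K n m), evalAt (conj g X) f = evalAt X f}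
  mul_mem' := by
    intro f h hf hh g X
    have h1 := hf g X
    have h2 := hh g X
    simp only [evalAt, map_mul] at *
    rw [h1, h2]
  add_mem' := by
    intro f h hf hh g X
    have h1 := hf g X
    have h2 := hh g X
    simp only [evalAt, map_add] at *
    rw [h1, h2]
  algebraMap_mem' := by
    intro r g X
    simp [evalAt, MvPolynomial.algebraMap_eq]

/-- `X_w = X_{i₁} ⋯ X_{i_k}` for the word `w = i₁ ⋯ i_k`; the empty word gives the identity. -/
def wordProd {R : Type*} [Semiring R] {ι : Type*} [Fintype ι] [DecidableEq ι] {m : ℕ}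
    (X : Fin m → Matrix ι ι R) (w : List (Fin m)) : Matrix ι ι R :=
  (w.map X).prod

/-- The polynomial `det(Id + t M)` in `t`. -/
noncomputable def charDet {R : Type*} [CommRing R] {n : ℕ} (M : Matrix (Fin n) (Fin n) R) :
    Polynomial R :=
  Matrix.det (1 + (Polynomial.X : Polynomial R) • M.map Polynomial.C)

/-- `σ_j(M)`, the coefficient of `t ^ j` in `det(Id + t M)`. -/
noncomputable def charCoeff {R : Type*} [CommRing R] {n : ℕ} (j : ℕ)
    (M : Matrix (Fin n) (Fin n) R) : R :=
  (charDet M).coeff j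

/-- The tuple of generic matrices, whose entries are the coordinate functions. -/
noncomputable def genericTuple (K : Type*) [CommRing K] (n m : ℕ) :
    Tuple (MvPolynomial (Coord n m) K) n m :=
  fun i => Matrix.of fun a b => MvPolynomial.X (i, a, b)

/-- `σ_{j,w}` as a polynomial on `Mat_{n,n}^m`. -/
noncomputable def sigma (K : Type*) [CommRing K] (n : ℕ) {m : ℕ} (j : ℕ) (w : List (Fin m)) :
    MvPolynomial (Coord n m) K :=
  charCoeff j (wordProd (genericTuple K n m) w)

/-- The polynomial `σ_{j,w}` is the function `X ↦ σ_j(X_w)`. -/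
theorem evalAt_sigma {K : Type*} [CommRing K] {n m : ℕ} (j : ℕ) (w : List (Fin m))
    (X : Tuple K n m) : evalAt X (sigma K n j w) = charCoeff j (wordProd X w) := by
  have hgen : ∀ i, (MvPolynomial.eval (coords X)).mapMatrix (genericTuple K n m i) = X i := by
    intro i
    ext a b
    simp [genericTuple, coords]
  have hw : (MvPolynomial.eval (coords X)).mapMatrix (wordProd (genericTuple K n m) w)
      = wordProd X w := by
    unfold wordProd
    rw [map_list_prod, List.map_map]
    congr 1
    exact List.map_congr_left fun i _ => hgen i
  have hdet : ∀ M : Matrix (Fin n) (Fin n) (MvPolynomial (Coord n m) K),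
      Polynomial.map (MvPolynomial.eval (coords X)) (charDet M)
        = charDet ((MvPolynomial.eval (coords X)).mapMatrix M) := by
    intro M
    unfold charDet
    rw [← Polynomial.coe_mapRingHom, RingHom.map_det]
    congr 1
    ext a b : 2
    by_cases hab : a = b
    · subst hab
      simp
    · simp [hab]
  unfold evalAt sigma charCoeff
  rw [← hw, ← hdet, Polynomial.coeff_map]

/-- The block-diagonal matrices `C_i = diag(A_i, B_i)`. -/
def blockDiag {K : Type*} [Field K] {n m : ℕ} (A B : Tuple K n m) :
    Fin m → Matrix (Fin n ⊕ Fin n) (Fin n ⊕ Fin n) K :=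
  fun i => Matrix.fromBlocks (A i) 0 0 (B i)

/-- A word `w` is a pivot of the matrices `C_i` if `C_w` is not in the span of the `C_u` with `u`
smaller than `w`, where words are ordered by length first and then lexicographically. -/
def IsPivot {K : Type*} [Field K] {ι : Type*} [Fintype ι] [DecidableEq ι] {m : ℕ}
    (C : Fin m → Matrix ι ι K) (w : List (Fin m)) : Prop :=
  wordProd C w ∉
    Submodule.span K {M | ∃ u : List (Fin m), List.Shortlex (· < ·) u w ∧ wordProd C u = M}

end MatInv

/-! ## The unit-cost arithmetic model

A random access machine over a field `K`. Its memory consists of index registers (natural numbers),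
arrays of natural numbers and arrays of field elements; arrays and registers are named by numbers
occurring in the program, so that a program uses finitely many of them, while positions inside an
array are computed at run time. The program text does not mention `K`: the only field constants are
`0` and `1`. Every arithmetic operation, every comparison, every memory access and every control
step costs one unit. Natural numbers can only be added, subtracted (truncated at zero) and compared,
and there is no way to turn a field element into a natural number other than testing whether it is
zero. -/

namespace ArithRAM

/-- Expressions for natural numbers (indices, counters). -/
inductive IdxExpr : Type
  | const (c : ℕ)
  | reg (r : ℕ)
  | cell (a : ℕ) (i : IdxExpr)
  | add (e f : IdxExpr)
  | sub (e f : IdxExpr)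

/-- Expressions for field elements. -/
inductive FldExpr : Type
  | zero
  | one
  | cell (a : ℕ) (i : IdxExpr)
  | add (e f : FldExpr)
  | sub (e f : FldExpr)
  | mul (e f : FldExpr)
  | div (e f : FldExpr)

/-- Branching conditions. -/
inductive Cond : Type
  | idxEq (e f : IdxExpr)
  | idxLt (e f : IdxExpr)
  | fldZero (e : FldExpr)

/-- Programs. -/
inductive Prog : Type
  | skip
  | setReg (r : ℕ) (e : IdxExpr)
  | setIdx (a : ℕ) (i e : IdxExpr)
  | setFld (a : ℕ) (i : IdxExpr) (e : FldExpr)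
  | seq (p q : Prog)
  | ite (c : Cond) (p q : Prog)
  | while (c : Cond) (p : Prog)

/-- A memory state: index registers, arrays of natural numbers, arrays of field elements
(`idx a k` and `fld a k` are the entries at position `k` of the arrays named `a`). -/
@[ext]
structure Mem (K : Type*) where
  reg : ℕ → ℕ
  idx : ℕ → ℕ → ℕ
  fld : ℕ → ℕ → K

namespace IdxExpr

def eval {K : Type*} (s : Mem K) : IdxExpr → ℕ
  | const c => c
  | reg r => s.reg r
  | cell a i => s.idx a (i.eval s)
  | add e f => e.eval s + f.eval s
  | sub e f => e.eval s - f.eval s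

/-- Number of unit-cost steps for the evaluation. -/
def cost : IdxExpr → ℕ
  | const _ => 1
  | reg _ => 1
  | cell _ i => i.cost + 1
  | add e f => e.cost + f.cost + 1
  | sub e f => e.cost + f.cost + 1

end IdxExpr

namespace FldExpr

/-- Division by zero returns zero; a program can avoid it by testing the divisor. -/
def eval {K : Type*} [Field K] (s : Mem K) : FldExpr → K
  | zero => 0
  | one => 1
  | cell a i => s.fld a (i.eval s)
  | add e f => e.eval s + f.eval s
  | sub e f => e.eval s - f.eval s
  | mul e f => e.eval s * f.eval s
  | div e f => e.eval s / f.eval s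

/-- Number of unit-cost steps for the evaluation. -/
def cost : FldExpr → ℕ
  | zero => 1
  | one => 1
  | cell _ i => i.cost + 1
  | add e f => e.cost + f.cost + 1
  | sub e f => e.cost + f.cost + 1
  | mul e f => e.cost + f.cost + 1
  | div e f => e.cost + f.cost + 1

end FldExpr

namespace Cond

def holds {K : Type*} [Field K] (s : Mem K) : Cond → Prop
  | idxEq e f => e.eval s = f.eval s
  | idxLt e f => e.eval s < f.eval s
  | fldZero e => e.eval s = 0

/-- Number of unit-cost steps for the evaluation, including the comparison. -/
def cost : Cond → ℕ
  | idxEq e f => e.cost + f.cost + 1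
  | idxLt e f => e.cost + f.cost + 1
  | fldZero e => e.cost + 1

end Cond

namespace Mem

def setReg {K : Type*} (s : Mem K) (r v : ℕ) : Mem K :=
  { s with reg := Function.update s.reg r v }

def setIdx {K : Type*} (s : Mem K) (a k v : ℕ) : Mem K :=
  { s with idx := Function.update s.idx a (Function.update (s.idx a) k v) }

def setFld {K : Type*} (s : Mem K) (a k : ℕ) (v : K) : Mem K :=
  { s with fld := Function.update s.fld a (Function.update (s.fld a) k v) }

end Mem

/-- `Runs p s t s'`: started in memory state `s`, the program `p` halts after exactly `t` steps in
memory state `s'`. -/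
inductive Runs {K : Type*} [Field K] : Prog → Mem K → ℕ → Mem K → Prop
  | skip (s : Mem K) : Runs Prog.skip s 1 s
  | setReg (s : Mem K) (r : ℕ) (e : IdxExpr) :
      Runs (Prog.setReg r e) s (e.cost + 1) (s.setReg r (e.eval s))
  | setIdx (s : Mem K) (a : ℕ) (i e : IdxExpr) :
      Runs (Prog.setIdx a i e) s (i.cost + e.cost + 1) (s.setIdx a (i.eval s) (e.eval s))
  | setFld (s : Mem K) (a : ℕ) (i : IdxExpr) (e : FldExpr) :
      Runs (Prog.setFld a i e) s (i.cost + e.cost + 1) (s.setFld a (i.eval s) (e.eval s))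
  | seq {p q : Prog} {s s₁ s₂ : Mem K} {t₁ t₂ : ℕ} :
      Runs p s t₁ s₁ → Runs q s₁ t₂ s₂ → Runs (Prog.seq p q) s (t₁ + t₂) s₂
  | ite_true {c : Cond} {p q : Prog} {s s₁ : Mem K} {t : ℕ} :
      c.holds s → Runs p s t s₁ → Runs (Prog.ite c p q) s (c.cost + 1 + t) s₁
  | ite_false {c : Cond} {p q : Prog} {s s₁ : Mem K} {t : ℕ} :
      ¬ c.holds s → Runs q s t s₁ → Runs (Prog.ite c p q) s (c.cost + 1 + t) s₁
  | while_false {c : Cond} {p : Prog} {s : Mem K} :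
      ¬ c.holds s → Runs (Prog.while c p) s (c.cost + 1) s
  | while_true {c : Cond} {p : Prog} {s s₁ s₂ : Mem K} {t₁ t₂ : ℕ} :
      c.holds s → Runs p s t₁ s₁ → Runs (Prog.while c p) s₁ t₂ s₂ →
        Runs (Prog.while c p) s (c.cost + 1 + t₁ + t₂) s₂

/-- Final state and number of steps are determined by the program and the initial state. -/
theorem Runs.deterministic {K : Type*} [Field K] {p : Prog} {s s₁ s₂ : Mem K} {t₁ t₂ : ℕ}
    (h₁ : Runs p s t₁ s₁) (h₂ : Runs p s t₂ s₂) : t₁ = t₂ ∧ s₁ = s₂ := by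
  induction h₁ generalizing t₂ s₂ with
  | skip | setReg | setIdx | setFld => cases h₂; exact ⟨rfl, rfl⟩
  | seq _ _ ih ih' =>
    cases h₂ with
    | seq a b =>
      obtain ⟨rfl, rfl⟩ := ih a
      obtain ⟨rfl, rfl⟩ := ih' b
      exact ⟨rfl, rfl⟩
  | ite_true hc _ ih =>
    cases h₂ with
    | ite_true _ a => obtain ⟨rfl, rfl⟩ := ih a; exact ⟨rfl, rfl⟩
    | ite_false h _ => exact absurd hc h
  | ite_false hc _ ih =>
    cases h₂ with
    | ite_true h _ => exact absurd h hc
    | ite_false _ a => obtain ⟨rfl, rfl⟩ := ih a; exact ⟨rfl, rfl⟩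
  | while_false hc =>
    cases h₂ with
    | while_false => exact ⟨rfl, rfl⟩
    | while_true h => exact absurd h hc
  | while_true hc _ _ ih ih' =>
    cases h₂ with
    | while_false h => exact absurd hc h
    | while_true _ a b =>
      obtain ⟨rfl, rfl⟩ := ih a
      obtain ⟨rfl, rfl⟩ := ih' b
      exact ⟨rfl, rfl⟩

/-- An array holding the entries of a tuple of matrices, one matrix after the other and each of them
row by row, followed by zeros. -/
def tupleArray {K : Type*} [Field K] {n m : ℕ} (X : MatInv.Tuple K n m) (k : ℕ) : K :=
  if h : k < m * (n * n) then
    X (finProdFinEquiv.symm ⟨k, h⟩).1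
      (finProdFinEquiv.symm (finProdFinEquiv.symm ⟨k, h⟩).2).1
      (finProdFinEquiv.symm (finProdFinEquiv.symm ⟨k, h⟩).2).2
  else 0

/-- Entry `(a, b)` of matrix `i` is stored at position `i n² + a n + b`. -/
theorem tupleArray_entry {K : Type*} [Field K] {n m : ℕ} (X : MatInv.Tuple K n m)
    (i : Fin m) (a b : Fin n) :
    tupleArray X ((b : ℕ) + n * (a : ℕ) + n * n * (i : ℕ)) = X i a b := by
  have h := (finProdFinEquiv (i, finProdFinEquiv (a, b))).isLt
  have hk : (b : ℕ) + n * (a : ℕ) + n * n * (i : ℕ)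
      = (finProdFinEquiv (i, finProdFinEquiv (a, b)) : ℕ) := by
    simp [finProdFinEquiv]
  rw [hk]
  simp only [tupleArray, h, dif_pos, Fin.eta, Equiv.symm_apply_apply]

/-- The memory state at the start of a computation on the input `(A, B)`: registers `0` and `1`
hold `n` and `m`, field arrays `0` and `1` hold the entries of `A` and `B`, and everything else is
zero. -/
def input {K : Type*} [Field K] {n m : ℕ} (A B : MatInv.Tuple K n m) : Mem K where
  reg r := if r = 0 then n else if r = 1 then m else 0
  idx _ _ := 0
  fld a := if a = 0 then tupleArray A else if a = 1 then tupleArray B else fun _ => 0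

/-- The word `w` (with letters numbered from `0`) is written in the memory: its length is in
register `2` and its letters are the first entries of index array `0`. -/
def HoldsWord {K : Type*} {m : ℕ} (s : Mem K) (w : List (Fin m)) : Prop :=
  s.reg 2 = w.length ∧ ∀ (k : ℕ) (hk : k < w.length), s.idx 0 k = (w[k] : ℕ)

end ArithRAM

/-!
The orbit closures of `A` and `B` meet if and only if `σ_{j,w}(A) = σ_{j,w}(B)` for all `j` and for
the finitely many pivots `w` of the block-diagonal matrices `C_i = diag(A_i, B_i)`; the program
enumerates the pivots and compares these invariants.

*Invariants separate closed orbits* (`MatInv.closureEquiv_of_pivots`). Let the free algebra act on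
`K ^ n` through the matrices of a tuple. If a subspace `W` is invariant, conjugation by
`(1 - e) + t e` with a projection `e` onto `W` degenerates the tuple, as `t → 0`, to the one that acts on `W` and on
the quotient separately. Repeating this, every orbit closure contains a tuple `X` whose
representation is semisimple. A semisimple module over an algebra over an algebraically closed field
is determined by the characteristic polynomials of the elements of any set `T` that spans the image
of the algebra (`nonempty_linearEquiv_of_actionCharpoly_eq`). In characteristic `p` the traces of
elements of `T` only determine the multiplicities of the simple constituents modulo `p`, since trace
forms of pairwise nonisomorphic simple modules are linearly independent. After cancellation of the
common constituents all multiplicities are therefore divisible by `p`, and the argument is repeated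
for the `p`-th roots of the characteristic polynomials. The monomials `w` for the pivots form such
a set `T`, because every `C_u` is a combination of the `C_w` for the pivots `w ≤ u`.

*Enumeration of the pivots* (`MatInv.PivotQueue`). Prefixes of pivots are pivots, so a breadth-first
search over the extensions by one letter of the pivots found so far meets all of them, in increasing
order. A candidate is a pivot if and only if its matrix is not in the span of the matrices found so
far, which is decided by Gaussian elimination. There are at most `2 n ^ 2` pivots, and their lengths
are less than `2 n ^ 2`.

*Comparison of characteristic polynomials* (`MatInv.charDet_mul_detSeries`). A machine that works in
all characteristics cannot recover `det(1 + t M)` from traces of powers by Newton's identities.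
Instead, with `N_k` the matrix of the first `k` rows of `-M`, Cramer's rule gives
`det(1 - t N_{k-1}) / det(1 - t N_k) = ∑ (N_k ^ l)_{kk} t ^ l`, and the product over `k` is a
division-free expression for `1 / det(1 + t M)` as a power series. The first degree in which these
series differ for `A_w` and `B_w` is the first degree in which the characteristic polynomials differ.

*Programs.* The program is written with counted loops only (`ArithRAM.LProg`), whose bounds are kept
in registers that the loop bodies do not change. Such programs have an evident denotation `exec`, and
their running time is at most a polynomial, read off from the program text, in a common bound for
the loop lengths (`ArithRAM.LProg.runs_compile`). What remains is partial correctness, by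
loop invariants (`ArithRAM.LProg.exec_loop_induction`).
-/


/-! ### Characteristic polynomials of semisimple modules -/

open Polynomial in
/-- Multiplicities in a product of monic polynomials `f q w`, which depend on a parameter `w`, are
determined by the products for all `w` if the families of subleading coefficients are linearly
independent over `K`. In characteristic `p` the subleading coefficients of the products only see the
multiplicities modulo `p`; the rest is an induction on the sum of the multiplicities. -/
theorem prod_pow_injective_of_nextCoeff {K Q T : Type*} [Field K] [Fintype Q]
    (f : Q → T → K[X]) (hf : ∀ q w, (f q w).Monic)
    (hind : ∀ c : Q → K, (∀ w, ∑ q, c q * (f q w).nextCoeff = 0) → c = 0) :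
    ∀ (N : ℕ) (a b : Q → ℕ), ∑ q, (a q + b q) ≤ N →
      (∀ w, ∏ q, f q w ^ a q = ∏ q, f q w ^ b q) → a = b := by
  classical
  have hcast : ∀ a b : Q → ℕ, (∀ w, ∏ q, f q w ^ a q = ∏ q, f q w ^ b q) →
      ∀ q, (a q : K) = (b q : K) := by
    intro a b h
    have key := hind (fun q => (a q : K) - b q) fun w => by
      have h1 := congrArg nextCoeff (h w)
      rw [Monic.nextCoeff_prod _ _ fun q _ => (hf q w).pow _,
        Monic.nextCoeff_prod _ _ fun q _ => (hf q w).pow _] at h1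
      simp only [(hf _ w).nextCoeff_pow, nsmul_eq_mul] at h1
      simp only [sub_mul, Finset.sum_sub_distrib, h1, sub_self]
    intro q
    exact sub_eq_zero.mp (congrFun key q)
  intro N
  induction N using Nat.strong_induction_on with
  | _ N ih =>
  intro a b hN h
  by_cases hz : a = 0 ∧ b = 0
  · rw [hz.1, hz.2]
  by_cases hc : ∃ q, a q ≠ 0 ∧ b q ≠ 0
  · obtain ⟨q, ha, hb⟩ := hc
    -- a factor occurring on both sides is cancelled
    have upd : ∀ a : Q → ℕ, a q ≠ 0 → ∃ a' : Q → ℕ, a = a' + Pi.single q 1 := by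
      intro a ha
      refine ⟨a - Pi.single q 1, ?_⟩
      ext x
      by_cases hx : x = q
      · subst hx; simp; omega
      · simp [hx]
    obtain ⟨a', rfl⟩ := upd a ha
    obtain ⟨b', rfl⟩ := upd b hb
    have hsp : ∀ (a : Q → ℕ) w, ∏ x, f x w ^ (a + Pi.single q 1 : Q → ℕ) x
        = (∏ x, f x w ^ a x) * f q w := by
      intro a w
      simp only [Pi.add_apply, pow_add, Finset.prod_mul_distrib]
      congr 1
      rw [Finset.prod_eq_single q] <;> simp +contextual
    have hs : ∑ x, (a' x + b' x) < N := by
      refine lt_of_lt_of_le ?_ hN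
      refine Finset.sum_lt_sum (fun i _ => by simp; omega) ⟨q, Finset.mem_univ _, by simp; omega⟩
    rw [ih _ hs a' b' le_rfl fun w => ?_]
    have := h w
    rw [hsp, hsp] at this
    exact mul_right_cancel₀ (hf q w).ne_zero this
  · push Not at hc
    have h0 := hcast a b h
    have ha0 : ∀ q, (a q : K) = 0 := fun q => by
      by_cases ha : a q = 0
      · simp [ha]
      · rw [h0, hc q ha, Nat.cast_zero]
    have hb0 : ∀ q, (b q : K) = 0 := fun q => by rw [← h0, ha0]
    obtain ⟨p, hp⟩ := CharP.exists K
    -- without common factors all multiplicities vanish in `K`, hence are divisible by `p`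
    rcases Nat.eq_zero_or_pos p with rfl | hpos
    · have := CharP.charP_to_charZero K
      exact absurd ⟨funext fun q => by exact_mod_cast ha0 q,
        funext fun q => by exact_mod_cast hb0 q⟩ hz
    · have hpp : p.Prime := (CharP.char_is_prime_or_zero K p).resolve_right hpos.ne'
      have : Fact p.Prime := ⟨hpp⟩
      choose a' ha' using fun q => (CharP.cast_eq_zero_iff K p (a q)).mp (ha0 q)
      choose b' hb' using fun q => (CharP.cast_eq_zero_iff K p (b q)).mp (hb0 q)
      have hs : ∑ x, (a' x + b' x) < ∑ x, (a x + b x) := by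
        have hex : ∃ q, a q + b q ≠ 0 := by
          by_contra! hcon
          exact hz ⟨funext fun q => by have := hcon q; simp; omega,
            funext fun q => by have := hcon q; simp; omega⟩
        obtain ⟨q, hq⟩ := hex
        have h2 := hpp.two_le
        refine Finset.sum_lt_sum (fun x _ => ?_) ⟨q, Finset.mem_univ _, ?_⟩
        · rw [ha' x, hb' x]; nlinarith
        · rw [ha' q, hb' q] at hq ⊢
          rw [← mul_add] at hq ⊢
          have := Nat.pos_of_ne_zero (right_ne_zero_of_mul hq)
          nlinarith
      have hab := ih _ (hs.trans_le hN) a' b' le_rfl fun w => by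
        apply frobenius_inj K[X] p
        have := h w
        simp only [ha', hb'] at this
        simp only [frobenius_def, ← Finset.prod_pow, ← pow_mul]
        simpa only [mul_comm] using this
      ext q
      rw [ha', hb', hab]

universe v

section Modules

open Module

variable {K R : Type*} [Field K] [Ring R] [Algebra K R]

section Density

variable {ι : Type*} {L : ι → Type*} [∀ i, AddCommGroup (L i)]
  [∀ i, Module R (L i)] [∀ i, Module K (L i)] [∀ i, IsScalarTower K R (L i)]

/-- Density theorem for pairwise nonisomorphic simple modules: some element of the algebra acts on
`L i` as a prescribed linear map and annihilates the other modules. -/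
theorem exists_smul_eq_of_pairwise_not_iso [Finite ι] [IsAlgClosed K]
    [∀ i, FiniteDimensional K (L i)] [∀ i, IsSimpleModule R (L i)]
    (hL : ∀ i j, i ≠ j → IsEmpty (L i ≃ₗ[R] L j)) (i : ι) (f : L i →ₗ[K] L i) :
    ∃ r : R, (∀ x : L i, r • x = f x) ∧ ∀ j, j ≠ i → ∀ x : L j, r • x = 0 := by
  classical
  have := Fintype.ofFinite ι
  -- by Schur's lemma the commutant of `R` on the product consists of diagonal matrices
  have hdiag : ∀ φ : End R (∀ j, L j), ∃ c : ι → K, ∀ x j, φ x j = c j • x j := by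
    intro φ
    have hc : ∀ j, ∃ c : K, ∀ y : L j, φ (Pi.single j y) j = c • y := by
      intro j
      obtain ⟨c, hc⟩ := (IsSimpleModule.algebraMap_end_bijective_of_isAlgClosed K
        (A := R) (V := L j)).2 (LinearMap.proj j ∘ₗ φ ∘ₗ LinearMap.single R L j)
      exact ⟨c, fun y => by simpa using (LinearMap.congr_fun hc y).symm⟩
    choose c hc using hc
    refine ⟨c, fun x j => ?_⟩
    conv_lhs => rw [← Finset.univ_sum_single x]
    rw [map_sum, Finset.sum_apply, Finset.sum_eq_single j]
    · exact hc j (x j)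
    · intro k _ hk
      rcases LinearMap.bijective_or_eq_zero
        (LinearMap.proj j ∘ₗ φ ∘ₗ LinearMap.single R L k) with h | h
      · exact ((hL k j hk).false (LinearEquiv.ofBijective _ h)).elim
      · exact LinearMap.congr_fun h (x k)
    · simp
  let F : End (End R (∀ j, L j)) (∀ j, L j) :=
    { toFun := fun x => Pi.single i (f (x i))
      map_add' := fun x y => by simp [Pi.single_add]
      map_smul' := fun φ x => by
        obtain ⟨c, hc⟩ := hdiag φ
        ext j
        simp only [End.smul_def, RingHom.id_apply, hc]
        by_cases hj : j = i
        · subst hj; simp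
        · simp [hj] }
  have : Module.Finite (End R (∀ j, L j)) (∀ j, L j) :=
    Module.Finite.of_restrictScalars_finite K _ _
  obtain ⟨r, hr⟩ := Module.Finite.toModuleEnd_moduleEnd_surjective (R := R) (M := ∀ j, L j) F
  have hr' : ∀ x : ∀ j, L j, r • x = Pi.single i (f (x i)) := fun x => LinearMap.congr_fun hr x
  refine ⟨r, fun x => ?_, fun j hj x => ?_⟩
  · simpa using congrFun (hr' (Pi.single i x)) i
  · simpa [hj] using congrFun (hr' (Pi.single j x)) j

end Density

/-- The characteristic polynomial of the action of `r` on a finite-dimensional module. -/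
noncomputable def actionCharpoly (K : Type*) {R : Type*} [Field K] [Ring R] [Algebra K R]
    (V : Type*) [AddCommGroup V] [Module R V] [Module K V] [IsScalarTower K R V]
    [FiniteDimensional K V] (r : R) : Polynomial K :=
  (Algebra.lsmul K K V r).charpoly

variable {V W : Type*} [AddCommGroup V] [Module R V] [Module K V] [IsScalarTower K R V]
    [FiniteDimensional K V] [AddCommGroup W] [Module R W] [Module K W] [IsScalarTower K R W]
    [FiniteDimensional K W]

theorem actionCharpoly_congr (e : V ≃ₗ[R] W) (r : R) :
    actionCharpoly K V r = actionCharpoly K W r := by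
  unfold actionCharpoly
  rw [← (e.restrictScalars K).charpoly_conj]
  congr 1
  ext x
  simp [LinearEquiv.conj_apply]

theorem actionCharpoly_prod (r : R) :
    actionCharpoly K (V × W) r = actionCharpoly K V r * actionCharpoly K W r := by
  unfold actionCharpoly
  rw [← LinearMap.charpoly_prodMap]
  congr 1

theorem actionCharpoly_subsingleton [Subsingleton V] (r : R) : actionCharpoly K V r = 1 := by
  refine Polynomial.eq_one_of_monic_natDegree_zero (LinearMap.charpoly_monic _) ?_
  rw [actionCharpoly, LinearMap.charpoly_natDegree, finrank_zero_of_subsingleton]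

theorem actionCharpoly_pi_fin (r : R) : ∀ {k : ℕ} (L : Fin k → Type*) [∀ i, AddCommGroup (L i)]
    [∀ i, Module R (L i)] [∀ i, Module K (L i)] [∀ i, IsScalarTower K R (L i)]
    [∀ i, FiniteDimensional K (L i)],
    actionCharpoly K (∀ i, L i) r = ∏ i, actionCharpoly K (L i) r := by
  intro k
  induction k with
  | zero => intro L _ _ _ _ _; rw [actionCharpoly_subsingleton]; simp
  | succ k ih =>
    intro L _ _ _ _ _
    rw [← actionCharpoly_congr (Fin.consLinearEquiv R L), actionCharpoly_prod, ih,
      Fin.prod_univ_succ]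

theorem nextCoeff_actionCharpoly (r : R) :
    (actionCharpoly K V r).nextCoeff = - LinearMap.trace K V (Algebra.lsmul K K V r) := by
  rw [actionCharpoly, LinearMap.charpoly_def, LinearMap.trace_eq_matrix_trace K
    (Free.chooseBasis K V), Matrix.trace_eq_neg_charpoly_nextCoeff, neg_neg]

/-- Two semisimple modules over an algebra over an algebraically closed field are isomorphic if
the characteristic polynomials agree on elements spanning the image of the algebra. -/
theorem nonempty_linearEquiv_of_actionCharpoly_eq {V W : Type v} {R : Type*} [Ring R] [Algebra K R]
    [AddCommGroup V] [Module R V] [Module K V]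
    [IsScalarTower K R V] [FiniteDimensional K V] [AddCommGroup W] [Module R W] [Module K W]
    [IsScalarTower K R W] [FiniteDimensional K W] [IsAlgClosed K]
    [IsSemisimpleModule R V] [IsSemisimpleModule R W] (T : Set R)
    (hT : ∀ r : R, ∃ r' ∈ Submodule.span K T,
      (∀ x : V, r • x = r' • x) ∧ ∀ x : W, r • x = r' • x)
    (hchar : ∀ r ∈ T, actionCharpoly K V r = actionCharpoly K W r) :
    Nonempty (V ≃ₗ[R] W) := by
  classical
  have : Module.Finite R V := Module.Finite.of_restrictScalars_finite K R V
  have : Module.Finite R W := Module.Finite.of_restrictScalars_finite K R W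
  obtain ⟨k, S, eS, hS⟩ := IsSemisimpleModule.exists_linearEquiv_fin_dfinsupp R V
  obtain ⟨l, S', eS', hS'⟩ := IsSemisimpleModule.exists_linearEquiv_fin_dfinsupp R W
  have hSfin : ∀ i, FiniteDimensional K (S i) := fun i =>
    inferInstanceAs (FiniteDimensional K ((S i).restrictScalars K))
  have hSfin' : ∀ i, FiniteDimensional K (S' i) := fun i =>
    inferInstanceAs (FiniteDimensional K ((S' i).restrictScalars K))
  have e : V ≃ₗ[R] ∀ i, S i := eS.trans DFinsupp.linearEquivFunOnFintype
  have e' : W ≃ₗ[R] ∀ i, S' i := eS'.trans DFinsupp.linearEquivFunOnFintype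
  -- the summands of both modules, each as a submodule of `V × W`
  let ι := Fin k ⊕ Fin l
  let M : ι → Submodule R (V × W) :=
    Sum.elim (fun i => (S i).map (LinearMap.inl R V W)) (fun i => (S' i).map (LinearMap.inr R V W))
  have eM : ∀ i, Nonempty (S i ≃ₗ[R] M (Sum.inl i)) := fun i =>
    ⟨Submodule.equivMapOfInjective _ LinearMap.inl_injective _⟩
  have eM' : ∀ i, Nonempty (S' i ≃ₗ[R] M (Sum.inr i)) := fun i =>
    ⟨Submodule.equivMapOfInjective _ LinearMap.inr_injective _⟩
  have hM : ∀ i, IsSimpleModule R (M i) := by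
    rintro (i | i)
    · exact IsSimpleModule.congr (eM i).some.symm
    · exact IsSimpleModule.congr (eM' i).some.symm
  have hMfin : ∀ i, FiniteDimensional K (M i) := fun i =>
    inferInstanceAs (FiniteDimensional K ((M i).restrictScalars K))
  let st : Setoid ι :=
    { r := fun i j => Nonempty (M i ≃ₗ[R] M j)
      iseqv := ⟨fun _ => ⟨LinearEquiv.refl _ _⟩, fun ⟨f⟩ => ⟨f.symm⟩, fun ⟨f⟩ ⟨g⟩ => ⟨f.trans g⟩⟩ }
  let Q := Quotient st
  let L : Q → Submodule R (V × W) := fun q => M q.out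
  have hL : ∀ i : ι, Nonempty (M i ≃ₗ[R] L (Quotient.mk st i)) := fun i =>
    Setoid.symm (Quotient.mk_out (s := st) i)
  have hne : ∀ q q' : Q, q ≠ q' → IsEmpty (L q ≃ₗ[R] L q') := by
    intro q q' hqq
    refine ⟨fun f => hqq ?_⟩
    rw [← Quotient.out_eq q, ← Quotient.out_eq q']
    exact Quotient.sound ⟨f⟩
  let a : Q → ℕ := fun q => Fintype.card {i : Fin k // Quotient.mk st (Sum.inl i) = q}
  let b : Q → ℕ := fun q => Fintype.card {i : Fin l // Quotient.mk st (Sum.inr i) = q}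
  have hprod : ∀ {k : ℕ} (g : Fin k → Q) (F : Q → Polynomial K),
      ∏ i, F (g i) = ∏ q, F q ^ Fintype.card {i // g i = q} := by
    intro k g F
    rw [← Finset.prod_fiberwise (s := Finset.univ) (g := g)]
    refine Finset.prod_congr rfl fun q _ => ?_
    rw [Finset.prod_congr rfl (g := fun _ => F q) fun i hi => by
      rw [(Finset.mem_filter.mp hi).2], Finset.prod_const, Fintype.card_subtype]
  have hV : ∀ r : R, actionCharpoly K V r = ∏ q, actionCharpoly K (L q) r ^ a q := by
    intro r
    rw [actionCharpoly_congr (K := K) e, actionCharpoly_pi_fin, ← hprod]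
    exact Finset.prod_congr rfl fun i _ => actionCharpoly_congr ((eM i).some.trans (hL _).some) r
  have hW : ∀ r : R, actionCharpoly K W r = ∏ q, actionCharpoly K (L q) r ^ b q := by
    intro r
    rw [actionCharpoly_congr (K := K) e', actionCharpoly_pi_fin, ← hprod]
    exact Finset.prod_congr rfl fun i _ => actionCharpoly_congr ((eM' i).some.trans (hL _).some) r
  have hab : a = b := by
    refine prod_pow_injective_of_nextCoeff (T := T) (fun q w => actionCharpoly K (L q) (w : R))
      (fun q w => LinearMap.charpoly_monic _) ?_ _ a b le_rfl
      (fun w => by rw [← hV, ← hW, hchar _ w.2])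
    intro c hc
    let φ : R →ₗ[K] K :=
      ∑ q, c q • (LinearMap.trace K (L q) ∘ₗ (Algebra.lsmul K K (L q)).toLinearMap)
    have hφ : ∀ r, φ r = ∑ q, c q * LinearMap.trace K (L q) (Algebra.lsmul K K (L q) r) := by
      intro r; simp [φ]
    have hspan : ∀ r ∈ Submodule.span K T, φ r = 0 := by
      intro r hr
      have : Submodule.span K T ≤ LinearMap.ker φ := by
        rw [Submodule.span_le]
        intro w hw
        have := hc ⟨w, hw⟩
        simp only [nextCoeff_actionCharpoly, mul_neg, Finset.sum_neg_distrib, neg_eq_zero] at this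
        rw [SetLike.mem_coe, LinearMap.mem_ker, hφ, this]
      exact this hr
    have hall : ∀ r, φ r = 0 := by
      intro r
      obtain ⟨r', hr', h1, h2⟩ := hT r
      rw [← hspan r' hr', hφ, hφ]
      refine Finset.sum_congr rfl fun q _ => ?_
      congr 2
      ext1 x
      apply Subtype.ext
      exact Prod.ext (h1 _) (h2 _)
    ext1 q
    have := (hM q.out).nontrivial
    -- an element acting on `L q` with trace `1` and annihilating the other simple modules
    obtain ⟨f, hf⟩ : ∃ f : L q →ₗ[K] L q, LinearMap.trace K (L q) f = 1 := by
      have : Nontrivial (L q) := this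
      obtain ⟨v, hv⟩ := exists_ne (0 : L q)
      obtain ⟨g, hg⟩ : ∃ g : Module.Dual K (L q), g v ≠ 0 := by
        by_contra! h
        exact hv ((Module.forall_dual_apply_eq_zero_iff K v).mp h)
      exact ⟨g.smulRight ((g v)⁻¹ • v), by
        rw [LinearMap.trace_smulRight, map_smul, smul_eq_mul, inv_mul_cancel₀ hg]⟩
    have : ∀ q, IsSimpleModule R (L q) := fun q => hM _
    obtain ⟨r, hr, hr'⟩ := exists_smul_eq_of_pairwise_not_iso (K := K) (R := R)
      (L := fun q => L q) hne q f
    have h := hall r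
    rw [hφ, Finset.sum_eq_single q] at h
    · rw [show Algebra.lsmul K K (L q) r = f from LinearMap.ext hr, hf, mul_one] at h
      exact h
    · intro q' _ hq'
      rw [show Algebra.lsmul K K (L q') r = 0 from LinearMap.ext (hr' q' hq'), map_zero, mul_zero]
    · simp
  have hcard : ∀ q, Nonempty ({i : Fin k // Quotient.mk st (Sum.inl i) = q} ≃
      {i : Fin l // Quotient.mk st (Sum.inr i) = q}) := fun q =>
    ⟨Fintype.equivOfCardEq (congrFun hab q)⟩
  let σ : Fin k ≃ Fin l := Equiv.ofFiberEquiv fun q => (hcard q).some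
  have hσ : ∀ i, Quotient.mk st (Sum.inr (σ i)) = Quotient.mk st (Sum.inl i) := fun i =>
    Equiv.ofFiberEquiv_map (f := fun i => Quotient.mk st (Sum.inl i))
      (g := fun i => Quotient.mk st (Sum.inr i)) _ i
  have es : ∀ i, Nonempty (S i ≃ₗ[R] S' (σ i)) := fun i => by
    obtain ⟨g⟩ : Nonempty (M (Sum.inr (σ i)) ≃ₗ[R] M (Sum.inl i)) := Quotient.exact (hσ i)
    exact ⟨(eM i).some.trans (g.symm.trans (eM' _).some.symm)⟩
  exact ⟨e.trans ((LinearEquiv.piCongrRight fun i => (es i).some).trans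
    ((LinearEquiv.piCongrLeft R (fun i => S' i) σ).trans e'.symm))⟩

end Modules

namespace MatInv

/-! ### Words, the free algebra and orbit closures -/

section FreeAlgebraAction

variable {K : Type*} [Field K] {n m : ℕ}

/-- The word `w` as a monomial of the free algebra. -/
noncomputable def wordElt (K : Type*) [Field K] {m : ℕ} (w : List (Fin m)) :
    FreeAlgebra K (Fin m) :=
  (w.map (FreeAlgebra.ι K)).prod

/-- Substitution of the matrices `X i` for the variables of the free algebra. -/
noncomputable def tupleHom (K : Type*) [Field K] {m : ℕ} {S : Type*} [CommRing S] [Algebra K S]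
    {ι : Type*} [Fintype ι] [DecidableEq ι] (X : Fin m → Matrix ι ι S) :
    FreeAlgebra K (Fin m) →ₐ[K] Matrix ι ι S :=
  FreeAlgebra.lift K X

theorem tupleHom_wordElt {S : Type*} [CommRing S] [Algebra K S]
    {ι : Type*} [Fintype ι] [DecidableEq ι] (X : Fin m → Matrix ι ι S) (w : List (Fin m)) :
    tupleHom K X (wordElt K w) = wordProd X w := by
  unfold wordElt wordProd tupleHom
  rw [map_list_prod, List.map_map]
  congr 1
  exact List.map_congr_left fun i _ => by simp

theorem span_wordElt : Submodule.span K (Set.range (wordElt K (m := m))) = ⊤ := by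
  rw [eq_top_iff]
  rintro r -
  induction r using FreeAlgebra.induction with
  | grade0 r =>
    rw [Algebra.algebraMap_eq_smul_one]
    exact Submodule.smul_mem _ _ (Submodule.subset_span ⟨[], by simp [wordElt]⟩)
  | grade1 x => exact Submodule.subset_span ⟨[x], by simp [wordElt]⟩
  | mul a b ha hb =>
    have h := Submodule.mul_mem_mul ha hb
    rw [Submodule.span_mul_span] at h
    refine Submodule.span_mono ?_ h
    rintro _ ⟨_, ⟨u, rfl⟩, _, ⟨v, rfl⟩, rfl⟩
    exact ⟨u ++ v, by simp [wordElt]⟩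
  | add a b ha hb => exact Submodule.add_mem _ ha hb

/-- The entries of `r(X)` are polynomial functions of `X`. -/
theorem evalAt_tupleHom_genericTuple (X : Tuple K n m) (r : FreeAlgebra K (Fin m)) (a b : Fin n) :
    evalAt X (tupleHom K (genericTuple K n m) r a b) = tupleHom K X r a b := by
  have h : (MvPolynomial.aeval (coords X)).mapMatrix.comp (tupleHom K (genericTuple K n m))
      = tupleHom K X := by
    ext i a b
    simp [tupleHom, genericTuple, coords]
  have h2 := congrFun (congrFun (DFunLike.congr_fun h r) a) b
  exact h2

theorem tupleHom_conj (g : GL (Fin n) K) (X : Tuple K n m) (r : FreeAlgebra K (Fin m)) :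
    tupleHom K (conj g X) r = (g : Matrix (Fin n) (Fin n) K) * tupleHom K X r *
      ((g⁻¹ : GL (Fin n) K) : Matrix (Fin n) (Fin n) K) := by
  have hg : ((g⁻¹ : GL (Fin n) K) : Matrix (Fin n) (Fin n) K) * g = 1 := g.inv_mul
  have hg' : (g : Matrix (Fin n) (Fin n) K) * ((g⁻¹ : GL (Fin n) K) : Matrix (Fin n) (Fin n) K)
      = 1 := g.mul_inv
  induction r using FreeAlgebra.induction with
  | grade0 r =>
    simp only [AlgHom.commutes]
    simp only [Algebra.algebraMap_eq_smul_one, Matrix.mul_smul, Matrix.smul_mul,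
      mul_one, hg']
  | grade1 x => simp [tupleHom, conj]
  | mul a b ha hb =>
    rw [map_mul, map_mul, ha, hb]
    simp only [mul_assoc]
    rw [← mul_assoc _ (g : Matrix (Fin n) (Fin n) K), hg, one_mul]
  | add a b ha hb => rw [map_add, map_add, ha, hb, mul_add, add_mul]

end FreeAlgebraAction

section Closure

variable {K : Type*} [Field K] {n m : ℕ}

theorem conj_mem_orbit (g : GL (Fin n) K) (A : Tuple K n m) : conj g A ∈ orbit A := ⟨g, rfl⟩

theorem self_mem_orbit (A : Tuple K n m) : A ∈ orbit A := ⟨1, by ext; simp [conj]⟩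

theorem subset_zariskiClosure (S : Set (Tuple K n m)) : S ⊆ zariskiClosure S :=
  fun X hX _ hf => hf X hX

theorem conj_conj (g h : GL (Fin n) K) (A : Tuple K n m) : conj g (conj h A) = conj (g * h) A := by
  ext1 i
  simp [conj, mul_assoc]

theorem evalAt_eq_of_mem_closure {A X : Tuple K n m} (hX : X ∈ zariskiClosure (orbit A))
    {f : MvPolynomial (Coord n m) K} (hf : f ∈ invariantRing K n m) : evalAt X f = evalAt A f := by
  have h := hX (f - MvPolynomial.C (evalAt A f)) (by
    rintro _ ⟨g, rfl⟩
    have := hf g A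
    simp only [evalAt, map_sub, MvPolynomial.eval_C] at this ⊢
    rw [this, sub_self])
  simp only [evalAt, map_sub, MvPolynomial.eval_C] at h
  exact sub_eq_zero.mp h

theorem tupleHom_eq_zero_of_mem_closure {A X : Tuple K n m} (hX : X ∈ zariskiClosure (orbit A))
    {r : FreeAlgebra K (Fin m)} (hr : tupleHom K A r = 0) : tupleHom K X r = 0 := by
  ext a b
  rw [← evalAt_tupleHom_genericTuple]
  refine hX _ ?_
  rintro _ ⟨g, rfl⟩
  rw [evalAt_tupleHom_genericTuple, tupleHom_conj, hr, mul_zero, zero_mul, Matrix.zero_apply]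

/-- A polynomial function precomposed with conjugation by `g`. -/
noncomputable def conjPullback (g : GL (Fin n) K) (f : MvPolynomial (Coord n m) K) :
    MvPolynomial (Coord n m) K :=
  MvPolynomial.aeval (fun p : Coord n m =>
    (((g : Matrix (Fin n) (Fin n) K).map MvPolynomial.C * genericTuple K n m p.1 *
      ((g⁻¹ : GL (Fin n) K) : Matrix (Fin n) (Fin n) K).map MvPolynomial.C :
        Matrix (Fin n) (Fin n) (MvPolynomial (Coord n m) K))) p.2.1 p.2.2) f

theorem evalAt_conjPullback (g : GL (Fin n) K) (f : MvPolynomial (Coord n m) K)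
    (X : Tuple K n m) : evalAt X (conjPullback g f) = evalAt (conj g X) f := by
  have h : (MvPolynomial.aeval (coords X)).comp (MvPolynomial.aeval (R := K)
      (fun p : Coord n m =>
      (((g : Matrix (Fin n) (Fin n) K).map MvPolynomial.C * genericTuple K n m p.1 *
      ((g⁻¹ : GL (Fin n) K) : Matrix (Fin n) (Fin n) K).map MvPolynomial.C :
        Matrix (Fin n) (Fin n) (MvPolynomial (Coord n m) K))) p.2.1 p.2.2))
      = MvPolynomial.aeval (R := K) (coords (conj g X)) := by
    ext p
    simp [conj, coords, genericTuple, Matrix.mul_apply, Matrix.map_apply]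
  exact DFunLike.congr_fun h f

/-- Orbit closures are invariant under conjugation, so closures of orbits of their points are
contained in them. -/
theorem mem_closure_trans {A X Y : Tuple K n m} (hX : X ∈ zariskiClosure (orbit A))
    (hY : Y ∈ zariskiClosure (orbit X)) : Y ∈ zariskiClosure (orbit A) := by
  intro f hf
  refine hY f ?_
  rintro _ ⟨g, rfl⟩
  change evalAt (conj g X) f = 0
  rw [← evalAt_conjPullback]
  refine hX _ ?_
  rintro _ ⟨h, rfl⟩
  change evalAt (conj h A) _ = 0
  rw [evalAt_conjPullback, conj_conj]
  exact hf _ (conj_mem_orbit _ _)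

/-- If the image of the idempotent `e` is invariant under `A`, the block diagonal part of `A` with
respect to `e` and `1 - e` is a limit of the conjugates of `A` under `(1 - e) + t e`. -/
theorem blockPart_mem_closure [Infinite K] (A : Tuple K n m) (e : Matrix (Fin n) (Fin n) K)
    (he : e * e = e) (hA : ∀ i, (1 - e) * A i * e = 0) :
    (fun i => e * A i * e + (1 - e) * A i * (1 - e)) ∈ zariskiClosure (orbit A) := by
  intro f hf
  set D : Tuple K n m := fun i => e * A i * e + (1 - e) * A i * (1 - e) with hD
  -- conjugation by `(1 - e) + t e` multiplies the off-diagonal block `N` by `t`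
  let N : Tuple K n m := fun i => e * A i * (1 - e)
  let p : Polynomial K := MvPolynomial.aeval
    (fun q => Polynomial.C (coords D q) + Polynomial.X * Polynomial.C (coords N q)) f
  have hp : ∀ t : K, p.eval t = evalAt (fun i => D i + t • N i) f := by
    intro t
    have h : (Polynomial.aeval t).comp (MvPolynomial.aeval (R := K)
        (fun q => Polynomial.C (coords D q) + Polynomial.X * Polynomial.C (coords N q)))
        = MvPolynomial.aeval (R := K) (coords (fun i => D i + t • N i)) := by
      ext q
      simp [coords]
      exact mul_comm _ _
    exact DFunLike.congr_fun h f
  have hinv : ∀ t u : K, t * u = 1 → ((1 - e) + t • e) * ((1 - e) + u • e) = 1 := by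
    intro t u htu
    have he' : (1 - e) * (1 - e) = 1 - e := by rw [mul_sub, sub_mul, sub_mul, he]; simp
    have he1 : e * (1 - e) = 0 := by rw [mul_sub, he, mul_one, sub_self]
    have he2 : (1 - e) * e = 0 := by rw [sub_mul, he, one_mul, sub_self]
    rw [mul_add, add_mul, add_mul, Matrix.smul_mul, Matrix.smul_mul, Matrix.mul_smul,
      Matrix.mul_smul, he, he', he1, he2, smul_smul, htu]
    simp
  have hroot : ∀ t : K, t ≠ 0 → p.eval t = 0 := by
    intro t ht
    rw [hp]
    refine hf _ ⟨⟨(1 - e) + t • e, (1 - e) + t⁻¹ • e, ?_, ?_⟩, ?_⟩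
    · exact hinv t t⁻¹ (mul_inv_cancel₀ ht)
    · exact hinv t⁻¹ t (inv_mul_cancel₀ ht)
    · ext1 i
      change ((1 - e) + t • e) * A i * ((1 - e) + t⁻¹ • e) = D i + t • N i
      have h1 : ((1 - e) + t • e) * A i * ((1 - e) + t⁻¹ • e)
          = (1 - e) * A i * (1 - e) + t⁻¹ • ((1 - e) * A i * e) + t • (e * A i * (1 - e))
            + (t * t⁻¹) • (e * A i * e) := by
        rw [add_mul, add_mul, mul_add, mul_add]
        simp only [Matrix.mul_smul, Matrix.smul_mul, smul_smul]
        rw [mul_comm t⁻¹ t]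
        abel
      rw [h1, hA, mul_inv_cancel₀ ht, smul_zero, add_zero, one_smul]
      simp only [hD, N]
      abel
  have hp0 : p = 0 := by
    refine Polynomial.eq_zero_of_infinite_isRoot p (Set.Infinite.mono (s := {0}ᶜ) ?_ ?_)
    · intro t ht
      exact hroot t ht
    · exact (Set.finite_singleton (0 : K)).infinite_compl
  have h := hp 0
  rw [hp0, Polynomial.eval_zero] at h
  simpa using h.symm

/-- Passage to the block diagonal part commutes with the evaluation of noncommutative polynomials. -/
theorem tupleHom_blockPart (A : Tuple K n m) (e : Matrix (Fin n) (Fin n) K)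
    (he : e * e = e) (hA : ∀ i, (1 - e) * A i * e = 0) (r : FreeAlgebra K (Fin m)) :
    (1 - e) * tupleHom K A r * e = 0 ∧
    tupleHom K (fun i => e * A i * e + (1 - e) * A i * (1 - e)) r
      = e * tupleHom K A r * e + (1 - e) * tupleHom K A r * (1 - e) := by
  have he' : (1 - e) * (1 - e) = 1 - e := by rw [mul_sub, sub_mul, sub_mul, he]; simp
  have he1 : e * (1 - e) = 0 := by rw [mul_sub, he, mul_one, sub_self]
  have he2 : (1 - e) * e = 0 := by rw [sub_mul, he, one_mul, sub_self]
  induction r using FreeAlgebra.induction with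
  | grade0 r =>
    simp only [AlgHom.commutes]
    simp only [Algebra.algebraMap_eq_smul_one, Matrix.mul_smul, Matrix.smul_mul, mul_one,
      he, he', he2, smul_zero, true_and]
    rw [← smul_add, add_sub_cancel]
  | grade1 x => simpa [tupleHom] using hA x
  | mul a b ha hb =>
    obtain ⟨ha, ha'⟩ := ha
    obtain ⟨hb, hb'⟩ := hb
    rw [map_mul, map_mul, ha', hb']
    set a := tupleHom K A a
    set b := tupleHom K A b
    have hbe : b * e = e * b * e := by
      rw [sub_mul, one_mul, sub_mul, sub_eq_zero] at hb
      exact hb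
    have hae : (1 - e) * a = (1 - e) * a * (1 - e) := by rw [mul_sub _ 1 e, mul_one, ha, sub_zero]
    have hae0 : (1 - e) * (a * e) = 0 := by rw [← mul_assoc, ha]
    have h1 : (e * a * e) * (e * b * e) = e * (a * b) * e := by
      calc (e * a * e) * (e * b * e) = e * a * (e * e) * b * e := by simp only [mul_assoc]
        _ = e * a * (e * b * e) := by rw [he]; simp only [mul_assoc]
        _ = e * (a * b) * e := by rw [← hbe]; simp only [mul_assoc]
    have h2 : ((1 - e) * a * (1 - e)) * ((1 - e) * b * (1 - e)) = (1 - e) * (a * b) * (1 - e) := by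
      calc ((1 - e) * a * (1 - e)) * ((1 - e) * b * (1 - e))
          = ((1 - e) * a * ((1 - e) * (1 - e))) * (b * (1 - e)) := by simp only [mul_assoc]
        _ = (1 - e) * (a * b) * (1 - e) := by rw [he', ← hae]; simp only [mul_assoc]
    have h3 : (e * a * e) * ((1 - e) * b * (1 - e)) = 0 := by
      calc _ = e * a * (e * (1 - e)) * (b * (1 - e)) := by simp only [mul_assoc]
        _ = 0 := by rw [he1]; simp
    have h4 : ((1 - e) * a * (1 - e)) * (e * b * e) = 0 := by
      calc _ = (1 - e) * a * ((1 - e) * e) * (b * e) := by simp only [mul_assoc]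
        _ = 0 := by rw [he2]; simp
    refine ⟨?_, ?_⟩
    · calc (1 - e) * (a * b) * e = (1 - e) * a * (b * e) := by simp only [mul_assoc]
        _ = (1 - e) * (a * e) * (b * e) := by
          conv_lhs => rw [hbe]
          simp only [mul_assoc]
        _ = 0 := by rw [hae0, zero_mul]
    · rw [mul_add, add_mul, add_mul, h1, h2, h3, h4, zero_add, add_zero]
  | add a b ha hb =>
    obtain ⟨ha, ha'⟩ := ha
    obtain ⟨hb, hb'⟩ := hb
    rw [map_add, map_add, ha', hb']
    refine ⟨by rw [mul_add, add_mul, ha, hb, add_zero], ?_⟩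
    simp only [mul_add, add_mul]
    abel

end Closure

/-! ### Semisimple representations in orbit closures -/

section Semisimplification

variable {K : Type*} [Field K] {n m : ℕ}

/-- The space `K ^ n` on which the free algebra acts through the matrices `A i`. The tuple is a
parameter of the type, so that the module structure can be an instance. -/
def Rep (_A : Tuple K n m) : Type _ := Fin n → K

namespace Rep

variable (A : Tuple K n m)

instance : AddCommGroup (Rep A) := inferInstanceAs (AddCommGroup (Fin n → K))

instance : Module K (Rep A) := inferInstanceAs (Module K (Fin n → K))

instance : FiniteDimensional K (Rep A) := inferInstanceAs (FiniteDimensional K (Fin n → K))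

noncomputable instance : Module (FreeAlgebra K (Fin m)) (Rep A) :=
  Module.compHom (Fin n → K) ((Matrix.toLinAlgEquiv' : Matrix (Fin n) (Fin n) K ≃ₐ[K]
    ((Fin n → K) →ₗ[K] Fin n → K)).toAlgHom.comp (tupleHom K A)).toRingHom

theorem smul_def (r : FreeAlgebra K (Fin m)) (x : Rep A) :
    r • x = (tupleHom K A r).mulVec x := rfl

instance : IsScalarTower K (FreeAlgebra K (Fin m)) (Rep A) where
  smul_assoc k r x := by
    rw [smul_def, smul_def, map_smul]
    exact Matrix.smul_mulVec k _ _

instance : IsArtinian (FreeAlgebra K (Fin m)) (Rep A) :=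
  isArtinian_of_tower K inferInstance

theorem actionCharpoly_eq (r : FreeAlgebra K (Fin m)) :
    actionCharpoly K (Rep A) r = (tupleHom K A r).charpoly :=
  Matrix.charpoly_toLin' (tupleHom K A r)

end Rep

/-- The closure of every orbit contains a tuple whose representation is semisimple. -/
theorem exists_isSemisimple_mem_closure [Infinite K] (A : Tuple K n m) :
    ∃ X ∈ zariskiClosure (orbit A), IsSemisimpleModule (FreeAlgebra K (Fin m)) (Rep X) := by
  -- induction on a bound `d` for the codimension of a semisimple submodule `W` of `Rep B`
  suffices H : ∀ (d : ℕ) (B : Tuple K n m), B ∈ zariskiClosure (orbit A) →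
      ∀ W : Submodule (FreeAlgebra K (Fin m)) (Rep B),
        IsSemisimpleModule (FreeAlgebra K (Fin m)) W →
        n ≤ d + Module.finrank K (W.restrictScalars K) →
        ∃ X ∈ zariskiClosure (orbit A), IsSemisimpleModule (FreeAlgebra K (Fin m)) (Rep X) from
    H n A (subset_zariskiClosure _ (self_mem_orbit A)) ⊥
      (sSup_simples_eq_top_iff_isSemisimpleModule.mp (Subsingleton.elim _ _))
      (Nat.le_add_right _ _)
  intro d
  induction d with
  | zero =>
    intro B hB W hW hd
    have hn : Module.finrank K (Rep B) = n := Module.finrank_fin_fun K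
    have htop : W.restrictScalars K = ⊤ := by
      apply Submodule.eq_top_of_finrank_eq
      have := Submodule.finrank_le (W.restrictScalars K)
      omega
    have htop' : W = ⊤ := (Submodule.restrictScalars_eq_top_iff K _ _).mp htop
    subst htop'
    exact ⟨B, hB, IsSemisimpleModule.congr Submodule.topEquiv.symm⟩
  | succ d ih =>
    intro B hB W hW hd
    by_cases htop : W = ⊤
    · subst htop
      exact ⟨B, hB, IsSemisimpleModule.congr Submodule.topEquiv.symm⟩
    let W₀ : Submodule K (Fin n → K) := W.restrictScalars K
    obtain ⟨U, hU⟩ := exists_isCompl W₀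
    let e : Matrix (Fin n) (Fin n) K := LinearMap.toMatrix' (W₀.projection U hU)
    have hev : ∀ x, e.mulVec x = W₀.projection U hU x := fun x => by
      rw [← Matrix.toLin'_apply, Matrix.toLin'_toMatrix']
    have hmem : ∀ x, e.mulVec x ∈ W₀ := fun x => by
      rw [hev]; exact Submodule.projection_apply_mem hU x
    have hfix : ∀ x ∈ W₀, e.mulVec x = x := fun x hx => by
      rw [hev]; exact Submodule.projection_apply_of_mem_left hU hx
    have hcomem : ∀ x, (1 - e).mulVec x ∈ U := fun x => by
      rw [Matrix.sub_mulVec, Matrix.one_mulVec, hev]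
      exact Submodule.sub_projection_mem hU x
    have hkill : ∀ x ∈ U, e.mulVec x = 0 := fun x hx => by
      rw [hev]; exact (Submodule.projection_apply_eq_zero_iff hU).mpr hx
    have hinv : ∀ (r : FreeAlgebra K (Fin m)), ∀ x ∈ W₀, (tupleHom K B r).mulVec x ∈ W₀ :=
      fun r x hx => W.smul_mem r hx
    have he : e * e = e := by
      apply Matrix.toLin'.injective
      refine LinearMap.ext fun x => ?_
      rw [Matrix.toLin'_apply, ← Matrix.mulVec_mulVec, hfix _ (hmem x), Matrix.toLin'_apply]
    have hA : ∀ i, (1 - e) * B i * e = 0 := by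
      intro i
      apply Matrix.toLin'.injective
      refine LinearMap.ext fun x => ?_
      have h1 := hinv (FreeAlgebra.ι K i) _ (hmem x)
      simp only [tupleHom, FreeAlgebra.lift_ι_apply] at h1
      rw [Matrix.toLin'_apply, ← Matrix.mulVec_mulVec, ← Matrix.mulVec_mulVec, Matrix.sub_mulVec,
        Matrix.one_mulVec, hfix _ h1, sub_self]
      simp
    -- in `B'` the complement `U` of `W` is invariant and contains a simple submodule
    let B' : Tuple K n m := fun i => e * B i * e + (1 - e) * B i * (1 - e)
    have hB' : B' ∈ zariskiClosure (orbit A) :=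
      mem_closure_trans hB (blockPart_mem_closure B e he hA)
    have hact : ∀ (r : FreeAlgebra K (Fin m)) (x : Fin n → K), (tupleHom K B' r).mulVec x
        = e.mulVec ((tupleHom K B r).mulVec (e.mulVec x))
          + (1 - e).mulVec ((tupleHom K B r).mulVec ((1 - e).mulVec x)) := by
      intro r x
      rw [(tupleHom_blockPart B e he hA r).2, Matrix.add_mulVec]
      simp only [Matrix.mulVec_mulVec, mul_assoc]
    have hactW : ∀ (r : FreeAlgebra K (Fin m)), ∀ x ∈ W₀,
        (tupleHom K B' r).mulVec x = (tupleHom K B r).mulVec x := by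
      intro r x hx
      have h0 : (1 - e).mulVec x = 0 := by
        rw [Matrix.sub_mulVec, Matrix.one_mulVec, hfix x hx, sub_self]
      rw [hact, hfix x hx, hfix _ (hinv r x hx), h0]
      simp
    have hactU : ∀ (r : FreeAlgebra K (Fin m)), ∀ x ∈ U, (tupleHom K B' r).mulVec x ∈ U := by
      intro r x hx
      rw [hact, hkill x hx, Matrix.mulVec_zero, Matrix.mulVec_zero, zero_add]
      exact hcomem _
    let W' : Submodule (FreeAlgebra K (Fin m)) (Rep B') :=
      { carrier := (show Set (Fin n → K) from W₀)
        add_mem' := W₀.add_mem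
        zero_mem' := W₀.zero_mem
        smul_mem' := fun r x hx => by
          have h1 := hinv r x hx
          rw [← hactW r x hx] at h1
          exact h1 }
    let U' : Submodule (FreeAlgebra K (Fin m)) (Rep B') :=
      { carrier := (show Set (Fin n → K) from U)
        add_mem' := U.add_mem
        zero_mem' := U.zero_mem
        smul_mem' := fun r x hx => hactU r x hx }
    let eW : W' ≃ₗ[FreeAlgebra K (Fin m)] W :=
      { toFun := fun x => ⟨x.1, x.2⟩
        invFun := fun x => ⟨x.1, x.2⟩
        left_inv := fun _ => rfl
        right_inv := fun _ => rfl
        map_add' := fun _ _ => rfl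
        map_smul' := fun r x => Subtype.ext (hactW r x.1 x.2) }
    have hW' : IsSemisimpleModule (FreeAlgebra K (Fin m)) W' := IsSemisimpleModule.congr eW
    have hU' : U' ≠ ⊥ := by
      intro h
      have hU0 : U = ⊥ := by
        rw [eq_bot_iff]
        intro x hx
        have : (x : Rep B') ∈ U' := hx
        rw [h] at this
        exact this
      rw [hU0] at hU
      have h1 := hU.sup_eq_top
      rw [sup_bot_eq] at h1
      exact htop ((Submodule.restrictScalars_eq_top_iff K _ _).mp h1)
    obtain ⟨T, hT, hTU⟩ := (IsAtomic.eq_bot_or_exists_atom_le U').resolve_left hU'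
    have hTs : IsSimpleModule (FreeAlgebra K (Fin m)) T := isSimpleModule_iff_isAtom.mpr hT
    refine ih B' hB' (W' ⊔ T) (IsSemisimpleModule.sup hW' inferInstance) ?_
    have hlt : W'.restrictScalars K < (W' ⊔ T).restrictScalars K := by
      refine lt_of_le_of_ne (fun x hx => Submodule.mem_sup_left hx) fun h => hT.1 ?_
      rw [eq_bot_iff]
      intro x hx
      have h1 : x ∈ (W' ⊔ T).restrictScalars K := Submodule.mem_sup_right hx
      rw [← h] at h1
      have h2 : (x : Fin n → K) ∈ W₀ ⊓ U := ⟨h1, hTU hx⟩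
      rw [hU.inf_eq_bot] at h2
      exact h2
    have h1 := Submodule.finrank_lt_finrank_of_lt hlt
    have h2 : Module.finrank K (W'.restrictScalars K) = Module.finrank K (W.restrictScalars K) := rfl
    omega

/-- `det(1 + t M)` is, up to the sign of `t`, the reverse of the characteristic polynomial. -/
theorem charpoly_eq_of_charDet_eq {M N : Matrix (Fin n) (Fin n) K} (h : charDet M = charDet N) :
    M.charpoly = N.charpoly := by
  have hrev : ∀ M : Matrix (Fin n) (Fin n) K,
      Polynomial.compRingHom (-Polynomial.X) (charDet M) = M.charpolyRev := by
    intro M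
    unfold charDet Matrix.charpolyRev
    rw [RingHom.map_det]
    congr 1
    ext a b : 2
    by_cases hab : a = b
    · subst hab; simp [sub_eq_add_neg]
    · simp [hab]
  have h1 : M.charpoly.reverse = N.charpoly.reverse := by
    rw [Matrix.reverse_charpoly, Matrix.reverse_charpoly, ← hrev, ← hrev, h]
  unfold Polynomial.reverse at h1
  rw [Matrix.charpoly_natDegree_eq_dim, Matrix.charpoly_natDegree_eq_dim] at h1
  rw [← Polynomial.reflect_reflect (p := M.charpoly), h1, Polynomial.reflect_reflect]

section Pivots

variable {ι : Type*} [Fintype ι] [DecidableEq ι] (C : Fin m → Matrix ι ι K)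

theorem shortlex_wf : WellFounded (List.Shortlex (· < · : Fin m → Fin m → Prop)) :=
  List.Shortlex.wf wellFounded_lt

theorem shortlex_trans {u v w : List (Fin m)} (h₁ : List.Shortlex (· < ·) u v)
    (h₂ : List.Shortlex (· < ·) v w) : List.Shortlex (· < ·) u w := by
  rw [List.shortlex_def] at *
  rcases h₁ with h₁ | ⟨h₁, h₁'⟩ <;> rcases h₂ with h₂ | ⟨h₂, h₂'⟩
  · left; omega
  · left; omega
  · left; omega
  · exact Or.inr ⟨h₁.trans h₂, List.lt_trans h₁' h₂'⟩

/-- `C_w` is a combination of the `C_v` for the pivots `v` up to `w`. -/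
theorem wordProd_mem_span_pivots (w : List (Fin m)) :
    wordProd C w ∈ Submodule.span K
      (wordProd C '' {v | IsPivot C v ∧ (v = w ∨ List.Shortlex (· < ·) v w)}) := by
  induction w using shortlex_wf.induction with
  | _ w ih =>
  by_cases hw : IsPivot C w
  · exact Submodule.subset_span ⟨w, ⟨hw, Or.inl rfl⟩, rfl⟩
  · unfold IsPivot at hw
    rw [not_not] at hw
    refine (Submodule.span_le.mpr ?_) hw
    rintro _ ⟨u, hu, rfl⟩
    refine Submodule.span_mono (Set.image_mono ?_) (ih u hu)
    rintro v ⟨hv, hvu⟩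
    refine ⟨hv, Or.inr ?_⟩
    rcases hvu with rfl | hvu
    · exact hu
    · exact shortlex_trans hvu hu

end Pivots

theorem tupleHom_blockDiag (A B : Tuple K n m) (r : FreeAlgebra K (Fin m)) :
    tupleHom K (blockDiag A B) r = Matrix.fromBlocks (tupleHom K A r) 0 0 (tupleHom K B r) := by
  induction r using FreeAlgebra.induction with
  | grade0 r =>
    simp only [AlgHom.commutes]
    simp only [Algebra.algebraMap_eq_smul_one, ← Matrix.fromBlocks_one, Matrix.fromBlocks_smul,
      smul_zero]
  | grade1 x => simp [tupleHom, blockDiag]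
  | mul a b ha hb =>
    simp only [map_mul, ha, hb, Matrix.fromBlocks_multiply, mul_zero, zero_mul, add_zero, zero_add]
  | add a b ha hb => simp only [map_add, ha, hb, Matrix.fromBlocks_add, add_zero]

/-- The functions `σ_{j,w}` are invariant under simultaneous conjugation. -/
theorem sigma_mem_invariantRing (K : Type*) [Field K] (n : ℕ) {m : ℕ} (j : ℕ) (w : List (Fin m)) :
    sigma K n j w ∈ invariantRing K n m := by
  intro g X
  rw [evalAt_sigma, evalAt_sigma, ← tupleHom_wordElt (K := K), ← tupleHom_wordElt (K := K),
    tupleHom_conj]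
  set M := tupleHom K X (wordElt K w)
  unfold charCoeff charDet
  congr 1
  let c : Matrix (Fin n) (Fin n) K →+* Matrix (Fin n) (Fin n) (Polynomial K) :=
    Polynomial.C.mapMatrix
  have h1 : c g * c (g⁻¹ : GL (Fin n) K) = 1 := by rw [← map_mul, g.mul_inv, map_one]
  have h2 : (1 + (Polynomial.X : Polynomial K) • c (g * M * (g⁻¹ : GL (Fin n) K)))
      = c g * (1 + (Polynomial.X : Polynomial K) • c M) * c (g⁻¹ : GL (Fin n) K) := by
    rw [mul_add, add_mul, mul_one, h1, map_mul, map_mul, Matrix.mul_smul, Matrix.smul_mul]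
  change (1 + (Polynomial.X : Polynomial K) • c (g * M * (g⁻¹ : GL (Fin n) K))).det
    = (1 + (Polynomial.X : Polynomial K) • c M).det
  rw [h2, Matrix.det_mul, Matrix.det_mul, mul_right_comm, ← Matrix.det_mul, h1, Matrix.det_one,
    one_mul]

theorem charCoeff_eq_of_mem_closure {A X : Tuple K n m} (hX : X ∈ zariskiClosure (orbit A))
    (j : ℕ) (w : List (Fin m)) : charCoeff j (wordProd X w) = charCoeff j (wordProd A w) := by
  rw [← evalAt_sigma, ← evalAt_sigma]
  exact evalAt_eq_of_mem_closure hX (sigma_mem_invariantRing K n j w)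

theorem ClosureEquiv.charCoeff_eq {A B : Tuple K n m} (h : ClosureEquiv A B) (j : ℕ)
    (w : List (Fin m)) : charCoeff j (wordProd A w) = charCoeff j (wordProd B w) := by
  obtain ⟨X, hA, hB⟩ := h
  rw [← charCoeff_eq_of_mem_closure hA, charCoeff_eq_of_mem_closure hB]

/-- If the invariants `σ_{j,w}` for the pivots `w` of `diag(A_i, B_i)` do not separate `A` and `B`,
the orbit closures meet. -/
theorem closureEquiv_of_pivots [IsAlgClosed K] (A B : Tuple K n m)
    (h : ∀ w, IsPivot (blockDiag A B) w → ∀ j,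
      charCoeff j (wordProd A w) = charCoeff j (wordProd B w)) : ClosureEquiv A B := by
  have : Infinite K := IsAlgClosed.instInfinite
  obtain ⟨X, hX, hXs⟩ := exists_isSemisimple_mem_closure A
  obtain ⟨Y, hY, hYs⟩ := exists_isSemisimple_mem_closure B
  let T : Set (FreeAlgebra K (Fin m)) := wordElt K '' {w | IsPivot (blockDiag A B) w}
  obtain ⟨φ⟩ := nonempty_linearEquiv_of_actionCharpoly_eq (K := K) (V := Rep X) (W := Rep Y) T
    (by
      -- modulo the kernel of the action, `r` is a combination of pivots
      intro r
      have hmem : ∀ r, tupleHom K (blockDiag A B) r ∈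
          (Submodule.span K T).map (tupleHom K (blockDiag A B)).toLinearMap := by
        intro r
        have hr : r ∈ Submodule.span K (Set.range (wordElt K (m := m))) := by
          rw [span_wordElt]; trivial
        induction hr using Submodule.span_induction with
        | mem r hr =>
          obtain ⟨w, rfl⟩ := hr
          rw [tupleHom_wordElt, Submodule.map_span]
          refine Submodule.span_mono ?_ (wordProd_mem_span_pivots (blockDiag A B) w)
          rintro _ ⟨v, hv, rfl⟩
          exact ⟨wordElt K v, ⟨v, hv.1, rfl⟩, tupleHom_wordElt _ _⟩
        | zero => rw [map_zero]; exact Submodule.zero_mem _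
        | add a b _ _ ha hb => rw [map_add]; exact Submodule.add_mem _ ha hb
        | smul c a _ ha => rw [map_smul]; exact Submodule.smul_mem _ _ ha
      obtain ⟨r', hr', he⟩ := hmem r
      refine ⟨r', hr', ?_⟩
      have he0 : tupleHom K (blockDiag A B) (r - r') = 0 := by
        rw [map_sub, sub_eq_zero]; exact he.symm
      rw [tupleHom_blockDiag, ← Matrix.fromBlocks_zero, Matrix.fromBlocks_inj] at he0
      have hx := tupleHom_eq_zero_of_mem_closure hX he0.1
      have hy := tupleHom_eq_zero_of_mem_closure hY he0.2.2.2
      rw [map_sub, sub_eq_zero] at hx hy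
      exact ⟨fun x => by rw [Rep.smul_def, Rep.smul_def, hx],
        fun x => by rw [Rep.smul_def, Rep.smul_def, hy]⟩)
    (by
      rintro _ ⟨w, hw, rfl⟩
      rw [Rep.actionCharpoly_eq, Rep.actionCharpoly_eq, tupleHom_wordElt, tupleHom_wordElt]
      refine charpoly_eq_of_charDet_eq (Polynomial.ext fun j => ?_)
      exact (charCoeff_eq_of_mem_closure hX j w).trans
        ((h w hw j).trans (charCoeff_eq_of_mem_closure hY j w).symm))
  let φK : (Fin n → K) ≃ₗ[K] (Fin n → K) := φ.restrictScalars K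
  let g : GL (Fin n) K := ⟨LinearMap.toMatrix' φK.toLinearMap,
    LinearMap.toMatrix' φK.symm.toLinearMap,
    by rw [← LinearMap.toMatrix'_comp]; simp, by rw [← LinearMap.toMatrix'_comp]; simp⟩
  have hg : ∀ x, (g : Matrix (Fin n) (Fin n) K).mulVec x = φK x := by
    intro x
    change (LinearMap.toMatrix' φK.toLinearMap).mulVec x = φK x
    rw [← Matrix.toLin'_apply, Matrix.toLin'_toMatrix']
    rfl
  have hconj : conj g X = Y := by
    ext1 i
    have h1 : (g : Matrix (Fin n) (Fin n) K) * X i = Y i * g := by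
      apply Matrix.toLin'.injective
      refine LinearMap.ext fun x => ?_
      rw [Matrix.toLin'_apply, Matrix.toLin'_apply, ← Matrix.mulVec_mulVec, ← Matrix.mulVec_mulVec,
        hg, hg]
      have h2 : φ ((tupleHom K X (FreeAlgebra.ι K i)).mulVec x)
          = (tupleHom K Y (FreeAlgebra.ι K i)).mulVec (φ x) :=
        φ.map_smul (FreeAlgebra.ι K i) (show Rep X from x)
      simp only [tupleHom, FreeAlgebra.lift_ι_apply] at h2
      exact h2
    change (g : Matrix (Fin n) (Fin n) K) * X i * _ = Y i
    rw [h1, mul_assoc, g.mul_inv, mul_one]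
  refine ⟨Y, ?_, hY⟩
  exact mem_closure_trans hX (hconj ▸ subset_zariskiClosure _ (conj_mem_orbit g X))

end Semisimplification

end MatInv

/-! ### Programs with counted loops -/

namespace ArithRAM

/-- Programs whose only loops are counted loops: `loop i N p` runs `p` for the values
`0, …, N - 1` of the register `i`, where `N` is the content of the register `N`. -/
inductive LProg : Type
  | skip
  | setReg (r : ℕ) (e : IdxExpr)
  | setIdx (a : ℕ) (i e : IdxExpr)
  | setFld (a : ℕ) (i : IdxExpr) (e : FldExpr)
  | seq (p q : LProg)
  | ite (c : Cond) (p q : LProg)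
  | loop (i N : ℕ) (p : LProg)

namespace LProg

/-- Translation into the programs of the machine. -/
def compile : LProg → Prog
  | skip => .skip
  | setReg r e => .setReg r e
  | setIdx a i e => .setIdx a i e
  | setFld a i e => .setFld a i e
  | seq p q => .seq p.compile q.compile
  | ite c p q => .ite c p.compile q.compile
  | loop i N p => .seq (.setReg i (.const 0))
      (.while (.idxLt (.reg i) (.reg N)) (.seq p.compile (.setReg i (.add (.reg i) (.const 1)))))

/-- The registers that a program may change. -/
def regs : LProg → List ℕ
  | skip => []
  | setReg r _ => [r]
  | setIdx _ _ _ => []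
  | setFld _ _ _ => []
  | seq p q => p.regs ++ q.regs
  | ite _ p q => p.regs ++ q.regs
  | loop i _ p => i :: p.regs

/-- The arrays of natural numbers that a program may change. -/
def idxs : LProg → List ℕ
  | skip => []
  | setReg _ _ => []
  | setIdx a _ _ => [a]
  | setFld _ _ _ => []
  | seq p q => p.idxs ++ q.idxs
  | ite _ p q => p.idxs ++ q.idxs
  | loop _ _ p => p.idxs

/-- The arrays of field elements that a program may change. -/
def flds : LProg → List ℕ
  | skip => []
  | setReg _ _ => []
  | setIdx _ _ _ => []
  | setFld a _ _ => [a]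
  | seq p q => p.flds ++ q.flds
  | ite _ p q => p.flds ++ q.flds
  | loop _ _ p => p.flds

/-- The registers that hold the bounds of the loops. -/
def bounds : LProg → List ℕ
  | skip => []
  | setReg _ _ => []
  | setIdx _ _ _ => []
  | setFld _ _ _ => []
  | seq p q => p.bounds ++ q.bounds
  | ite _ p q => p.bounds ++ q.bounds
  | loop _ N p => N :: p.bounds

/-- No loop body changes the counter of its loop. -/
def CountersKept : LProg → Bool
  | skip => true
  | setReg _ _ => true
  | setIdx _ _ _ => true
  | setFld _ _ _ => true
  | seq p q => p.CountersKept && q.CountersKept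
  | ite _ p q => p.CountersKept && q.CountersKept
  | loop i _ p => !(p.regs.contains i) && p.CountersKept

/-- A bound for the running time in terms of a common bound for all loop lengths. Each round of a
loop costs `4` steps for the test and `4` for the counter. -/
noncomputable def timeBound : LProg → Polynomial ℕ
  | skip => 1
  | setReg _ e => Polynomial.C (e.cost + 1)
  | setIdx _ i e => Polynomial.C (i.cost + e.cost + 1)
  | setFld _ i e => Polynomial.C (i.cost + e.cost + 1)
  | seq p q => p.timeBound + q.timeBound
  | ite c p q => Polynomial.C (c.cost + 1) + (p.timeBound + q.timeBound)
  | loop _ _ p => Polynomial.X * (p.timeBound + Polynomial.C 8) + Polynomial.C 6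

variable {K : Type*} [Field K]

/-- `k` rounds of a counted loop with counter `i` and body `f`. The counter is set to the number of
the next round after the body, as the translated program does. -/
def iter (f : Mem K → Mem K) (i : ℕ) : ℕ → Mem K → Mem K
  | 0, s => s.setReg i 0
  | k + 1, s => (f (iter f i k s)).setReg i (k + 1)

open Classical in
/-- The effect of a program on the memory. -/
noncomputable def exec : LProg → Mem K → Mem K
  | skip, s => s
  | setReg r e, s => s.setReg r (e.eval s)
  | setIdx a i e, s => s.setIdx a (i.eval s) (e.eval s)
  | setFld a i e, s => s.setFld a (i.eval s) (e.eval s)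
  | seq p q, s => q.exec (p.exec s)
  | ite c p q, s => if c.holds s then p.exec s else q.exec s
  | loop i N p, s => iter p.exec i (s.reg N) s

end LProg

/-- The states `s` and `s'` agree except in the listed registers and arrays. -/
structure Agree {K : Type*} (R I F : List ℕ) (s s' : Mem K) : Prop where
  reg : ∀ r, r ∉ R → s'.reg r = s.reg r
  idx : ∀ a, a ∉ I → s'.idx a = s.idx a
  fld : ∀ a, a ∉ F → s'.fld a = s.fld a

namespace Agree

variable {K : Type*} {R I F R' I' F' : List ℕ} {s s' s'' : Mem K}

theorem refl (R I F : List ℕ) (s : Mem K) : Agree R I F s s :=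
  ⟨fun _ _ => rfl, fun _ _ => rfl, fun _ _ => rfl⟩

theorem trans (h : Agree R I F s s') (h' : Agree R I F s' s'') : Agree R I F s s'' :=
  ⟨fun r hr => (h'.reg r hr).trans (h.reg r hr), fun a ha => (h'.idx a ha).trans (h.idx a ha),
    fun a ha => (h'.fld a ha).trans (h.fld a ha)⟩

theorem mono (h : Agree R I F s s') (hR : R ⊆ R') (hI : I ⊆ I') (hF : F ⊆ F') :
    Agree R' I' F' s s' :=
  ⟨fun r hr => h.reg r fun h' => hr (hR h'), fun a ha => h.idx a fun h' => ha (hI h'),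
    fun a ha => h.fld a fun h' => ha (hF h')⟩

theorem setReg (s : Mem K) (r v : ℕ) : Agree [r] [] [] s (s.setReg r v) :=
  ⟨fun x hx => Function.update_of_ne (by simpa using hx) _ _, fun _ _ => rfl, fun _ _ => rfl⟩

theorem setIdx (s : Mem K) (a k v : ℕ) : Agree [] [a] [] s (s.setIdx a k v) :=
  ⟨fun _ _ => rfl, fun x hx => Function.update_of_ne (by simpa using hx) _ _, fun _ _ => rfl⟩

theorem setFld (s : Mem K) (a k : ℕ) (v : K) : Agree [] [] [a] s (s.setFld a k v) :=
  ⟨fun _ _ => rfl, fun _ _ => rfl, fun x hx => Function.update_of_ne (by simpa using hx) _ _⟩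

end Agree

namespace Mem

variable {K : Type*} (s : Mem K)

@[simp] theorem setReg_idx (r v : ℕ) : (s.setReg r v).idx = s.idx := rfl
@[simp] theorem setIdx_reg (a k v : ℕ) : (s.setIdx a k v).reg = s.reg := rfl

@[simp] theorem setReg_self (r v : ℕ) : (s.setReg r v).reg r = v := Function.update_self ..

theorem setReg_of_ne {r r' : ℕ} (v : ℕ) (h : r' ≠ r) : (s.setReg r v).reg r' = s.reg r' :=
  Function.update_of_ne h _ _

@[simp] theorem setIdx_self (a k v : ℕ) :
    (s.setIdx a k v).idx a = Function.update (s.idx a) k v := Function.update_self ..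

theorem setIdx_of_ne {a a' : ℕ} (k v : ℕ) (h : a' ≠ a) : (s.setIdx a k v).idx a' = s.idx a' :=
  Function.update_of_ne h _ _

@[simp] theorem setFld_self (a k : ℕ) (v : K) :
    (s.setFld a k v).fld a = Function.update (s.fld a) k v := Function.update_self ..

end Mem

namespace LProg

variable {K : Type*} [Field K]

theorem exec_agree (p : LProg) (s : Mem K) : Agree p.regs p.idxs p.flds s (p.exec s) := by
  induction p generalizing s with
  | skip => exact .refl ..
  | setReg r e => exact .setReg ..
  | setIdx a i e => exact .setIdx ..
  | setFld a i e => exact .setFld ..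
  | seq p q ihp ihq =>
    exact ((ihp s).mono (by simp [regs]) (by simp [idxs]) (by simp [flds])).trans
      ((ihq _).mono (by simp [regs]) (by simp [idxs]) (by simp [flds]))
  | ite c p q ihp ihq =>
    unfold exec
    split
    · exact (ihp s).mono (by simp [regs]) (by simp [idxs]) (by simp [flds])
    · exact (ihq s).mono (by simp [regs]) (by simp [idxs]) (by simp [flds])
  | loop i N p ih =>
    unfold exec
    generalize s.reg N = k
    induction k with
    | zero => exact (Agree.setReg s i 0).mono (by simp [regs]) (by simp) (by simp)
    | succ k ihk =>
      refine ihk.trans (((ih _).mono (by simp [regs]) (by simp [idxs]) (by simp [flds])).trans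
        ((Agree.setReg _ i _).mono (by simp [regs]) (by simp) (by simp)))

theorem iter_agree (p : LProg) (i k : ℕ) (s : Mem K) :
    Agree (i :: p.regs) p.idxs p.flds s (iter p.exec i k s) := by
  induction k with
  | zero => exact (Agree.setReg s i 0).mono (by simp) (by simp) (by simp)
  | succ k ih =>
    exact ih.trans (((exec_agree p _).mono (by simp) (by simp) (by simp)).trans
      ((Agree.setReg _ i _).mono (by simp) (by simp) (by simp)))

theorem iter_reg {K : Type*} (f : Mem K → Mem K) (i k : ℕ) (s : Mem K) : (iter f i k s).reg i = k := by
  cases k <;> exact Mem.setReg_self ..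

/-- Invariants of counted loops. The invariant may not depend on the counter register. -/
theorem exec_loop_induction {i N : ℕ} {p : LProg} {s : Mem K} (Inv : ℕ → Mem K → Prop)
    (hI : ∀ k s' v, Inv k s' → Inv k (s'.setReg i v)) (h0 : Inv 0 s)
    (hs : ∀ k s', k < s.reg N → Agree (i :: p.regs) p.idxs p.flds s s' → s'.reg i = k → Inv k s' →
      Inv (k + 1) (p.exec s')) :
    Inv (s.reg N) ((loop i N p).exec s) := by
  have key : ∀ k ≤ s.reg N, Inv k (iter p.exec i k s) := by
    intro k
    induction k with
    | zero => intro _; exact hI _ _ _ h0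
    | succ k ih =>
      intro hk
      exact hI _ _ _ (hs k _ hk (iter_agree p i k s) (iter_reg ..) (ih (by omega)))
  exact key _ le_rfl

/-- The translated program computes `exec`, in time at most `timeBound`. -/
theorem runs_compile (p : LProg) (hp : p.CountersKept = true) (hb : ∀ N ∈ p.bounds, N ∉ p.regs)
    (B : ℕ) (s : Mem K) (hs : ∀ N ∈ p.bounds, s.reg N ≤ B) :
    ∃ t, Runs p.compile s t (p.exec s) ∧ t ≤ p.timeBound.eval B := by
  induction p generalizing s with
  | skip => exact ⟨_, .skip s, by simp [timeBound]⟩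
  | setReg r e => exact ⟨_, .setReg .., by simp [timeBound]⟩
  | setIdx a i e => exact ⟨_, .setIdx .., by simp [timeBound]⟩
  | setFld a i e => exact ⟨_, .setFld .., by simp [timeBound]⟩
  | seq p q ihp ihq =>
    simp only [CountersKept, Bool.and_eq_true] at hp
    simp only [bounds, regs, List.mem_append, not_or] at hb hs
    obtain ⟨t, h, ht⟩ := ihp hp.1 (fun N hN => (hb N (.inl hN)).1) s fun N hN => hs N (.inl hN)
    obtain ⟨t', h', ht'⟩ := ihq hp.2 (fun N hN => (hb N (.inr hN)).2) (p.exec s) fun N hN => by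
      rw [(exec_agree p s).reg N (hb N (.inr hN)).1]; exact hs N (.inr hN)
    exact ⟨_, .seq h h', by simp only [timeBound, Polynomial.eval_add]; omega⟩
  | ite c p q ihp ihq =>
    simp only [CountersKept, Bool.and_eq_true] at hp
    simp only [bounds, regs, List.mem_append, not_or] at hb hs
    obtain ⟨t, h, ht⟩ := ihp hp.1 (fun N hN => (hb N (.inl hN)).1) s fun N hN => hs N (.inl hN)
    obtain ⟨t', h', ht'⟩ := ihq hp.2 (fun N hN => (hb N (.inr hN)).2) s fun N hN => hs N (.inr hN)
    by_cases hc : c.holds s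
    · rw [show (ite c p q).exec s = _ from if_pos hc]
      refine ⟨_, .ite_true hc h, ?_⟩
      simp only [timeBound, Polynomial.eval_add, Polynomial.eval_C]; omega
    · rw [show (ite c p q).exec s = _ from if_neg hc]
      refine ⟨_, .ite_false hc h', ?_⟩
      simp only [timeBound, Polynomial.eval_add, Polynomial.eval_C]; omega
  | loop i N p ih =>
    simp only [CountersKept, Bool.and_eq_true, Bool.not_eq_true', List.contains_eq_mem,
      decide_eq_false_iff_not] at hp
    simp only [bounds, regs, List.mem_cons, forall_eq_or_imp, not_or] at hb hs
    obtain ⟨⟨hNi, hNp⟩, hb⟩ := hb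
    obtain ⟨hsN, hs⟩ := hs
    -- the remaining `d` rounds
    have key : ∀ d k, k + d = s.reg N → ∃ t,
        Runs (.while (.idxLt (.reg i) (.reg N))
          (.seq p.compile (.setReg i (.add (.reg i) (.const 1))))) (iter p.exec i k s) t
          (iter p.exec i (s.reg N) s) ∧ t ≤ d * (p.timeBound.eval B + 8) + 4 := by
      intro d
      induction d with
      | zero =>
        intro k hk
        rw [Nat.add_zero] at hk
        subst hk
        refine ⟨_, .while_false ?_, ?_⟩
        · simp only [Cond.holds, IdxExpr.eval, iter_reg,
            (iter_agree p i _ s).reg N (by simp [hNi, hNp]), lt_irrefl, not_false_iff]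
        · simp [Cond.cost, IdxExpr.cost]
      | succ d ihd =>
        intro k hk
        obtain ⟨t, ht, hle⟩ := ih hp.2 (fun M hM => (hb M hM).2) (iter p.exec i k s) fun M hM => by
          rw [(iter_agree p i _ s).reg M (by simp [(hb M hM).1, (hb M hM).2])]; exact hs M hM
        obtain ⟨t', ht', hle'⟩ := ihd (k + 1) (by omega)
        have hreg : (p.exec (iter p.exec i k s)).reg i = k := by
          rw [(exec_agree p _).reg i hp.1, iter_reg]
        have hstep := Runs.setReg (p.exec (iter p.exec i k s)) i (.add (.reg i) (.const 1))
        simp only [IdxExpr.eval, hreg] at hstep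
        refine ⟨_, .while_true ?_ (.seq ht hstep) ht', ?_⟩
        · simp only [Cond.holds, IdxExpr.eval, iter_reg,
            (iter_agree p i _ s).reg N (by simp [hNi, hNp])]
          omega
        · simp only [Cond.cost, IdxExpr.cost]
          rw [Nat.add_mul]
          omega
    obtain ⟨t, ht, hle⟩ := key (s.reg N) 0 (by omega)
    refine ⟨_, .seq (.setReg s i (.const 0)) ht, ?_⟩
    have h1 : s.reg N * (p.timeBound.eval B + 8) ≤ B * (p.timeBound.eval B + 8) :=
      Nat.mul_le_mul_right _ hsN
    simp only [timeBound, Polynomial.eval_add, Polynomial.eval_mul, Polynomial.eval_X,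
      Polynomial.eval_C, IdxExpr.cost]
    omega

section Patterns

variable {s : Mem K} {i N : ℕ} {p : LProg}

/-- A loop that writes one cell of the array `a` in each round. -/
theorem exec_loop_fld (a : ℕ) (pos : ℕ → ℕ) (f : ℕ → K)
    (hinj : ∀ j < s.reg N, ∀ k < s.reg N, pos j = pos k → j = k)
    (h : ∀ k s', k < s.reg N → Agree (i :: p.regs) p.idxs p.flds s s' → s'.reg i = k →
      s'.fld a (pos k) = s.fld a (pos k) →
      (∀ x, (∀ j < s.reg N, x ≠ pos j) → s'.fld a x = s.fld a x) →
      (p.exec s').fld a = Function.update (s'.fld a) (pos k) (f k)) :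
    (∀ k < s.reg N, ((loop i N p).exec s).fld a (pos k) = f k) ∧
    ∀ x, (∀ j < s.reg N, x ≠ pos j) → ((loop i N p).exec s).fld a x = s.fld a x := by
  have key := exec_loop_induction (s := s) (i := i) (N := N) (p := p)
    (fun k s' => (∀ j < k, k ≤ s.reg N → s'.fld a (pos j) = f j) ∧
      (∀ j, k ≤ j → j < s.reg N → s'.fld a (pos j) = s.fld a (pos j)) ∧
      ∀ x, (∀ j < s.reg N, x ≠ pos j) → s'.fld a x = s.fld a x)
    (fun _ _ _ h => h) ⟨fun _ h => by omega, fun _ _ _ => rfl, fun _ _ => rfl⟩ ?_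
  · exact ⟨fun k hk => key.1 k hk le_rfl, key.2.2⟩
  · rintro k s' hk hA hi ⟨h1, h2, h3⟩
    have hu := h k s' hk hA hi (h2 k le_rfl hk) h3
    refine ⟨fun j hj _ => ?_, fun j hj hj' => ?_, fun x hx => ?_⟩
    · rw [hu]
      by_cases hjk : j = k
      · subst hjk; exact Function.update_self ..
      · rw [Function.update_of_ne fun he => hjk (hinj j (by omega) k hk he)]
        exact h1 j (by omega) (by omega)
    · rw [hu, Function.update_of_ne fun he => by have := hinj j hj' k hk he; omega]
      exact h2 j (by omega) hj'
    · rw [hu, Function.update_of_ne (hx k hk)]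
      exact h3 x hx

/-- A loop that writes one cell of the array `a` of natural numbers in each round. -/
theorem exec_loop_idx (a : ℕ) (pos : ℕ → ℕ) (f : ℕ → ℕ)
    (hinj : ∀ j < s.reg N, ∀ k < s.reg N, pos j = pos k → j = k)
    (h : ∀ k s', k < s.reg N → Agree (i :: p.regs) p.idxs p.flds s s' → s'.reg i = k →
      (∀ x, (∀ j < s.reg N, x ≠ pos j) → s'.idx a x = s.idx a x) →
      (p.exec s').idx a = Function.update (s'.idx a) (pos k) (f k)) :
    (∀ k < s.reg N, ((loop i N p).exec s).idx a (pos k) = f k) ∧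
    ∀ x, (∀ j < s.reg N, x ≠ pos j) → ((loop i N p).exec s).idx a x = s.idx a x := by
  have key := exec_loop_induction (s := s) (i := i) (N := N) (p := p)
    (fun k s' => (∀ j < k, k ≤ s.reg N → s'.idx a (pos j) = f j) ∧
      ∀ x, (∀ j < s.reg N, x ≠ pos j) → s'.idx a x = s.idx a x)
    (fun _ _ _ h => h) ⟨fun _ h => by omega, fun _ _ => rfl⟩ ?_
  · exact ⟨fun k hk => key.1 k hk le_rfl, key.2⟩
  · rintro k s' hk hA hi ⟨h1, h3⟩
    have hu := h k s' hk hA hi h3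
    refine ⟨fun j hj _ => ?_, fun x hx => ?_⟩
    · rw [hu]
      by_cases hjk : j = k
      · subst hjk; exact Function.update_self ..
      · rw [Function.update_of_ne fun he => hjk (hinj j (by omega) k hk he)]
        exact h1 j (by omega) (by omega)
    · rw [hu, Function.update_of_ne (hx k hk)]
      exact h3 x hx

/-- Accumulation of a sum in the cell `0` of the array `a`; the loop body `p` adds one summand. -/
def accumulate (a i N : ℕ) (p : LProg) : LProg :=
  seq (setFld a (.const 0) .zero) (loop i N p)

theorem exec_accumulate (a : ℕ) (f : ℕ → K)
    (h : ∀ k s', k < s.reg N → Agree (i :: p.regs) p.idxs (a :: p.flds) s s' → s'.reg i = k →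
      (p.exec s').fld a 0 = s'.fld a 0 + f k) :
    ((accumulate a i N p).exec s).fld a 0 = ∑ k ∈ Finset.range (s.reg N), f k := by
  have key := exec_loop_induction (s := (setFld a (.const 0) .zero).exec s) (i := i) (N := N)
    (p := p) (fun k s' => s'.fld a 0 = ∑ k ∈ Finset.range k, f k) (fun _ _ _ h => h)
    (by simp [exec, FldExpr.eval, IdxExpr.eval]) ?_
  · exact key
  · intro k s' hk hA hi hk'
    rw [h k s' hk (Agree.trans ((Agree.setFld s a 0 0).mono (by simp) (by simp) (by simp))
      (hA.mono (by simp) (by simp) (by simp))) hi, hk', Finset.sum_range_succ]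

end Patterns

end LProg

end ArithRAM

/-! ### Gaussian elimination -/

section Echelon

variable {K : Type*} [Field K] {D : ℕ}

/-- Rows in echelon form: the leading entry of row `p`, if the row is not zero, is at
position `p`. Rows are stored at the position of their leading entry, so a zero row is a free
place. -/
structure IsEchelon (E : Fin D → Fin D → K) : Prop where
  lower : ∀ p q, q < p → E p q = 0
  zero : ∀ p, E p p = 0 → E p = 0

/-- The number of nonzero rows of an echelon form. -/
noncomputable def echelonRank (E : Fin D → Fin D → K) : ℕ :=
  by classical exact (Finset.univ.filter fun p => E p p ≠ 0).card

theorem echelonRank_le (E : Fin D → Fin D → K) : echelonRank E ≤ D := by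
  classical
  exact (Finset.card_filter_le _ _).trans (by simp)

/-- A vector whose leading entry is at a free place is independent of the rows. -/
theorem IsEchelon.notMem_span {E : Fin D → Fin D → K} (hE : IsEchelon E) {v : Fin D → K}
    {p : Fin D} (hp : E p p = 0) (hv : ∀ q < p, v q = 0) (hvp : v p ≠ 0) :
    v ∉ Submodule.span K (Set.range E) := by
  intro hmem
  obtain ⟨c, rfl⟩ := (Submodule.mem_span_range_iff_exists_fun K).mp hmem
  have hc : ∀ q < p, c q • E q = 0 := by
    intro q
    induction q using WellFoundedLT.induction with
    | ind q ih =>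
      intro hq
      have h1 := hv q hq
      rw [Finset.sum_apply, Finset.sum_eq_single q] at h1
      · rcases (show c q = 0 ∨ E q q = 0 by simpa using h1) with h2 | h2
        · rw [h2, zero_smul]
        · rw [hE.zero q h2, smul_zero]
      · intro r _ hr
        rcases lt_or_gt_of_ne hr with h2 | h2
        · rw [ih r h2 (h2.trans hq), Pi.zero_apply]
        · simp [hE.lower r q h2]
      · simp
  apply hvp
  rw [Finset.sum_apply]
  refine Finset.sum_eq_zero fun r _ => ?_
  rcases lt_trichotomy r p with h | rfl | h
  · rw [hc r h, Pi.zero_apply]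
  · simp [hp]
  · simp [hE.lower r p h]

/-- The state of the reduction of `v₀` modulo the echelon form `E₀` before position `k`: either
`v` is congruent to `v₀` and vanishes before `k`, or a new row has been stored and `v` is zero. -/
def Reduction (E₀ : Fin D → Fin D → K) (v₀ : Fin D → K) (k : ℕ) (E : Fin D → Fin D → K)
    (v : Fin D → K) (flag : ℕ) : Prop :=
  (flag = 0 ∧ E = E₀ ∧ v₀ - v ∈ Submodule.span K (Set.range E₀) ∧
    ∀ q : Fin D, (q : ℕ) < k → v q = 0) ∨
  (flag = 1 ∧ v = 0 ∧ ∃ (p : Fin D) (v₁ : Fin D → K), E₀ p p = 0 ∧ (∀ q < p, v₁ q = 0) ∧ v₁ p ≠ 0 ∧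
    v₀ - v₁ ∈ Submodule.span K (Set.range E₀) ∧ E = Function.update E₀ p v₁)

theorem Reduction.start (E₀ : Fin D → Fin D → K) (v₀ : Fin D → K) :
    Reduction E₀ v₀ 0 E₀ v₀ 0 :=
  Or.inl ⟨rfl, rfl, by simp, fun _ h => absurd h (Nat.not_lt_zero _)⟩

/-- Elimination at position `k`. If row `k` is zero then the junk value `v k / 0 = 0` leaves the
vector unchanged. If a row has already been stored, the vector is zero and stays so. -/
theorem Reduction.step {E₀ E : Fin D → Fin D → K} {v₀ v v' : Fin D → K} {flag : ℕ} {k : Fin D}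
    (hE₀ : IsEchelon E₀) (h : Reduction E₀ v₀ k E v flag)
    (hv' : v' = v - (v k / E k k) • E k) :
    (v' k = 0 → Reduction E₀ v₀ (k + 1) E v' flag) ∧
    (v' k ≠ 0 → Reduction E₀ v₀ (k + 1) (Function.update E k v') 0 1) := by
  rcases h with ⟨rfl, rfl, hmem, hz⟩ | ⟨rfl, rfl, p, v₁, hp, hq, hne, hmem, rfl⟩
  · have hmem' : v₀ - v' ∈ Submodule.span K (Set.range E) := by
      have : v₀ - v' = (v₀ - v) + (v k / E k k) • E k := by rw [hv']; abel
      rw [this]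
      exact Submodule.add_mem _ hmem (Submodule.smul_mem _ _ (Submodule.subset_span ⟨k, rfl⟩))
    have hz' : ∀ q < k, v' q = 0 := by
      intro q hq
      simp [hv', hz q hq, hE₀.lower k q hq]
    refine ⟨fun h0 => Or.inl ⟨rfl, rfl, hmem', fun q hq => ?_⟩,
      fun h0 => Or.inr ⟨rfl, rfl, k, v', ?_,
      hz', h0, hmem', rfl⟩⟩
    · rcases (Nat.lt_succ_iff_lt_or_eq.mp hq) with h | h
      · exact hz' q h
      · rw [Fin.ext h]; exact h0
    · by_contra hk
      exact h0 (by simp [hv', div_mul_cancel₀ _ hk])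
  · have hv0 : v' = 0 := by rw [hv']; simp
    refine ⟨fun _ => Or.inr ⟨rfl, hv0, p, v₁, hp, hq, hne, hmem, rfl⟩, fun h0 => ?_⟩
    exact absurd (by rw [hv0]; rfl) h0

theorem Reduction.finish {E₀ E : Fin D → Fin D → K} {v₀ v : Fin D → K} {flag : ℕ}
    (hE₀ : IsEchelon E₀) (h : Reduction E₀ v₀ D E v flag) :
    (flag = 0 ∧ E = E₀ ∧ v₀ ∈ Submodule.span K (Set.range E₀)) ∨
    (flag = 1 ∧ v₀ ∉ Submodule.span K (Set.range E₀) ∧ IsEchelon E ∧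
      echelonRank E = echelonRank E₀ + 1 ∧
      Submodule.span K (Set.range E) = Submodule.span K (insert v₀ (Set.range E₀))) := by
  classical
  rcases h with ⟨rfl, rfl, hmem, hz⟩ | ⟨rfl, rfl, p, v₁, hp, hq, hne, hmem, rfl⟩
  · refine Or.inl ⟨rfl, rfl, ?_⟩
    have hv : v = 0 := funext fun q => hz q q.2
    rwa [hv, sub_zero] at hmem
  · have hp0 := hE₀.zero p hp
    refine Or.inr ⟨rfl, fun h0 => hE₀.notMem_span hp hq hne ?_, ⟨fun r q hr => ?_, fun r hr => ?_⟩,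
      ?_, ?_⟩
    · simpa using Submodule.sub_mem _ h0 hmem
    · by_cases hrp : r = p
      · subst hrp; rw [Function.update_self]; exact hq q hr
      · rw [Function.update_of_ne hrp]; exact hE₀.lower r q hr
    · by_cases hrp : r = p
      · subst hrp; rw [Function.update_self] at hr; exact absurd hr hne
      · rw [Function.update_of_ne hrp] at hr ⊢; exact hE₀.zero r hr
    · unfold echelonRank
      have : (Finset.univ.filter fun r => (Function.update E₀ p v₁) r r ≠ 0)
          = insert p (Finset.univ.filter fun r => E₀ r r ≠ 0) := by
        ext r
        by_cases hrp : r = p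
        · subst hrp; simp [hne]
        · simp [hrp]
      rw [this, Finset.card_insert_of_notMem (by simp [hp])]
    · have hv₁ : v₁ ∈ Submodule.span K (insert v₀ (Set.range E₀)) := by
        have : v₁ = v₀ - (v₀ - v₁) := by abel
        rw [this]
        exact Submodule.sub_mem _ (Submodule.subset_span (Set.mem_insert _ _))
          (Submodule.span_mono (Set.subset_insert _ _) hmem)
      have hle : Submodule.span K (Set.range E₀)
          ≤ Submodule.span K (Set.range (Function.update E₀ p v₁)) := by
        rw [Submodule.span_le]
        rintro _ ⟨r, rfl⟩
        by_cases hrp : r = p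
        · subst hrp; rw [hp0]; exact Submodule.zero_mem _
        · exact Submodule.subset_span ⟨r, Function.update_of_ne hrp _ _⟩
      apply le_antisymm
      · rw [Submodule.span_le]
        rintro _ ⟨r, rfl⟩
        by_cases hrp : r = p
        · subst hrp; rw [Function.update_self]; exact hv₁
        · rw [Function.update_of_ne hrp]
          exact Submodule.subset_span (Set.mem_insert_of_mem _ ⟨r, rfl⟩)
      · rw [Submodule.span_le, Set.insert_subset_iff]
        refine ⟨?_, fun x hx => hle (Submodule.subset_span hx)⟩
        have : v₀ = v₁ + (v₀ - v₁) := by abel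
        rw [this]
        exact Submodule.add_mem _ (Submodule.subset_span ⟨p, Function.update_self ..⟩) (hle hmem)

end Echelon

namespace MatInv

/-! ### Breadth-first search for pivots -/

section Queue

variable {K : Type*} [Field K] {m : ℕ} {ι : Type*} [Fintype ι] [DecidableEq ι]
  {C : Fin m → Matrix ι ι K}

/-- The shortlex order on words. -/
abbrev WordLT {m : ℕ} (u v : List (Fin m)) : Prop := List.Shortlex (· < ·) u v

theorem wordLT_asymm {u v : List (Fin m)} (h : WordLT u v) : ¬ WordLT v u :=
  Std.Asymm.asymm _ _ h

theorem wordLT_trichotomy (u v : List (Fin m)) : WordLT u v ∨ u = v ∨ WordLT v u := by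
  by_contra! h
  exact h.2.1 (Std.Trichotomous.trichotomous (r := WordLT) u v h.1 h.2.2)

theorem wordLT_append_singleton (x : List (Fin m)) (j : Fin m) : WordLT x (x ++ [j]) :=
  List.Shortlex.of_length_lt (by simp)

theorem wordLT_snoc_snoc {x y : List (Fin m)} (h : WordLT x y) (i j : Fin m) :
    WordLT (x ++ [i]) (y ++ [j]) := by
  unfold WordLT at h ⊢
  rw [List.shortlex_def] at h ⊢
  rcases h with h | ⟨h, h'⟩
  · left; simpa using h
  · right
    refine ⟨by simpa using h, ?_⟩
    induction h' with
    | nil => simp at h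
    | cons _ ih => exact List.Lex.cons (ih (by simpa using h))
    | rel hr => exact List.Lex.rel hr

theorem wordLT_snoc_right (x : List (Fin m)) {i j : Fin m} (h : i < j) :
    WordLT (x ++ [i]) (x ++ [j]) :=
  List.Shortlex.append_left ((List.shortlex_singleton_iff i j).mpr h) x

theorem wordLT_snoc_iff {x y : List (Fin m)} {i j : Fin m} :
    WordLT (x ++ [i]) (y ++ [j]) ↔ WordLT x y ∨ x = y ∧ i < j := by
  refine ⟨fun h => ?_, ?_⟩
  · rcases wordLT_trichotomy x y with h1 | rfl | h1
    · exact Or.inl h1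
    · refine Or.inr ⟨rfl, ?_⟩
      rcases lt_trichotomy i j with h2 | rfl | h2
      · exact h2
      · exact absurd h (wordLT_asymm h)
      · exact absurd h (wordLT_asymm (wordLT_snoc_right x h2))
    · exact absurd h (wordLT_asymm (wordLT_snoc_snoc h1 _ _))
  · rintro (h | ⟨rfl, h⟩)
    · exact wordLT_snoc_snoc h _ _
    · exact wordLT_snoc_right x h

theorem wordProd_snoc (C : Fin m → Matrix ι ι K) (x : List (Fin m)) (j : Fin m) :
    wordProd C (x ++ [j]) = wordProd C x * C j := by
  simp [wordProd]

/-- Prefixes of pivots are pivots. -/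
theorem IsPivot.of_snoc {x : List (Fin m)} {j : Fin m} (h : IsPivot C (x ++ [j])) :
    IsPivot C x := by
  unfold IsPivot at *
  intro hx
  apply h
  have h1 := Submodule.mem_map_of_mem (f := LinearMap.mulRight K (C j)) hx
  rw [Submodule.map_span] at h1
  rw [wordProd_snoc]
  refine Submodule.span_mono ?_ h1
  rintro _ ⟨_, ⟨u, hu, rfl⟩, rfl⟩
  exact ⟨u ++ [j], wordLT_snoc_snoc hu j j, wordProd_snoc C u j⟩

/-- The queue `Q` of pivots when all extensions `Q[h'] ++ [j]` with `(h', j)` lexicographically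
smaller than `(h, i)` have been examined. -/
structure PivotQueue (C : Fin m → Matrix ι ι K) (Q : List (List (Fin m))) (h i : ℕ) : Prop where
  sorted : Q.Pairwise WordLT
  pivot : ∀ u ∈ Q, IsPivot C u
  origin : ∀ u ∈ Q, u = [] ∨ ∃ (h' : ℕ) (x : List (Fin m)) (j : Fin m),
    Q[h']? = some x ∧ u = x ++ [j] ∧ (h' < h ∨ h' = h ∧ (j : ℕ) < i)
  nil : IsPivot C [] → [] ∈ Q
  done : ∀ (h' : ℕ) (x : List (Fin m)) (j : Fin m), Q[h']? = some x →
    (h' < h ∨ h' = h ∧ (j : ℕ) < i) → IsPivot C (x ++ [j]) → x ++ [j] ∈ Q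

namespace PivotQueue

variable {Q : List (List (Fin m))} {h i : ℕ}

theorem lt_of_wordLT (hQ : Q.Pairwise WordLT) {a b : ℕ} {x y : List (Fin m)}
    (ha : Q[a]? = some x) (hb : Q[b]? = some y) (hxy : WordLT x y) : a < b := by
  obtain ⟨ha', rfl⟩ := List.getElem?_eq_some_iff.mp ha
  obtain ⟨hb', rfl⟩ := List.getElem?_eq_some_iff.mp hb
  rcases lt_trichotomy a b with hab | rfl | hab
  · exact hab
  · exact absurd hxy (wordLT_asymm hxy)
  · exact absurd (List.pairwise_iff_getElem.mp hQ b a hb' ha' hab) (wordLT_asymm hxy)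

theorem wordLT_of_lt (hQ : Q.Pairwise WordLT) {a b : ℕ} {x y : List (Fin m)}
    (ha : Q[a]? = some x) (hb : Q[b]? = some y) (hab : a < b) : WordLT x y := by
  obtain ⟨ha', rfl⟩ := List.getElem?_eq_some_iff.mp ha
  obtain ⟨hb', rfl⟩ := List.getElem?_eq_some_iff.mp hb
  exact List.pairwise_iff_getElem.mp hQ a b ha' hb' hab

/-- Prefixes precede their extensions in the queue. -/
theorem length_le (q : PivotQueue C Q h i) {k : ℕ} {x : List (Fin m)} (hk : Q[k]? = some x) :
    x.length ≤ k := by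
  induction k using Nat.strong_induction_on generalizing x with
  | _ k ih =>
    rcases q.origin x (List.mem_of_getElem? hk) with rfl | ⟨h', y, j, hy, rfl, -⟩
    · simp
    · have hlt := lt_of_wordLT q.sorted hy hk (wordLT_append_singleton y j)
      have := ih h' hlt hy
      simp only [List.length_append, List.length_singleton]
      omega

theorem start_of_isPivot (h0 : IsPivot C []) : PivotQueue C [[]] 0 0 where
  sorted := by simp
  pivot := by simpa using h0
  origin := by simp
  nil := by simp
  done := by simp

theorem start_of_not_isPivot (h0 : ¬ IsPivot C []) : PivotQueue C [] 0 0 where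
  sorted := by simp
  pivot := by simp
  origin := by simp
  nil h := absurd h h0
  done := by simp

variable {x : List (Fin m)} {j : Fin m}

theorem mem_wordLT (q : PivotQueue C Q h i) (hx : Q[h]? = some x) (hj : (j : ℕ) = i)
    {u : List (Fin m)} (hu : u ∈ Q) : WordLT u (x ++ [j]) := by
  rcases q.origin u hu with rfl | ⟨h', y, k, hy, rfl, hlt⟩
  · exact List.Shortlex.of_length_lt (by simp)
  · rw [wordLT_snoc_iff]
    rcases hlt with hlt | ⟨rfl, hlt⟩
    · exact Or.inl (wordLT_of_lt q.sorted hy hx hlt)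
    · exact Or.inr ⟨Option.some.inj (hy.symm.trans hx), Fin.lt_def.mpr (by omega)⟩

theorem mem_of_wordLT (q : PivotQueue C Q h i) (hx : Q[h]? = some x) (hj : (j : ℕ) = i)
    {u : List (Fin m)} (hu : IsPivot C u) (hlt : WordLT u (x ++ [j])) : u ∈ Q := by
  induction u using shortlex_wf.induction with
  | _ u ih =>
  rcases List.eq_nil_or_concat' u with rfl | ⟨y, k, rfl⟩
  · exact q.nil hu
  · have hyQ : y ∈ Q := ih y (wordLT_append_singleton y k) hu.of_snoc
      (shortlex_trans (wordLT_append_singleton y k) hlt)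
    obtain ⟨a, ha⟩ := List.mem_iff_getElem?.mp hyQ
    refine q.done a y k ha ?_ hu
    rcases wordLT_snoc_iff.mp hlt with h1 | ⟨rfl, h1⟩
    · exact Or.inl (lt_of_wordLT q.sorted ha hx h1)
    · obtain ⟨ha', hae⟩ := List.getElem?_eq_some_iff.mp ha
      obtain ⟨hx', hxe⟩ := List.getElem?_eq_some_iff.mp hx
      have : a = h := by
        have hnd : Q.Nodup := q.sorted.imp fun {a b} hab hEq => by
          subst hEq; exact wordLT_asymm hab hab
        exact (hnd.getElem_inj_iff (hi := ha') (hj := hx')).mp (hae.trans hxe.symm)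
      rw [Fin.lt_def] at h1
      exact Or.inr ⟨this, by omega⟩

/-- The words of the queue span the same space as all words smaller than the next candidate. -/
theorem isPivot_iff (q : PivotQueue C Q h i) (hx : Q[h]? = some x) (hj : (j : ℕ) = i) :
    IsPivot C (x ++ [j]) ↔
      wordProd C (x ++ [j]) ∉ Submodule.span K (wordProd C '' {u | u ∈ Q}) := by
  unfold IsPivot
  have : Submodule.span K {M | ∃ u : List (Fin m), List.Shortlex (· < ·) u (x ++ [j]) ∧
      wordProd C u = M} = Submodule.span K (wordProd C '' {u | u ∈ Q}) := by
    apply le_antisymm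
    · rw [Submodule.span_le]
      rintro _ ⟨u, hu, rfl⟩
      refine Submodule.span_mono (Set.image_mono ?_) (wordProd_mem_span_pivots C u)
      rintro v ⟨hv, hvu⟩
      refine q.mem_of_wordLT hx hj hv ?_
      rcases hvu with rfl | hvu
      · exact hu
      · exact shortlex_trans hvu hu
    · exact Submodule.span_mono (by rintro _ ⟨u, hu, rfl⟩; exact ⟨u, q.mem_wordLT hx hj hu, rfl⟩)
  rw [this]

theorem push (q : PivotQueue C Q h i) (hx : Q[h]? = some x) (hj : (j : ℕ) = i)
    (hp : IsPivot C (x ++ [j])) : PivotQueue C (Q ++ [x ++ [j]]) h (i + 1) := by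
  have hh : h < Q.length := (List.getElem?_eq_some_iff.mp hx).1
  have hget : ∀ {a : ℕ} {y : List (Fin m)}, a < Q.length →
      ((Q ++ [x ++ [j]])[a]? = some y ↔ Q[a]? = some y) := fun ha => by
    rw [List.getElem?_append_left ha]
  refine ⟨?_, ?_, ?_, ?_, ?_⟩
  · rw [List.pairwise_append]
    refine ⟨q.sorted, by simp, fun u hu v hv => ?_⟩
    rw [List.mem_singleton.mp hv]
    exact q.mem_wordLT hx hj hu
  · intro u hu
    rcases List.mem_append.mp hu with hu | hu
    · exact q.pivot u hu
    · rw [List.mem_singleton.mp hu]; exact hp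
  · intro u hu
    rcases List.mem_append.mp hu with hu | hu
    · rcases q.origin u hu with rfl | ⟨h', y, k, hy, rfl, hlt⟩
      · exact Or.inl rfl
      · exact Or.inr ⟨h', y, k, (hget (List.getElem?_eq_some_iff.mp hy).1).mpr hy, rfl, by omega⟩
    · rw [List.mem_singleton.mp hu]
      exact Or.inr ⟨h, x, j, (hget hh).mpr hx, rfl, by omega⟩
  · exact fun h0 => List.mem_append_left _ (q.nil h0)
  · intro h' y k hy hlt hpiv
    rw [hget (by omega)] at hy
    by_cases heq : h' = h ∧ (k : ℕ) = i
    · obtain ⟨rfl, hk⟩ := heq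
      rw [Option.some.inj (hy.symm.trans hx), Fin.ext (hk.trans hj.symm)]
      exact List.mem_append_right _ (List.mem_singleton.mpr rfl)
    · exact List.mem_append_left _ (q.done h' y k hy (by omega) hpiv)

theorem skip (q : PivotQueue C Q h i) (hx : Q[h]? = some x) (hj : (j : ℕ) = i)
    (hp : ¬ IsPivot C (x ++ [j])) : PivotQueue C Q h (i + 1) := by
  refine ⟨q.sorted, q.pivot, ?_, q.nil, ?_⟩
  · intro u hu
    rcases q.origin u hu with rfl | ⟨h', y, k, hy, rfl, hlt⟩
    · exact Or.inl rfl
    · exact Or.inr ⟨h', y, k, hy, rfl, by omega⟩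
  · intro h' y k hy hlt hpiv
    by_cases heq : h' = h ∧ (k : ℕ) = i
    · obtain ⟨rfl, hk⟩ := heq
      rw [Option.some.inj (hy.symm.trans hx), Fin.ext (hk.trans hj.symm)] at hpiv
      exact absurd hpiv hp
    · exact q.done h' y k hy (by omega) hpiv

theorem next (q : PivotQueue C Q h m) : PivotQueue C Q (h + 1) 0 := by
  refine ⟨q.sorted, q.pivot, ?_, q.nil, ?_⟩
  · intro u hu
    rcases q.origin u hu with rfl | ⟨h', y, k, hy, rfl, hlt⟩
    · exact Or.inl rfl
    · exact Or.inr ⟨h', y, k, hy, rfl, by omega⟩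
  · intro h' y k hy hlt hpiv
    have := k.2
    exact q.done h' y k hy (by omega) hpiv

theorem next_of_length_le (q : PivotQueue C Q h 0) (hh : Q.length ≤ h) :
    PivotQueue C Q (h + 1) 0 := by
  refine ⟨q.sorted, q.pivot, ?_, q.nil, ?_⟩
  · intro u hu
    rcases q.origin u hu with rfl | ⟨h', y, k, hy, rfl, hlt⟩
    · exact Or.inl rfl
    · exact Or.inr ⟨h', y, k, hy, rfl, by omega⟩
  · intro h' y k hy hlt hpiv
    have := (List.getElem?_eq_some_iff.mp hy).1
    exact q.done h' y k hy (by omega) hpiv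

theorem complete (q : PivotQueue C Q h 0) (hh : Q.length ≤ h) {u : List (Fin m)}
    (hu : IsPivot C u) : u ∈ Q := by
  induction u using shortlex_wf.induction with
  | _ u ih =>
  rcases List.eq_nil_or_concat' u with rfl | ⟨y, k, rfl⟩
  · exact q.nil hu
  · obtain ⟨a, ha⟩ := List.mem_iff_getElem?.mp (ih y (wordLT_append_singleton y k) hu.of_snoc)
    have := (List.getElem?_eq_some_iff.mp ha).1
    exact q.done a y k ha (by omega) hu

end PivotQueue

end Queue

/-! ### The inverse of the characteristic polynomial as a power series -/

section Series

open PowerSeries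

variable {K : Type*} [Field K] {n : ℕ}

/-- The first `k` rows of `-M`, followed by zero rows. -/
def negTrunc (M : Matrix (Fin n) (Fin n) K) (k : ℕ) : Matrix (Fin n) (Fin n) K :=
  Matrix.of fun a b => if (a : ℕ) < k then -M a b else 0

/-- The power series `∑ (N ^ l)_{kk} t ^ l`, where `N` consists of the rows up to `k` of `-M`. -/
noncomputable def diagSeries (M : Matrix (Fin n) (Fin n) K) (k : ℕ) : K⟦X⟧ :=
  if h : k < n then PowerSeries.mk fun l => (negTrunc M (k + 1) ^ l) ⟨k, h⟩ ⟨k, h⟩ else 1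

/-- The product of the first `k` series `diagSeries M`. -/
noncomputable def detSeries (M : Matrix (Fin n) (Fin n) K) (k : ℕ) : K⟦X⟧ :=
  ∏ j ∈ Finset.range k, diagSeries M j

/-- The determinant of `1 - t N` as a power series. -/
noncomputable def seriesDet (N : Matrix (Fin n) (Fin n) K) : K⟦X⟧ :=
  (1 - (X : K⟦X⟧) • N.map C).det

/-- The resolvent identity `(1 - t N) ∑ N ^ l t ^ l = 1`. -/
theorem one_sub_mul_resolvent (N : Matrix (Fin n) (Fin n) K) :
    (1 - (X : K⟦X⟧) • N.map C) *
      (Matrix.of fun a b => PowerSeries.mk fun l => (N ^ l) a b) = 1 := by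
  ext a b l
  rw [sub_mul, one_mul, Matrix.smul_mul, Matrix.sub_apply, Matrix.smul_apply, smul_eq_mul, map_sub]
  cases l with
  | zero =>
    by_cases hab : a = b
    · subst hab; simp
    · simp [hab]
  | succ l =>
    have h1 : (coeff (l + 1)) ((1 : Matrix (Fin n) (Fin n) K⟦X⟧) a b) = 0 := by
      by_cases hab : a = b
      · subst hab; simp [coeff_one]
      · simp [hab]
    rw [h1, mul_comm X, coeff_succ_mul_X, sub_eq_zero]
    simp [Matrix.mul_apply, pow_succ']

/-- Cramer's rule: a diagonal entry of the resolvent is a quotient of two determinants. -/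
theorem seriesDet_mul_diagSeries (M : Matrix (Fin n) (Fin n) K) {k : ℕ} (hk : k < n) :
    seriesDet (negTrunc M (k + 1)) * diagSeries M k = seriesDet (negTrunc M k) := by
  set P : Matrix (Fin n) (Fin n) K⟦X⟧ := 1 - (X : K⟦X⟧) • (negTrunc M (k + 1)).map C with hP
  have h1 : P.adjugate = P.det •
      (Matrix.of fun a b => PowerSeries.mk fun l => (negTrunc M (k + 1) ^ l) a b) := by
    calc P.adjugate = P.adjugate * (P * _) := by rw [one_sub_mul_resolvent, mul_one]
      _ = _ := by rw [← mul_assoc, Matrix.adjugate_mul, Matrix.smul_mul, one_mul]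
  have h2 := congrFun (congrFun h1 ⟨k, hk⟩) ⟨k, hk⟩
  rw [Matrix.adjugate_apply, Matrix.smul_apply, Matrix.of_apply, smul_eq_mul] at h2
  unfold diagSeries
  rw [dif_pos hk]
  refine h2.symm.trans ?_
  -- the cofactor is the determinant with one row less
  unfold seriesDet
  congr 1
  ext a b : 2
  by_cases ha : a = ⟨k, hk⟩
  · subst ha
    rw [Matrix.updateRow_self]
    by_cases hb : b = ⟨k, hk⟩
    · subst hb; simp [negTrunc]
    · simp [negTrunc, hb, Matrix.one_apply_ne' hb]
  · rw [Matrix.updateRow_ne ha]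
    have ha' : (a : ℕ) ≠ k := fun h => ha (Fin.ext h)
    have : negTrunc M k a b = negTrunc M (k + 1) a b := by
      have : ((a : ℕ) < k + 1) ↔ (a : ℕ) < k := by omega
      simp only [negTrunc, Matrix.of_apply, this]
    rw [hP, Matrix.sub_apply, Matrix.sub_apply, Matrix.smul_apply, Matrix.smul_apply,
      Matrix.map_apply, Matrix.map_apply, this]

/-- `1 / det(1 + t M)` is the product of the diagonal entries of resolvents of truncations. -/
theorem charDet_mul_detSeries (M : Matrix (Fin n) (Fin n) K) :
    (charDet M : K⟦X⟧) * detSeries M n = 1 := by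
  have h1 : ∀ k ≤ n, seriesDet (negTrunc M k) * detSeries M k = 1 := by
    intro k
    induction k with
    | zero =>
      intro _
      have : negTrunc M 0 = 0 := by ext; simp [negTrunc]
      rw [this]
      simp [seriesDet, detSeries]
    | succ k ih =>
      intro hk
      unfold detSeries at ih ⊢
      rw [Finset.prod_range_succ, mul_comm (∏ _ ∈ _, _), ← mul_assoc,
        seriesDet_mul_diagSeries M hk, ih (by omega)]
  have h2 : (charDet M : K⟦X⟧) = seriesDet (negTrunc M n) := by
    unfold charDet seriesDet
    rw [← Polynomial.coeToPowerSeries.ringHom_apply, RingHom.map_det]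
    congr 1
    ext a b : 2
    by_cases hab : a = b
    · subst hab; simp [negTrunc]; exact mul_comm _ _
    · simp [negTrunc, hab]; exact mul_comm _ _
  rw [h2, h1 n le_rfl]

theorem charDet_coeff_zero (M : Matrix (Fin n) (Fin n) K) : (charDet M).coeff 0 = 1 := by
  have h := Polynomial.coeff_det_X_add_C_zero M 1
  rw [Matrix.map_one _ (map_zero _) (map_one _), add_comm, Matrix.det_one] at h
  exact h

theorem natDegree_charDet_le (M : Matrix (Fin n) (Fin n) K) : (charDet M).natDegree ≤ n := by
  have h := Polynomial.natDegree_det_X_add_C_le M 1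
  rw [Matrix.map_one _ (map_zero _) (map_one _), add_comm, Fintype.card_fin] at h
  exact h

theorem coeff_detSeries_zero (M : Matrix (Fin n) (Fin n) K) : coeff 0 (detSeries M n) = 1 := by
  have h := congrArg (coeff 0) (charDet_mul_detSeries M)
  simpa [charDet_coeff_zero] using h

theorem coeff_mul_of_coeff_eq_zero {F G : K⟦X⟧} {j : ℕ} (h : ∀ i < j, coeff i G = 0) :
    coeff j (F * G) = coeff 0 F * coeff j G := by
  rw [coeff_mul, Finset.sum_eq_single (0, j)]
  · rintro ⟨a, b⟩ hab hne
    have hab := Finset.HasAntidiagonal.mem_antidiagonal.mp hab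
    simp only at hab ⊢
    have : b ≠ j := fun hb => hne (by ext <;> simp <;> omega)
    rw [h b (by omega), mul_zero]
  · simp

/-- If `P F = 1` and `Q G = 1`, then `Q - P = P Q (F - G)`. -/
theorem charDet_sub (M N : Matrix (Fin n) (Fin n) K) :
    (charDet N - charDet M : K⟦X⟧) =
      (charDet M * charDet N : K⟦X⟧) * (detSeries M n - detSeries N n) := by
  have hM := charDet_mul_detSeries M
  have hN := charDet_mul_detSeries N
  linear_combination (-(charDet N : K⟦X⟧)) * hM + (charDet M : K⟦X⟧) * hN

/-- The first coefficient at which the inverses of the characteristic polynomials differ is one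
at which the characteristic polynomials differ. -/
theorem charCoeff_ne_of_coeff_detSeries_ne {M N : Matrix (Fin n) (Fin n) K} {j : ℕ}
    (h : ∀ i < j, coeff i (detSeries M n) = coeff i (detSeries N n))
    (hj : coeff j (detSeries M n) ≠ coeff j (detSeries N n)) : charCoeff j M ≠ charCoeff j N := by
  intro heq
  have h1 := congrArg (coeff j) (charDet_sub M N)
  rw [coeff_mul_of_coeff_eq_zero (fun i hi => by rw [map_sub, h i hi, sub_self]),
    coeff_zero_eq_constantCoeff_apply, map_mul, ← coeff_zero_eq_constantCoeff_apply,
    ← coeff_zero_eq_constantCoeff_apply, map_sub, map_sub, Polynomial.coeff_coe,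
    Polynomial.coeff_coe, Polynomial.coeff_coe, Polynomial.coeff_coe,
    charDet_coeff_zero, charDet_coeff_zero] at h1
  unfold charCoeff at heq
  rw [heq, sub_self, one_mul, one_mul] at h1
  exact hj (sub_eq_zero.mp h1.symm)

theorem charCoeff_eq_of_coeff_detSeries_eq {M N : Matrix (Fin n) (Fin n) K}
    (h : ∀ i ≤ n, coeff i (detSeries M n) = coeff i (detSeries N n)) (j : ℕ) :
    charCoeff j M = charCoeff j N := by
  unfold charCoeff
  by_cases hj : j ≤ n
  · have h1 := congrArg (coeff j) (charDet_sub M N)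
    rw [coeff_mul_of_coeff_eq_zero (fun i hi => by rw [map_sub, h i (by omega), sub_self]), map_sub,
      map_sub, h j hj, sub_self, mul_zero, Polynomial.coeff_coe, Polynomial.coeff_coe] at h1
    exact (sub_eq_zero.mp h1).symm
  · rw [Polynomial.coeff_eq_zero_of_natDegree_lt
      (lt_of_le_of_lt (natDegree_charDet_le M) (by omega)),
      Polynomial.coeff_eq_zero_of_natDegree_lt
      (lt_of_le_of_lt (natDegree_charDet_le N) (by omega))]

end Series

/-! ### Matrices as vectors -/

section Flat

variable {K : Type*} [Field K] {n m : ℕ}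

/-- The entry of `M` at position `q` of the row by row enumeration. -/
def entry (M : Matrix (Fin n) (Fin n) K) (q : ℕ) : K :=
  if h : q < n * n then
    M ⟨q / n, Nat.div_lt_of_lt_mul h⟩
      ⟨q % n, Nat.mod_lt _ (Nat.pos_of_ne_zero fun h0 => by simp [h0] at h)⟩
  else 0

theorem mul_add_lt {a b n : ℕ} (ha : a < n) (hb : b < n) : n * a + b < n * n := by
  have : n * (a + 1) ≤ n * n := Nat.mul_le_mul_left n ha
  rw [Nat.mul_add, Nat.mul_one] at this
  omega

theorem entry_mul_add (M : Matrix (Fin n) (Fin n) K) (a b : Fin n) :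
    entry M (n * a + b) = M a b := by
  have hn : 0 < n := a.pos
  unfold entry
  rw [dif_pos (mul_add_lt a.2 b.2)]
  congr 1
  · apply Fin.ext
    change (n * (a : ℕ) + b) / n = a
    rw [Nat.mul_add_div hn, Nat.div_eq_of_lt b.2, Nat.add_zero]
  · apply Fin.ext
    change (n * (a : ℕ) + b) % n = b
    rw [Nat.mul_add_mod, Nat.mod_eq_of_lt b.2]

theorem entry_add (M N : Matrix (Fin n) (Fin n) K) (q : ℕ) :
    entry (M + N) q = entry M q + entry N q := by
  unfold entry; split <;> simp

theorem entry_smul (c : K) (M : Matrix (Fin n) (Fin n) K) (q : ℕ) :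
    entry (c • M) q = c * entry M q := by
  unfold entry; split <;> simp

/-- The entries of the diagonal blocks of a matrix, as a vector. -/
def flat : Matrix (Fin n ⊕ Fin n) (Fin n ⊕ Fin n) K →ₗ[K] (Fin (n * n + n * n) → K) where
  toFun M q := if (q : ℕ) < n * n then entry M.toBlocks₁₁ q else entry M.toBlocks₂₂ (q - n * n)
  map_add' M N := by
    ext q
    simp only [Pi.add_apply]
    split <;> exact entry_add _ _ _
  map_smul' c M := by
    ext q
    simp only [Pi.smul_apply, RingHom.id_apply, smul_eq_mul]
    split <;> exact entry_smul _ _ _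

/-- The block diagonal matrix with the given entries. -/
def unflat : (Fin (n * n + n * n) → K) →ₗ[K] Matrix (Fin n ⊕ Fin n) (Fin n ⊕ Fin n) K where
  toFun v := Matrix.fromBlocks
    (Matrix.of fun a b => v ⟨n * a + b, by have := mul_add_lt a.2 b.2; omega⟩) 0 0
    (Matrix.of fun a b => v ⟨n * n + (n * a + b), by have := mul_add_lt a.2 b.2; omega⟩)
  map_add' v w := by
    rw [Matrix.fromBlocks_add, add_zero]; rfl
  map_smul' c v := by
    rw [Matrix.fromBlocks_smul, smul_zero]; rfl

theorem unflat_flat_fromBlocks (M N : Matrix (Fin n) (Fin n) K) :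
    unflat (flat (Matrix.fromBlocks M 0 0 N)) = Matrix.fromBlocks M 0 0 N := by
  have h1 : ∀ a b : Fin n, n * (a : ℕ) + b < n * n := fun a b => mul_add_lt a.2 b.2
  simp only [unflat, flat, LinearMap.coe_mk, AddHom.coe_mk, h1, if_true,
    Matrix.toBlocks_fromBlocks₁₁,
    Matrix.toBlocks_fromBlocks₂₂, entry_mul_add, Nat.add_sub_cancel_left,
    Nat.not_lt.mpr (Nat.le_add_right _ _), if_false]
  rfl

theorem wordProd_blockDiag (A B : Tuple K n m) (w : List (Fin m)) :
    wordProd (blockDiag A B) w = Matrix.fromBlocks (wordProd A w) 0 0 (wordProd B w) := by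
  rw [← tupleHom_wordElt (K := K), tupleHom_blockDiag, tupleHom_wordElt, tupleHom_wordElt]

/-- The entries of `A_w` and `B_w`, as a vector. -/
def wordVec (A B : Tuple K n m) (w : List (Fin m)) : Fin (n * n + n * n) → K :=
  flat (wordProd (blockDiag A B) w)

theorem wordVec_apply (A B : Tuple K n m) (w : List (Fin m)) (q : Fin (n * n + n * n)) :
    wordVec A B w q = if (q : ℕ) < n * n then entry (wordProd A w) q
      else entry (wordProd B w) (q - n * n) := by
  unfold wordVec
  rw [wordProd_blockDiag]
  rfl

theorem wordVec_mem_span_iff (A B : Tuple K n m) (w : List (Fin m)) (S : Set (List (Fin m))) :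
    wordVec A B w ∈ Submodule.span K (wordVec A B '' S) ↔
      wordProd (blockDiag A B) w ∈ Submodule.span K (wordProd (blockDiag A B) '' S) := by
  have hun : ∀ u, unflat (wordVec A B u) = wordProd (blockDiag A B) u := fun u => by
    unfold wordVec
    rw [wordProd_blockDiag, unflat_flat_fromBlocks]
  constructor
  · intro h
    have h1 := Submodule.mem_map_of_mem (f := unflat) h
    rw [Submodule.map_span, Set.image_image, hun] at h1
    simpa only [hun] using h1
  · intro h
    have h1 := Submodule.mem_map_of_mem (f := flat) h
    rw [Submodule.map_span, Set.image_image] at h1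
    exact h1

end Flat

end MatInv

namespace ArithRAM

open MatInv LProg

/-! ### Gaussian elimination on the machine -/

variable {K : Type*} [Field K] {n m : ℕ}

/-- The data that stay fixed during the main computation: sizes, multiplication tables, input.

The rest of the memory is used as follows. Registers `20` to `29` are counters and running values;
register `30` is the number of pivots found, `31` and `33` are flags. The memory for words consists
of slots, the first ones holding the queue of pivots and the next one the candidate under
examination: slot `k` has its letters in index array `1` and its matrices in field array `2`, both
from position `2 n ^ 2 k` on, and its length in index array `2`. Field array `6` holds the echelon
form and `5` the vector to be reduced, `8` and `9` hold power series, and the others hold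
intermediate results. -/
structure Env (A B : Tuple K n m) (s : Mem K) : Prop where
  size : s.reg 10 = n
  letters : s.reg 11 = m
  sq : s.reg 12 = n * n
  dim : s.reg 13 = n * n + n * n
  succ : s.reg 14 = n + 1
  mulN : ∀ x < n, s.idx 3 x = n * x
  mulSq : ∀ x < m, s.idx 4 x = n * n * x
  mulDim : ∀ x ≤ n * n + n * n, s.idx 5 x = (n * n + n * n) * x
  row : ∀ q < n * n, s.idx 8 q = n * (q / n)
  col : ∀ q < n * n, s.idx 9 q = q % n
  fldA : s.fld 0 = tupleArray A
  fldB : s.fld 1 = tupleArray B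

theorem Env.of_agree {A B : Tuple K n m} {s s' : Mem K} {R I F : List ℕ} (h : Env A B s)
    (hA : Agree R I F s s') (hR : ∀ r ∈ R, r ∉ [10, 11, 12, 13, 14])
    (hI : ∀ a ∈ I, a ∉ [3, 4, 5, 8, 9]) (hF : ∀ a ∈ F, a ∉ [0, 1]) : Env A B s' := by
  have h1 : ∀ r, r ∈ [10, 11, 12, 13, 14] → s'.reg r = s.reg r :=
    fun r hr => hA.reg r fun h' => hR r h' hr
  have h2 : ∀ a, a ∈ [3, 4, 5, 8, 9] → s'.idx a = s.idx a :=
    fun a ha => hA.idx a fun h' => hI a h' ha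
  have h3 : ∀ a, a ∈ [0, 1] → s'.fld a = s.fld a := fun a ha => hA.fld a fun h' => hF a h' ha
  obtain ⟨a1, a2, a3, a4, a5, a6, a7, a8, a9, a10, a11, a12⟩ := h
  constructor
  · rw [h1 10 (by decide), a1]
  · rw [h1 11 (by decide), a2]
  · rw [h1 12 (by decide), a3]
  · rw [h1 13 (by decide), a4]
  · rw [h1 14 (by decide), a5]
  · rw [h2 3 (by decide)]; exact a6
  · rw [h2 4 (by decide)]; exact a7
  · rw [h2 5 (by decide)]; exact a8
  · rw [h2 8 (by decide)]; exact a9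
  · rw [h2 9 (by decide)]; exact a10
  · rw [h3 0 (by decide)]; exact a11
  · rw [h3 1 (by decide)]; exact a12

/-- The array `a` holds the vector `v` from position `base` on. -/
def HoldsVec {D : ℕ} (s : Mem K) (a base : ℕ) (v : Fin D → K) : Prop :=
  ∀ q : Fin D, s.fld a (base + q) = v q

theorem HoldsVec.congr {K : Type*} {D : ℕ} {s s' : Mem K} {a base : ℕ} {v : Fin D → K}
    (h : HoldsVec s a base v) (hs : s'.fld a = s.fld a) : HoldsVec s' a base v := fun q => by
  rw [hs]; exact h q

/-- A loop that writes consecutive cells of an array of field elements. -/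
theorem exec_fill {s : Mem K} {i N : ℕ} {p : LProg} (a base : ℕ) (f : ℕ → K)
    (h : ∀ k s', k < s.reg N → Agree (i :: p.regs) p.idxs p.flds s s' → s'.reg i = k →
      s'.fld a (base + k) = s.fld a (base + k) →
      (∀ x, x < base ∨ base + s.reg N ≤ x → s'.fld a x = s.fld a x) →
      (p.exec s').fld a = Function.update (s'.fld a) (base + k) (f k)) :
    (∀ k < s.reg N, ((loop i N p).exec s).fld a (base + k) = f k) ∧
    ∀ x, x < base ∨ base + s.reg N ≤ x → ((loop i N p).exec s).fld a x = s.fld a x := by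
  have key := exec_loop_fld (s := s) (i := i) (N := N) (p := p) a (fun k => base + k) f
    (fun j _ k _ h => by simpa using h) fun k s' hk hA hi h1 h2 =>
      h k s' hk hA hi h1 fun x hx => h2 x fun j hj => by omega
  exact ⟨key.1, fun x hx => key.2 x fun j hj => by omega⟩

/-- Elimination of position `p` (register `22`) from the vector in array `5`. If row `p` is zero, this
divides by zero and subtracts a multiple of a zero row. -/
def eliminate : LProg :=
  .seq (.setFld 7 (.const 0) (.div (.cell 5 (.reg 22)) (.cell 6 (.add (.cell 5 (.reg 22)) (.reg 22)))))
    (.loop 23 13 (.setFld 5 (.reg 23) (.sub (.cell 5 (.reg 23))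
      (.mul (.cell 7 (.const 0)) (.cell 6 (.add (.cell 5 (.reg 22)) (.reg 23)))))))

/-- Storage of the vector in array `5` as row `p` of the echelon form. The vector is set to zero, so
that the remaining steps of the reduction have no effect. -/
def storeRow : LProg :=
  .seq (.loop 23 13 (.setFld 6 (.add (.cell 5 (.reg 22)) (.reg 23)) (.cell 5 (.reg 23))))
    (.seq (.loop 23 13 (.setFld 5 (.reg 23) .zero)) (.setReg 31 (.const 1)))

/-- One step of the reduction modulo the echelon form. -/
def reduceStep : LProg :=
  .seq eliminate (.ite (.fldZero (.cell 5 (.reg 22))) .skip storeRow)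

/-- Reduction of the vector in slot `cnt` (register `30`) modulo the echelon form; if it is not in
its span, the echelon form is enlarged and `cnt` is increased. -/
def testCandidate : LProg :=
  .seq (.loop 23 13 (.setFld 5 (.reg 23) (.cell 2 (.add (.cell 5 (.reg 30)) (.reg 23)))))
    (.seq (.setReg 31 (.const 0))
      (.seq (.loop 22 13 reduceStep) (.setReg 30 (.add (.reg 30) (.reg 31)))))

section Test

variable {A B : Tuple K n m} {s : Mem K}

theorem exec_eliminate (hs : Env A B s) {p : Fin (n * n + n * n)} (hp : s.reg 22 = p)
    {v e : Fin (n * n + n * n) → K} (hv : HoldsVec s 5 0 v)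
    (he : HoldsVec s 6 ((n * n + n * n) * p) e) :
    HoldsVec (eliminate.exec s) 5 0 (v - (v p / e p) • e) := by
  have hmul := hs.mulDim p p.2.le
  set s₁ := (LProg.setFld 7 (.const 0)
    (.div (.cell 5 (.reg 22)) (.cell 6 (.add (.cell 5 (.reg 22)) (.reg 22))))).exec s with hs₁
  have h7 : s₁.fld 7 0 = v p / e p := by
    simp only [hs₁, exec, FldExpr.eval, IdxExpr.eval, Mem.setFld_self, Function.update_self, hp,
      hmul]
    rw [he p, ← hv p, Nat.zero_add]
  have hA₁ : Agree [] [] [7] s s₁ := Agree.setFld ..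
  have hdim : s₁.reg 13 = n * n + n * n := (hA₁.reg 13 (by decide)).trans hs.dim
  have key := exec_fill (s := s₁) (i := 23) (N := 13)
    (p := .setFld 5 (.reg 23) (.sub (.cell 5 (.reg 23))
      (.mul (.cell 7 (.const 0)) (.cell 6 (.add (.cell 5 (.reg 22)) (.reg 23)))))) 5 0
    (fun k => s.fld 5 k - v p / e p * s.fld 6 ((n * n + n * n) * p + k)) ?_
  · intro q
    have := key.1 q (by rw [hdim]; exact q.2)
    refine this.trans ?_
    have h5 := hv q
    rw [Nat.zero_add] at h5
    rw [h5, he q]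
    rfl
  · intro k s' hk hA hi h5 _
    have h22 : s'.reg 22 = p := by rw [hA.reg 22 (by decide), hA₁.reg 22 (by decide), hp]
    have h7' : s'.fld 7 0 = v p / e p := by rw [hA.fld 7 (by decide), h7]
    have h6 : s'.fld 6 = s.fld 6 := by rw [hA.fld 6 (by decide), hA₁.fld 6 (by decide)]
    have hi5 : s'.idx 5 = s.idx 5 := by rw [hA.idx 5 (by decide), hA₁.idx 5 (by decide)]
    have h5s : s₁.fld 5 = s.fld 5 := hA₁.fld 5 (by decide)
    simp only [exec, Mem.setFld_self, FldExpr.eval, IdxExpr.eval, hi, h22, h7', h6, hi5, hmul]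
    rw [Nat.zero_add, h5s] at h5
    rw [h5, Nat.zero_add]

theorem exec_storeRow (hs : Env A B s) {p : Fin (n * n + n * n)} (hp : s.reg 22 = p)
    {v : Fin (n * n + n * n) → K} {E : Fin (n * n + n * n) → Fin (n * n + n * n) → K}
    (hv : HoldsVec s 5 0 v) (hE : ∀ r : Fin (n * n + n * n),
      HoldsVec s 6 ((n * n + n * n) * r) (E r)) :
    HoldsVec (storeRow.exec s) 5 0 (0 : Fin (n * n + n * n) → K) ∧
    (∀ r : Fin (n * n + n * n), HoldsVec (storeRow.exec s) 6 ((n * n + n * n) * r)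
      (Function.update E p v r)) ∧ (storeRow.exec s).reg 31 = 1 := by
  have hmul := hs.mulDim p p.2.le
  set P₁ : LProg := .loop 23 13 (.setFld 6 (.add (.cell 5 (.reg 22)) (.reg 23)) (.cell 5 (.reg 23)))
    with hP₁
  set s₁ := P₁.exec s with hs₁
  have hA₁ : Agree P₁.regs P₁.idxs P₁.flds s s₁ := exec_agree _ _
  have key := exec_fill (s := s) (i := 23) (N := 13)
    (p := .setFld 6 (.add (.cell 5 (.reg 22)) (.reg 23)) (.cell 5 (.reg 23)))
    6 ((n * n + n * n) * p) (fun k => s.fld 5 k) (by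
      intro k s' hk hA hi _ _
      simp only [exec, Mem.setFld_self, FldExpr.eval, IdxExpr.eval, hi, hA.reg 22 (by decide),
        hA.idx 5 (by decide), hp, hmul, hA.fld 5 (by decide)])
  rw [hs.dim] at key
  have key₂ := exec_fill (s := s₁) (i := 23) (N := 13) (p := .setFld 5 (.reg 23) .zero)
    5 0 (fun _ => 0) (by
      intro k s' hk hA hi _ _
      simp only [exec, Mem.setFld_self, FldExpr.eval, IdxExpr.eval, hi, Nat.zero_add])
  rw [hA₁.reg 13 (by decide), hs.dim] at key₂
  have h6 : (storeRow.exec s).fld 6 = s₁.fld 6 :=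
    (exec_agree (.seq (.loop 23 13 (.setFld 5 (.reg 23) .zero)) (.setReg 31 (.const 1))) s₁).fld 6
      (by decide)
  refine ⟨fun q => key₂.1 q q.2, fun r q => ?_, Mem.setReg_self ..⟩
  rw [h6]
  by_cases hr : r = p
  · subst hr
    rw [Function.update_self]
    refine (key.1 q q.2).trans ?_
    have := hv q
    rwa [Nat.zero_add] at this
  · rw [Function.update_of_ne hr]
    refine (key.2 _ ?_).trans (hE r q)
    have hq := q.2
    rcases Nat.lt_or_gt_of_ne (fun h => hr (Fin.ext h) : (r : ℕ) ≠ p) with h | h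
    · left
      have := Nat.mul_le_mul_left (n * n + n * n) h
      rw [Nat.mul_succ] at this
      omega
    · right
      have := Nat.mul_le_mul_left (n * n + n * n) h
      rw [Nat.mul_succ] at this
      omega

/-- The test of a candidate is a complete reduction; the number of slots grows by its flag. -/
theorem exec_testCandidate (hs : Env A B s) (hc : s.reg 30 ≤ n * n + n * n)
    {v : Fin (n * n + n * n) → K} {E : Fin (n * n + n * n) → Fin (n * n + n * n) → K}
    (hv : HoldsVec s 2 ((n * n + n * n) * s.reg 30) v)
    (hE : ∀ r : Fin (n * n + n * n), HoldsVec s 6 ((n * n + n * n) * r) (E r))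
    (hech : IsEchelon E) :
    ∃ E' v' flag, Reduction E v (n * n + n * n) E' v' flag ∧
      (∀ r : Fin (n * n + n * n),
        HoldsVec (testCandidate.exec s) 6 ((n * n + n * n) * r) (E' r)) ∧
      (testCandidate.exec s).reg 30 = s.reg 30 + flag := by
  set P₁ : LProg := .loop 23 13 (.setFld 5 (.reg 23) (.cell 2 (.add (.cell 5 (.reg 30)) (.reg 23))))
    with hP₁
  set s₁ := P₁.exec s with hs₁
  have hA₁ : Agree P₁.regs P₁.idxs P₁.flds s s₁ := exec_agree _ _
  have key := exec_fill (s := s) (i := 23) (N := 13)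
    (p := .setFld 5 (.reg 23) (.cell 2 (.add (.cell 5 (.reg 30)) (.reg 23))))
    5 0 (fun k => s.fld 2 ((n * n + n * n) * s.reg 30 + k)) (by
      intro k s' hk hA hi _ _
      simp only [exec, Mem.setFld_self, FldExpr.eval, IdxExpr.eval, hi, hA.reg 30 (by decide),
        hA.idx 5 (by decide), hs.mulDim _ hc, hA.fld 2 (by decide), Nat.zero_add])
  rw [hs.dim] at key
  set s₂ := (LProg.setReg 31 (.const 0)).exec s₁ with hs₂
  have hA₂ : Agree (31 :: P₁.regs) P₁.idxs P₁.flds s s₂ :=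
    (hA₁.mono (by simp) (by simp) (by simp)).trans
      ((Agree.setReg s₁ 31 0).mono (by simp) (by simp) (by simp))
  have henv₂ : Env A B s₂ := hs.of_agree hA₂ (by decide) (by decide) (by decide)
  have hloop := exec_loop_induction (s := s₂) (i := 22) (N := 13) (p := reduceStep)
    (fun k s' => ∃ E' v', Reduction E v k E' v' (s'.reg 31) ∧ HoldsVec s' 5 0 v' ∧
      ∀ r : Fin (n * n + n * n), HoldsVec s' 6 ((n * n + n * n) * r) (E' r))
    (fun k s' x ⟨E', v', h1, h2, h3⟩ => ⟨E', v', by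
      rwa [Mem.setReg_of_ne _ _ (by decide)], h2, h3⟩)
    ⟨E, v, by
      rw [show s₂.reg 31 = 0 from Mem.setReg_self ..]; exact Reduction.start E v,
      fun q => (key.1 q q.2).trans (hv q), fun r => (hE r).congr (hA₂.fld 6 (by decide))⟩
    (by
      rintro k s' hk hA hi ⟨E', v', hred, hv', hE'⟩
      have henv : Env A B s' := henv₂.of_agree hA (by decide) (by decide) (by decide)
      rw [henv₂.dim] at hk
      have hel := exec_eliminate henv (p := ⟨k, hk⟩) hi hv' (hE' ⟨k, hk⟩)
      have hAel := exec_agree eliminate s'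
      obtain ⟨w, hw⟩ : ∃ w, w = v' - (v' ⟨k, hk⟩ / E' ⟨k, hk⟩ ⟨k, hk⟩) • E' ⟨k, hk⟩ := ⟨_, rfl⟩
      have hstep := hred.step (k := ⟨k, hk⟩) hech hw
      rw [← hw] at hel
      have henv' : Env A B (eliminate.exec s') :=
        henv.of_agree hAel (by decide) (by decide) (by decide)
      have h22 : (eliminate.exec s').reg 22 = k := by rw [hAel.reg 22 (by decide), hi]
      have hEel : ∀ r : Fin (n * n + n * n),
          HoldsVec (eliminate.exec s') 6 ((n * n + n * n) * r) (E' r) :=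
        fun r => (hE' r).congr (hAel.fld 6 (by decide))
      have hval : (eliminate.exec s').fld 5 k = w ⟨k, hk⟩ := by
        have := hel ⟨k, hk⟩
        rwa [Nat.zero_add] at this
      have hcond : (Cond.fldZero (.cell 5 (.reg 22))).holds (eliminate.exec s') ↔ w ⟨k, hk⟩ = 0 := by
        simp only [Cond.holds, FldExpr.eval, IdxExpr.eval, h22]
        rw [hval]
      by_cases h0 : (Cond.fldZero (.cell 5 (.reg 22))).holds (eliminate.exec s')
      · rw [show reduceStep.exec s' = eliminate.exec s' from if_pos h0]
        refine ⟨_, _, ?_, hel, hEel⟩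
        rw [hAel.reg 31 (by decide)]
        exact hstep.1 (hcond.mp h0)
      · rw [show reduceStep.exec s' = storeRow.exec (eliminate.exec s') from if_neg h0]
        obtain ⟨h1, h2, h3⟩ := exec_storeRow henv' (p := ⟨k, hk⟩) h22 hel hEel
        refine ⟨_, _, ?_, h1, h2⟩
        rw [h3]
        exact hstep.2 fun h => h0 (hcond.mpr h))
  obtain ⟨E', v', hred, -, hE'⟩ := hloop
  have hA₃ := exec_agree (.loop 22 13 reduceStep) s₂
  refine ⟨E', v', _, henv₂.dim ▸ hred, fun r q => hE' r q, ?_⟩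
  refine (Mem.setReg_self ..).trans ?_
  simp only [IdxExpr.eval]
  congr 1
  rw [hA₃.reg 30 (by decide), hA₂.reg 30 (by decide)]

end Test

/-! ### The search for pivots on the machine -/

section Search

/-- Entry by entry product of a block of slot `h` (register `20`) with matrix `i` (register `21`)
of the input array `inp`, written to the same block of slot `cnt` (register `30`). -/
def mulBlock (off : IdxExpr) (inp : ℕ) : LProg :=
  .loop 23 12 (.seq
    (accumulate 7 24 10 (.setFld 7 (.const 0) (.add (.cell 7 (.const 0)) (.mul
      (.cell 2 (.add (.add (.cell 5 (.reg 20)) off) (.add (.cell 8 (.reg 23)) (.reg 24))))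
      (.cell inp (.add (.add (.cell 9 (.reg 23)) (.cell 3 (.reg 24))) (.cell 4 (.reg 21))))))))
    (.setFld 2 (.add (.add (.cell 5 (.reg 30)) off) (.reg 23)) (.cell 7 (.const 0))))

/-- The word of slot `h` (register `20`) followed by the letter `i` (register `21`), written to
slot `cnt` (register `30`). -/
def extendWord : LProg :=
  .seq (.loop 23 13 (.setIdx 1 (.add (.cell 5 (.reg 30)) (.reg 23))
      (.cell 1 (.add (.cell 5 (.reg 20)) (.reg 23)))))
    (.seq (.setIdx 1 (.add (.cell 5 (.reg 30)) (.cell 2 (.reg 20))) (.reg 21))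
      (.setIdx 2 (.reg 30) (.add (.cell 2 (.reg 20)) (.const 1))))

/-- The extension of the word in slot `h` by the letter `i`, together with its matrices. -/
def makeCandidate : LProg :=
  .seq (mulBlock (.const 0) 0) (.seq (mulBlock (.reg 12) 1) extendWord)

/-- The identity matrix, written to a block of slot `0`. -/
def identityBlock (off : IdxExpr) : LProg :=
  .loop 23 12 (.ite (.idxEq (.cell 8 (.reg 23)) (.cell 3 (.cell 9 (.reg 23))))
    (.setFld 2 (.add off (.reg 23)) .one) (.setFld 2 (.add off (.reg 23)) .zero))

/-- The queue with the empty word, or an empty queue: for `n = 0` the empty word is no pivot. -/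
def startQueue : LProg :=
  .seq (identityBlock (.const 0)) (.seq (identityBlock (.reg 12))
    (.seq (.setReg 30 (.const 0)) (.seq (.setIdx 2 (.const 0) (.const 0)) testCandidate)))

/-- Breadth first search for the pivots. -/
def findPivots : LProg :=
  .seq startQueue (.loop 20 13 (.ite (.idxLt (.reg 20) (.reg 30))
    (.loop 21 11 (.seq makeCandidate testCandidate)) .skip))

/-- Slot `k` of the queue holds the word `w`, its length and the matrices `A_w`, `B_w`. -/
structure HoldsSlot (A B : Tuple K n m) (s : Mem K) (k : ℕ) (w : List (Fin m)) : Prop where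
  vec : HoldsVec s 2 ((n * n + n * n) * k) (wordVec A B w)
  len : s.idx 2 k = w.length
  word : ∀ t (ht : t < w.length), s.idx 1 ((n * n + n * n) * k + t) = (w[t] : ℕ)

/-- The memory holds the queue `Q` and an echelon form of its vectors. -/
structure QueueMem (A B : Tuple K n m) (s : Mem K) (Q : List (List (Fin m))) : Prop where
  count : s.reg 30 = Q.length
  slot : ∀ k w, Q[k]? = some w → HoldsSlot A B s k w
  rows : ∃ E : Fin (n * n + n * n) → Fin (n * n + n * n) → K, IsEchelon E ∧
    (∀ r : Fin (n * n + n * n), HoldsVec s 6 ((n * n + n * n) * r) (E r)) ∧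
    echelonRank E = Q.length ∧
    Submodule.span K (Set.range E) = Submodule.span K (wordVec A B '' {u | u ∈ Q})

variable {A B : Tuple K n m} {s : Mem K}

theorem HoldsSlot.congr {s' : Mem K} {k : ℕ} {w : List (Fin m)} (h : HoldsSlot A B s k w)
    (h2 : s'.fld 2 = s.fld 2) (hi1 : s'.idx 1 = s.idx 1) (hi2 : s'.idx 2 = s.idx 2) :
    HoldsSlot A B s' k w :=
  ⟨h.vec.congr h2, by rw [hi2]; exact h.len, fun t ht => by rw [hi1]; exact h.word t ht⟩

theorem QueueMem.congr {s' : Mem K} {Q : List (List (Fin m))} (h : QueueMem A B s Q)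
    (h30 : s'.reg 30 = s.reg 30) (h2 : s'.fld 2 = s.fld 2) (h6 : s'.fld 6 = s.fld 6)
    (hi1 : s'.idx 1 = s.idx 1) (hi2 : s'.idx 2 = s.idx 2) : QueueMem A B s' Q := by
  obtain ⟨E, h1, h3, h4, h5⟩ := h.rows
  exact ⟨h30.trans h.count, fun k w hk => (h.slot k w hk).congr h2 hi1 hi2,
    E, h1, fun r => (h3 r).congr h6, h4, h5⟩

theorem QueueMem.length_le {Q : List (List (Fin m))} (h : QueueMem A B s Q) :
    Q.length ≤ n * n + n * n := by
  obtain ⟨E, -, -, h4, -⟩ := h.rows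
  exact h4 ▸ echelonRank_le E

theorem slot_le {D k c : ℕ} (h : k < c) : D * k + D ≤ D * c := by
  have := Nat.mul_le_mul_left D h
  rwa [Nat.mul_succ] at this

theorem exec_mulBlock (hs : Env A B s) {off : IdxExpr} {inp o : ℕ} {X : Tuple K n m}
    (hoff : ∀ s', Env A B s' → off.eval s' = o)
    (hinp : ∀ s', Env A B s' → s'.fld inp = tupleArray X)
    {i : Fin m} (hi : s.reg 21 = i) (hc : s.reg 30 ≤ n * n + n * n) (hh : s.reg 20 < s.reg 30)
    {M : Matrix (Fin n) (Fin n) K}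
    (hM : ∀ q < n * n, s.fld 2 ((n * n + n * n) * s.reg 20 + o + q) = entry M q) :
    (∀ q < n * n, ((mulBlock off inp).exec s).fld 2 ((n * n + n * n) * s.reg 30 + o + q)
      = entry (M * X i) q) ∧
    ∀ x, x < (n * n + n * n) * s.reg 30 + o ∨ (n * n + n * n) * s.reg 30 + o + n * n ≤ x →
      ((mulBlock off inp).exec s).fld 2 x = s.fld 2 x := by
  have hlt := slot_le (D := n * n + n * n) hh
  have key := exec_fill (s := s) (i := 23) (N := 12) (p := .seq
    (accumulate 7 24 10 (.setFld 7 (.const 0) (.add (.cell 7 (.const 0)) (.mul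
      (.cell 2 (.add (.add (.cell 5 (.reg 20)) off) (.add (.cell 8 (.reg 23)) (.reg 24))))
      (.cell inp (.add (.add (.cell 9 (.reg 23)) (.cell 3 (.reg 24))) (.cell 4 (.reg 21))))))))
    (.setFld 2 (.add (.add (.cell 5 (.reg 30)) off) (.reg 23)) (.cell 7 (.const 0))))
    2 ((n * n + n * n) * s.reg 30 + o) (fun q => entry (M * X i) q) (by
      intro k s' hk hA hik _ hout
      rw [hs.sq] at hk hout
      have hn : 0 < n := Nat.pos_of_ne_zero fun h0 => by simp [h0] at hk
      have henv : Env A B s' := hs.of_agree hA (by simp [regs, accumulate])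
        (by simp [idxs, accumulate]) (by simp [flds, accumulate])
      have hA20 : s'.reg 20 = s.reg 20 := hA.reg 20 (by simp [regs, accumulate])
      have hA21 : s'.reg 21 = s.reg 21 := hA.reg 21 (by simp [regs, accumulate])
      have hA30 : s'.reg 30 = s.reg 30 := hA.reg 30 (by simp [regs, accumulate])
      have ha : k / n < n := Nat.div_lt_of_lt_mul hk
      have hb : k % n < n := Nat.mod_lt _ hn
      set body : LProg := .setFld 7 (.const 0) (.add (.cell 7 (.const 0)) (.mul
        (.cell 2 (.add (.add (.cell 5 (.reg 20)) off) (.add (.cell 8 (.reg 23)) (.reg 24))))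
        (.cell inp (.add (.add (.cell 9 (.reg 23)) (.cell 3 (.reg 24))) (.cell 4 (.reg 21))))))
        with hbody
      have hAacc := exec_agree (accumulate 7 24 10 body) s'
      have henv' : Env A B ((accumulate 7 24 10 body).exec s') :=
        henv.of_agree hAacc (by simp [regs, accumulate, hbody])
          (by simp [idxs, accumulate, hbody]) (by simp [flds, accumulate, hbody])
      have hsum := exec_accumulate (s := s') (i := 24) (N := 10) (p := body) 7
        (fun z => if hz : z < n then M ⟨k / n, ha⟩ ⟨z, hz⟩ * X i ⟨z, hz⟩ ⟨k % n, hb⟩ else 0) (by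
          intro z s'' hz hA' hiz
          rw [henv.size] at hz
          have he : Env A B s'' := henv.of_agree hA' (by simp [regs, hbody])
            (by simp [idxs, hbody]) (by simp [flds, hbody])
          have h20 : s''.reg 20 = s.reg 20 := (hA'.reg 20 (by simp [regs, hbody])).trans hA20
          have h21 : s''.reg 21 = i := ((hA'.reg 21 (by simp [regs, hbody])).trans hA21).trans hi
          have h23 : s''.reg 23 = k := (hA'.reg 23 (by simp [regs, hbody])).trans hik
          have h2 : s''.fld 2 = s'.fld 2 := hA'.fld 2 (by simp [flds, hbody])
          have hlt' := mul_add_lt ha hz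
          have hr : s''.fld 2 ((n * n + n * n) * s.reg 20 + o + (n * (k / n) + z))
              = M ⟨k / n, ha⟩ ⟨z, hz⟩ := by
            rw [h2, hout _ (by left; omega), hM _ hlt']
            exact entry_mul_add M ⟨k / n, ha⟩ ⟨z, hz⟩
          have hX := tupleArray_entry X i ⟨z, hz⟩ ⟨k % n, hb⟩
          simp only at hX
          simp only [hbody, exec, Mem.setFld_self, FldExpr.eval, IdxExpr.eval,
            Function.update_self, h20, h21, h23, hiz, hoff _ he, hinp _ he,
            he.mulDim (s.reg 20) (by omega), he.row k hk, he.col k hk, he.mulN z hz,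
            he.mulSq i i.2, hr, hX, hz, dif_pos])
      have h2acc : ((accumulate 7 24 10 body).exec s').fld 2 = s'.fld 2 :=
        hAacc.fld 2 (by simp [flds, accumulate, hbody])
      have h30 : ((accumulate 7 24 10 body).exec s').reg 30 = s.reg 30 :=
        (hAacc.reg 30 (by simp [regs, accumulate, hbody])).trans hA30
      have h23 : ((accumulate 7 24 10 body).exec s').reg 23 = k :=
        (hAacc.reg 23 (by simp [regs, accumulate, hbody])).trans hik
      have hval : ((accumulate 7 24 10 body).exec s').fld 7 0 = entry (M * X i) k := by
        rw [hsum, henv.size, Finset.sum_range, entry, dif_pos hk, Matrix.mul_apply]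
        exact Finset.sum_congr rfl fun z _ => by simp
      change (LProg.exec (.setFld 2 _ _) ((accumulate 7 24 10 body).exec s')).fld 2 = _
      simp only [exec, Mem.setFld_self, FldExpr.eval, IdxExpr.eval, h30, h23, h2acc, hval,
        hoff _ henv', henv'.mulDim (s.reg 30) hc])
  rw [hs.sq] at key
  exact key

theorem exec_extendWord (hs : Env A B s) {i : Fin m} (hi : s.reg 21 = i)
    (hc : s.reg 30 ≤ n * n + n * n) (hh : s.reg 20 < s.reg 30) {w : List (Fin m)}
    (hlen : s.idx 2 (s.reg 20) = w.length)
    (hw : ∀ t (ht : t < w.length), s.idx 1 ((n * n + n * n) * s.reg 20 + t) = (w[t] : ℕ))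
    (hwl : w.length < n * n + n * n) :
    (extendWord.exec s).idx 2 (s.reg 30) = (w ++ [i]).length ∧
    (∀ t (ht : t < (w ++ [i]).length), (extendWord.exec s).idx 1
      ((n * n + n * n) * s.reg 30 + t) = ((w ++ [i])[t] : ℕ)) ∧
    (∀ k < s.reg 30, (extendWord.exec s).idx 2 k = s.idx 2 k) ∧
    ∀ x < (n * n + n * n) * s.reg 30, (extendWord.exec s).idx 1 x = s.idx 1 x := by
  have hlt := slot_le (D := n * n + n * n) hh
  set P : LProg := .loop 23 13 (.setIdx 1 (.add (.cell 5 (.reg 30)) (.reg 23))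
      (.cell 1 (.add (.cell 5 (.reg 20)) (.reg 23)))) with hP
  have key := exec_loop_idx (s := s) (i := 23) (N := 13)
    (p := .setIdx 1 (.add (.cell 5 (.reg 30)) (.reg 23))
      (.cell 1 (.add (.cell 5 (.reg 20)) (.reg 23)))) 1
    (fun k => (n * n + n * n) * s.reg 30 + k) (fun k => s.idx 1 ((n * n + n * n) * s.reg 20 + k))
    (fun j _ k _ h => by simpa using h) (by
      intro k s' hk hA hik hout
      rw [hs.dim] at hk
      have he : Env A B s' := hs.of_agree hA (by decide) (by decide) (by decide)
      have h1 := hout ((n * n + n * n) * s.reg 20 + k) (fun j _ => by omega)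
      simp only [exec, Mem.setIdx_self, IdxExpr.eval, hA.reg 30 (by decide), hA.reg 20 (by decide),
        hik, he.mulDim _ hc, he.mulDim (s.reg 20) (by omega), h1])
  obtain ⟨key1, key2⟩ := key
  rw [hs.dim] at key1 key2
  have hA := exec_agree P s
  have he : Env A B (P.exec s) := hs.of_agree hA (by decide) (by decide) (by decide)
  have h20 : (P.exec s).reg 20 = s.reg 20 := hA.reg 20 (by decide)
  have h30 : (P.exec s).reg 30 = s.reg 30 := hA.reg 30 (by decide)
  have h21 : (P.exec s).reg 21 = i := (hA.reg 21 (by decide)).trans hi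
  have hi2 : (P.exec s).idx 2 = s.idx 2 := hA.idx 2 (by decide)
  have hidx2 : (extendWord.exec s).idx 2 = Function.update (s.idx 2) (s.reg 30) (w.length + 1) := by
    change (LProg.exec (.setIdx 2 _ _) (LProg.exec (.setIdx 1 _ _) (P.exec s))).idx 2 = _
    simp only [exec, Mem.setIdx_self, IdxExpr.eval, Mem.setIdx_reg, h20, h30,
      Mem.setIdx_of_ne _ _ _ (show 2 ≠ 1 by decide), hi2, hlen]
  have hidx1 : (extendWord.exec s).idx 1 = Function.update ((P.exec s).idx 1)
      ((n * n + n * n) * s.reg 30 + w.length) i := by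
    change (LProg.exec (.setIdx 2 _ _) (LProg.exec (.setIdx 1 _ _) (P.exec s))).idx 1 = _
    simp only [exec, Mem.setIdx_self, IdxExpr.eval, h20, h30, h21,
      Mem.setIdx_of_ne _ _ _ (show 1 ≠ 2 by decide), hi2, hlen, he.mulDim _ hc]
  refine ⟨?_, ?_, ?_, ?_⟩
  · rw [hidx2, Function.update_self, List.length_append, List.length_singleton]
  · intro t ht
    rw [hidx1]
    by_cases hte : t = w.length
    · subst hte; simp
    · have ht' : t < w.length := by
        rw [List.length_append, List.length_singleton] at ht; omega
      rw [Function.update_of_ne (by omega), key1 t (by omega), hw t ht',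
        List.getElem_append_left ht']
  · intro k hk
    rw [hidx2, Function.update_of_ne (by omega)]
  · intro x hx
    rw [hidx1, Function.update_of_ne (by omega)]
    exact key2 x fun j _ => by omega

theorem HoldsSlot.of_lt {s' : Mem K} {k c : ℕ} {w : List (Fin m)} (h : HoldsSlot A B s k w)
    (hk : k < c) (hw : w.length ≤ n * n + n * n)
    (h2 : ∀ x < (n * n + n * n) * c, s'.fld 2 x = s.fld 2 x)
    (hi1 : ∀ x < (n * n + n * n) * c, s'.idx 1 x = s.idx 1 x)
    (hi2 : ∀ x < c, s'.idx 2 x = s.idx 2 x) : HoldsSlot A B s' k w := by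
  have hlt := slot_le (D := n * n + n * n) hk
  exact ⟨fun q => (h2 _ (by have := q.2; omega)).trans (h.vec q), (hi2 k hk).trans h.len,
    fun t ht => (hi1 _ (by omega)).trans (h.word t ht)⟩

theorem exec_makeCandidate (hs : Env A B s) {i : Fin m} (hi : s.reg 21 = i)
    (hc : s.reg 30 ≤ n * n + n * n) (hh : s.reg 20 < s.reg 30) {w : List (Fin m)}
    (hw : HoldsSlot A B s (s.reg 20) w) (hwl : w.length < n * n + n * n) :
    HoldsSlot A B (makeCandidate.exec s) (s.reg 30) (w ++ [i]) ∧
    ∀ k u, k < s.reg 30 → u.length ≤ n * n + n * n → HoldsSlot A B s k u →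
      HoldsSlot A B (makeCandidate.exec s) k u := by
  have hlt := slot_le (D := n * n + n * n) hh
  set s₁ := (mulBlock (.const 0) 0).exec s with hs₁
  set s₂ := (mulBlock (.reg 12) 1).exec s₁ with hs₂
  have hA₁ : Agree _ _ _ s s₁ := exec_agree _ _
  have hA₂ : Agree _ _ _ s₁ s₂ := exec_agree _ _
  have henv₁ : Env A B s₁ := hs.of_agree hA₁ (by decide) (by decide) (by decide)
  have henv₂ : Env A B s₂ := henv₁.of_agree hA₂ (by decide) (by decide) (by decide)
  have h20₁ : s₁.reg 20 = s.reg 20 := hA₁.reg 20 (by decide)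
  have h21₁ : s₁.reg 21 = s.reg 21 := hA₁.reg 21 (by decide)
  have h30₁ : s₁.reg 30 = s.reg 30 := hA₁.reg 30 (by decide)
  have h20₂ : s₂.reg 20 = s.reg 20 := (hA₂.reg 20 (by decide)).trans h20₁
  have h21₂ : s₂.reg 21 = s.reg 21 := (hA₂.reg 21 (by decide)).trans h21₁
  have h30₂ : s₂.reg 30 = s.reg 30 := (hA₂.reg 30 (by decide)).trans h30₁
  have hi1 : s₂.idx 1 = s.idx 1 := (hA₂.idx 1 (by decide)).trans (hA₁.idx 1 (by decide))
  have hi2 : s₂.idx 2 = s.idx 2 := (hA₂.idx 2 (by decide)).trans (hA₁.idx 2 (by decide))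
  obtain ⟨a1, a2⟩ := exec_mulBlock (X := A) (o := 0) (off := .const 0) (inp := 0) hs
    (fun _ _ => rfl)
    (fun _ h => h.fldA) hi hc hh (M := wordProd A w) (by
      intro q hq
      have := hw.vec ⟨q, by omega⟩
      rw [wordVec_apply, if_pos hq] at this
      rw [← this, Nat.add_zero])
  obtain ⟨b1, b2⟩ := exec_mulBlock (X := B) (o := n * n) (off := .reg 12) (inp := 1) henv₁
    (fun _ h => h.sq)
    (fun _ h => h.fldB) (h21₁.trans hi) (h30₁ ▸ hc) (by rw [h20₁, h30₁]; exact hh)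
    (M := wordProd B w) (by
      intro q hq
      have := hw.vec ⟨n * n + q, by omega⟩
      rw [wordVec_apply, if_neg (by simp), Nat.add_sub_cancel_left] at this
      rw [← this, h20₁, a2 _ (by left; omega), Nat.add_assoc])
  rw [← hs₁] at a1 a2
  rw [← hs₂, h30₁] at b1 b2
  obtain ⟨c1, c2, c3, c4⟩ := exec_extendWord henv₂ (h21₂.trans hi) (h30₂ ▸ hc)
    (by rw [h20₂, h30₂]; exact hh) (w := w) (by rw [hi2, h20₂]; exact hw.len)
    (by rw [hi1, h20₂]; exact hw.word) hwl
  rw [h30₂] at c1 c2 c3 c4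
  have hfin : makeCandidate.exec s = extendWord.exec s₂ := rfl
  have hf2 : (extendWord.exec s₂).fld 2 = s₂.fld 2 := (exec_agree extendWord s₂).fld 2 (by decide)
  rw [hfin]
  refine ⟨⟨?_, c1, c2⟩, ?_⟩
  · intro q
    rw [hf2, wordVec_apply, wordProd_snoc, wordProd_snoc]
    have hq := q.2
    split_ifs with h
    · rw [b2 _ (by left; omega)]
      exact a1 q h
    · have := b1 (q - n * n) (by omega)
      rw [← this]
      congr 1
      omega
  · intro k u hk hu hsl
    refine hsl.of_lt hk hu (fun x hx => ?_) (fun x hx => (c4 x hx).trans (by rw [hi1]))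
      (fun x hx => (c3 x hx).trans (by rw [hi2]))
    rw [hf2, b2 x (by left; omega), a2 x (by left; omega)]

theorem exec_testCandidate_queue (hs : Env A B s) {Q : List (List (Fin m))}
    (hQ : QueueMem A B s Q) {w : List (Fin m)} (hw : HoldsSlot A B s Q.length w)
    (hpiv : IsPivot (blockDiag A B) w ↔ wordProd (blockDiag A B) w ∉
      Submodule.span K (wordProd (blockDiag A B) '' {u | u ∈ Q})) :
    (IsPivot (blockDiag A B) w ∧ QueueMem A B (testCandidate.exec s) (Q ++ [w])) ∨
    (¬ IsPivot (blockDiag A B) w ∧ QueueMem A B (testCandidate.exec s) Q) := by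
  obtain ⟨E, hech, hrows, hrank, hspan⟩ := hQ.rows
  obtain ⟨E', v', flag, hred, hrows', hcnt⟩ := exec_testCandidate hs
    (by rw [hQ.count]; exact hQ.length_le) (by rw [hQ.count]; exact hw.vec) hrows hech
  rw [hQ.count] at hcnt
  have hA := exec_agree testCandidate s
  have hslot : ∀ k u, HoldsSlot A B s k u → HoldsSlot A B (testCandidate.exec s) k u :=
    fun k u h => h.congr (hA.fld 2 (by decide)) (hA.idx 1 (by decide)) (hA.idx 2 (by decide))
  have hpiv' : IsPivot (blockDiag A B) w ↔ wordVec A B w ∉ Submodule.span K (Set.range E) := by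
    rw [hpiv, hspan, wordVec_mem_span_iff]
  rcases hred.finish hech with ⟨rfl, rfl, hmem⟩ | ⟨rfl, hmem, hech', hrank', hspan'⟩
  · exact Or.inr ⟨fun h => hpiv'.mp h hmem, hcnt, fun k u hk => hslot k u (hQ.slot k u hk),
      E', hech, hrows', hrank, hspan⟩
  · refine Or.inl ⟨hpiv'.mpr hmem, by rw [hcnt]; simp, fun k u hk => ?_, E', hech', hrows',
      by rw [hrank', hrank]; simp, ?_⟩
    · rw [List.getElem?_append] at hk
      split_ifs at hk with hlt
      · exact hslot k u (hQ.slot k u hk)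
      · rw [List.getElem?_singleton] at hk
        split_ifs at hk with h0
        rw [← Option.some.inj hk, show k = Q.length by omega]
        exact hslot _ _ hw
    · rw [hspan', Submodule.span_insert, hspan, ← Submodule.span_union]
      congr 1
      ext x
      simp only [Set.mem_union, Set.mem_singleton_iff, Set.mem_image, Set.mem_ofPred_eq,
        List.mem_append, List.mem_singleton]
      constructor
      · rintro (rfl | ⟨u, hu, rfl⟩)
        · exact ⟨w, Or.inr rfl, rfl⟩
        · exact ⟨u, Or.inl hu, rfl⟩
      · rintro ⟨u, hu | rfl, rfl⟩
        · exact Or.inr ⟨u, hu, rfl⟩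
        · exact Or.inl rfl

theorem exec_identityBlock (hs : Env A B s) {off : IdxExpr} {o : ℕ}
    (hoff : ∀ s', Env A B s' → off.eval s' = o) :
    (∀ q < n * n, ((identityBlock off).exec s).fld 2 (o + q)
      = entry (1 : Matrix (Fin n) (Fin n) K) q) ∧
    ∀ x, x < o ∨ o + n * n ≤ x → ((identityBlock off).exec s).fld 2 x = s.fld 2 x := by
  have key := exec_fill (s := s) (i := 23) (N := 12)
    (p := .ite (.idxEq (.cell 8 (.reg 23)) (.cell 3 (.cell 9 (.reg 23))))
    (.setFld 2 (.add off (.reg 23)) .one) (.setFld 2 (.add off (.reg 23)) .zero)) 2 o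
    (fun q => entry (1 : Matrix (Fin n) (Fin n) K) q) (by
      intro k s' hk hA hik _ _
      rw [hs.sq] at hk
      have he : Env A B s' := hs.of_agree hA (by simp [regs]) (by simp [idxs]) (by simp [flds])
      have hn : 0 < n := Nat.pos_of_ne_zero fun h0 => by simp [h0] at hk
      have hb : k % n < n := Nat.mod_lt _ hn
      have hcond : (Cond.idxEq (.cell 8 (.reg 23)) (.cell 3 (.cell 9 (.reg 23)))).holds s' ↔
          k / n = k % n := by
        simp only [Cond.holds, IdxExpr.eval, hik, he.row k hk, he.col k hk, he.mulN _ hb]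
        exact Nat.mul_right_inj hn.ne'
      have hval : entry (1 : Matrix (Fin n) (Fin n) K) k = if k / n = k % n then 1 else 0 := by
        unfold entry
        rw [dif_pos hk, Matrix.one_apply]
        simp only [Fin.mk.injEq]
      by_cases h : k / n = k % n
      · rw [show LProg.exec (.ite _ _ _) s' = _ from if_pos (hcond.mpr h), hval, if_pos h]
        simp only [exec, Mem.setFld_self, FldExpr.eval, IdxExpr.eval, hik, hoff _ he]
      · rw [show LProg.exec (.ite _ _ _) s' = _ from if_neg (fun h' => h (hcond.mp h')), hval,
          if_neg h]
        simp only [exec, Mem.setFld_self, FldExpr.eval, IdxExpr.eval, hik, hoff _ he])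
  rw [hs.sq] at key
  exact key

theorem exec_startQueue (hs : Env A B s) (h6 : s.fld 6 = fun _ => 0) :
    ∃ Q, PivotQueue (blockDiag A B) Q 0 0 ∧ QueueMem A B (startQueue.exec s) Q := by
  set s₁ := (identityBlock (.const 0)).exec s with hs₁
  set s₂ := (identityBlock (.reg 12)).exec s₁ with hs₂
  set s₃ := (LProg.seq (.setReg 30 (.const 0)) (.setIdx 2 (.const 0) (.const 0))).exec s₂ with hs₃
  have hA₁ : Agree _ _ _ s s₁ := exec_agree _ _
  have hA₂ : Agree _ _ _ s₁ s₂ := exec_agree _ _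
  have hA₃ : Agree _ _ _ s₂ s₃ := exec_agree _ _
  have henv₁ : Env A B s₁ := hs.of_agree hA₁ (by decide) (by decide) (by decide)
  have henv₂ : Env A B s₂ := henv₁.of_agree hA₂ (by decide) (by decide) (by decide)
  have henv₃ : Env A B s₃ := henv₂.of_agree hA₃ (by decide) (by decide) (by decide)
  obtain ⟨a1, a2⟩ := exec_identityBlock (o := 0) hs (off := .const 0) fun _ _ => rfl
  obtain ⟨b1, b2⟩ := exec_identityBlock (o := n * n) henv₁ (off := .reg 12) fun _ h => h.sq
  rw [← hs₁] at a1 a2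
  rw [← hs₂] at b1 b2
  have h2 : s₃.fld 2 = s₂.fld 2 := hA₃.fld 2 (by decide)
  have hE : s₃.fld 6 = fun _ => 0 := by
    rw [hA₃.fld 6 (by decide), hA₂.fld 6 (by decide), hA₁.fld 6 (by decide), h6]
  have hslot : HoldsSlot A B s₃ 0 [] := by
    refine ⟨fun q => ?_, ?_, by simp⟩
    · have hq := q.2
      rw [h2, wordVec_apply, Nat.mul_zero, Nat.zero_add]
      simp only [wordProd, List.map_nil, List.prod_nil]
      split_ifs with h
      · rw [b2 _ (by left; omega)]
        have := a1 q h
        rwa [Nat.zero_add] at this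
      · have := b1 (q - n * n) (by omega)
        rwa [show n * n + (q - n * n) = (q : ℕ) by omega] at this
    · change (Mem.setIdx _ 2 0 0).idx 2 0 = 0
      rw [Mem.setIdx_self, Function.update_self]
  have hQ : QueueMem A B s₃ [] := by
    refine ⟨by simp [hs₃, exec, IdxExpr.eval], by simp, 0, ⟨fun _ _ _ => rfl, fun _ _ => rfl⟩,
      fun r q => by rw [hE]; rfl, by simp [echelonRank], ?_⟩
    rw [show {u : List (Fin m) | u ∈ []} = ∅ by simp, Set.image_empty, Submodule.span_empty,
      Submodule.span_eq_bot]
    rintro _ ⟨r, rfl⟩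
    rfl
  have hpiv : IsPivot (blockDiag A B) [] ↔ wordProd (blockDiag A B) [] ∉
      Submodule.span K (wordProd (blockDiag A B) '' {u | u ∈ []}) := by
    unfold IsPivot
    rw [show {M | ∃ u : List (Fin m), List.Shortlex (· < ·) u [] ∧ wordProd (blockDiag A B) u = M}
      = wordProd (blockDiag A B) '' {u | u ∈ []} by
        ext M; simp [List.not_shortlex_nil_right]]
  have hfin : startQueue.exec s = testCandidate.exec s₃ := rfl
  rw [hfin]
  rcases exec_testCandidate_queue henv₃ hQ hslot hpiv with ⟨h, hq⟩ | ⟨h, hq⟩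
  · exact ⟨_, PivotQueue.start_of_isPivot h, hq⟩
  · exact ⟨_, PivotQueue.start_of_not_isPivot h, hq⟩

/-- After the search, the queue consists of the pivots. -/
theorem exec_findPivots (hs : Env A B s) (h6 : s.fld 6 = fun _ => 0) :
    ∃ Q : List (List (Fin m)), (∀ u, u ∈ Q ↔ IsPivot (blockDiag A B) u) ∧
      (∀ (k : ℕ) (w : List (Fin m)), Q[k]? = some w → w.length ≤ k) ∧
      QueueMem A B (findPivots.exec s) Q := by
  obtain ⟨Q₀, hq₀, hQ₀⟩ := exec_startQueue hs h6
  have henv₀ : Env A B (startQueue.exec s) :=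
    hs.of_agree (exec_agree _ _) (by decide) (by decide) (by decide)
  have hloop := exec_loop_induction (s := startQueue.exec s) (i := 20) (N := 13)
    (p := .ite (.idxLt (.reg 20) (.reg 30)) (.loop 21 11 (.seq makeCandidate testCandidate)) .skip)
    (fun h s' => ∃ Q, PivotQueue (blockDiag A B) Q h 0 ∧ QueueMem A B s' Q)
    (fun h s' v ⟨Q, h1, h2⟩ => ⟨Q, h1, h2.congr (Mem.setReg_of_ne _ _ (by decide)) rfl rfl rfl rfl⟩)
    ⟨Q₀, hq₀, hQ₀⟩ (by
      rintro h s' hh hA hi ⟨Q, hq, hQ⟩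
      have henv : Env A B s' := henv₀.of_agree hA (by decide) (by decide) (by decide)
      have hcond : (Cond.idxLt (.reg 20) (.reg 30)).holds s' ↔ h < Q.length := by
        simp only [Cond.holds, IdxExpr.eval, hi, hQ.count]
      by_cases hlt : h < Q.length
      · rw [show LProg.exec (.ite _ _ _) s' = _ from if_pos (hcond.mpr hlt)]
        have hin := exec_loop_induction (s := s') (i := 21) (N := 11)
          (p := .seq makeCandidate testCandidate)
          (fun i t => ∃ Q, PivotQueue (blockDiag A B) Q h i ∧ QueueMem A B t Q ∧ h < Q.length)
          (fun i t v ⟨Q, h1, h2, h3⟩ =>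
            ⟨Q, h1, h2.congr (Mem.setReg_of_ne _ _ (by decide)) rfl rfl rfl rfl, h3⟩)
          ⟨Q, hq, hQ, hlt⟩ (by
            rintro i t hi' hA' hit ⟨Q, hq, hQ, hlt⟩
            rw [henv.letters] at hi'
            have het : Env A B t := henv.of_agree hA' (by decide) (by decide) (by decide)
            have h20 : t.reg 20 = h := (hA'.reg 20 (by decide)).trans hi
            obtain ⟨x, hx⟩ : ∃ x, Q[h]? = some x := ⟨_, List.getElem?_eq_getElem hlt⟩
            have hlen := hQ.length_le
            have hxl := hq.length_le hx
            obtain ⟨c1, c2⟩ := exec_makeCandidate het (i := ⟨i, hi'⟩) hit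
              (by rw [hQ.count]; exact hlen) (by rw [h20, hQ.count]; exact hlt)
              (by rw [h20]; exact hQ.slot h x hx) (by omega)
            rw [hQ.count] at c1 c2
            have hAc := exec_agree makeCandidate t
            have hec : Env A B (makeCandidate.exec t) :=
              het.of_agree hAc (by decide) (by decide) (by decide)
            have hQc : QueueMem A B (makeCandidate.exec t) Q := by
              obtain ⟨E, e1, e2, e3, e4⟩ := hQ.rows
              refine ⟨(hAc.reg 30 (by decide)).trans hQ.count, fun k w hk => ?_, E, e1,
                fun r => (e2 r).congr (hAc.fld 6 (by decide)), e3, e4⟩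
              have hkl := (List.getElem?_eq_some_iff.mp hk).1
              have := hq.length_le hk
              exact c2 k w hkl (by omega) (hQ.slot k w hk)
            change ∃ Q, _ ∧ QueueMem A B (testCandidate.exec (makeCandidate.exec t)) Q ∧ _
            rcases exec_testCandidate_queue hec hQc c1
              (hq.isPivot_iff hx (j := ⟨i, hi'⟩) rfl) with ⟨hp, hQ'⟩ | ⟨hp, hQ'⟩
            · exact ⟨_, hq.push hx rfl hp, hQ', by
                rw [List.length_append]; omega⟩
            · exact ⟨_, hq.skip hx rfl hp, hQ', hlt⟩)
        obtain ⟨Q', hq', hQ', -⟩ := hin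
        rw [henv.letters] at hq'
        exact ⟨Q', hq'.next, hQ'⟩
      · rw [show LProg.exec (.ite _ _ _) s' = _ from if_neg fun h' => hlt (hcond.mp h')]
        exact ⟨Q, hq.next_of_length_le (by omega), hQ⟩)
  obtain ⟨Q, hq, hQ⟩ := hloop
  rw [henv₀.dim] at hq
  exact ⟨Q, fun u => ⟨hq.pivot u, hq.complete hQ.length_le⟩, fun k w hk => hq.length_le hk, hQ⟩

end Search

/-! ### Power series arithmetic on the machine -/

/-- The product of the vector in array `10` with the rows up to `k` (register `25`) of `-M`, where
`M` is a block of slot `h` (register `20`). -/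
def truncMulVec (off : IdxExpr) : LProg :=
  .loop 23 10 (.ite (.idxLt (.reg 23) (.add (.reg 25) (.const 1)))
    (.seq (accumulate 7 24 10 (.setFld 7 (.const 0) (.sub (.cell 7 (.const 0)) (.mul
        (.cell 2 (.add (.add (.cell 5 (.reg 20)) off) (.add (.cell 3 (.reg 23)) (.reg 24))))
        (.cell 10 (.reg 24))))))
      (.setFld 12 (.reg 23) (.cell 7 (.const 0))))
    (.setFld 12 (.reg 23) .zero))

/-- One power of the truncated matrix: its diagonal entry is stored, the column is multiplied. -/
def powerStep (off : IdxExpr) : LProg :=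
  .seq (.setFld 11 (.reg 26) (.cell 10 (.reg 25)))
    (.seq (truncMulVec off) (.loop 23 10 (.setFld 10 (.reg 23) (.cell 12 (.reg 23)))))

/-- The coefficients of `diagSeries M k`, written to array `11`. -/
def diagCoeffs (off : IdxExpr) : LProg :=
  .seq (.loop 23 10 (.setFld 10 (.reg 23) .zero))
    (.seq (.setFld 10 (.reg 25) .one) (.loop 26 14 (powerStep off)))

/-- Multiplication of the truncated power series in array `o` by the one in array `11`. -/
def mulSeries (o : ℕ) : LProg :=
  .seq (.loop 27 14 (.seq (accumulate 7 26 14 (.ite (.idxLt (.reg 27) (.reg 26)) .skip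
      (.setFld 7 (.const 0) (.add (.cell 7 (.const 0))
        (.mul (.cell o (.reg 26)) (.cell 11 (.sub (.reg 27) (.reg 26))))))))
    (.setFld 13 (.reg 27) (.cell 7 (.const 0)))))
    (.loop 27 14 (.setFld o (.reg 27) (.cell 13 (.reg 27))))

/-- The coefficients of `detSeries M n` up to degree `n`, written to array `o`. -/
def detCoeffs (off : IdxExpr) (o : ℕ) : LProg :=
  .seq (.loop 27 14 (.setFld o (.reg 27) .zero))
    (.seq (.setFld o (.const 0) .one) (.loop 25 10 (.seq (diagCoeffs off) (mulSeries o))))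

section Series

open PowerSeries

variable {A B : Tuple K n m} {s : Mem K} {off : IdxExpr} {c : ℕ} {M : Matrix (Fin n) (Fin n) K}

theorem exec_truncMulVec (hs : Env A B s) (hoff : ∀ s', Env A B s' → off.eval s' = c)
    (hh : s.reg 20 ≤ n * n + n * n)
    (hM : ∀ q < n * n, s.fld 2 ((n * n + n * n) * s.reg 20 + c + q) = entry M q)
    {v : Fin n → K} (hv : ∀ a : Fin n, s.fld 10 a = v a) (a : Fin n) :
    ((truncMulVec off).exec s).fld 12 a = (negTrunc M (s.reg 25 + 1)).mulVec v a := by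
  set body : LProg := .setFld 7 (.const 0) (.sub (.cell 7 (.const 0)) (.mul
    (.cell 2 (.add (.add (.cell 5 (.reg 20)) off) (.add (.cell 3 (.reg 23)) (.reg 24))))
    (.cell 10 (.reg 24)))) with hbody
  have key := exec_fill (s := s) (i := 23) (N := 10)
    (p := .ite (.idxLt (.reg 23) (.add (.reg 25) (.const 1)))
      (.seq (accumulate 7 24 10 body) (.setFld 12 (.reg 23) (.cell 7 (.const 0))))
      (.setFld 12 (.reg 23) .zero)) 12 0
    (fun k => if h : k < n then (negTrunc M (s.reg 25 + 1)).mulVec v ⟨k, h⟩ else 0) (by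
      intro k s' hk hA hik _ _
      rw [hs.size] at hk
      have he : Env A B s' := hs.of_agree hA (by simp [regs, accumulate, hbody])
        (by simp [idxs, accumulate, hbody]) (by simp [flds, accumulate, hbody])
      have h25 : s'.reg 25 = s.reg 25 := hA.reg 25 (by simp [regs, accumulate, hbody])
      have h20 : s'.reg 20 = s.reg 20 := hA.reg 20 (by simp [regs, accumulate, hbody])
      have h2 : s'.fld 2 = s.fld 2 := hA.fld 2 (by simp [flds, accumulate, hbody])
      have h10 : s'.fld 10 = s.fld 10 := hA.fld 10 (by simp [flds, accumulate, hbody])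
      have hcond : (Cond.idxLt (.reg 23) (.add (.reg 25) (.const 1))).holds s' ↔
          k < s.reg 25 + 1 := by
        simp only [Cond.holds, IdxExpr.eval, hik, h25]
      rw [dif_pos hk]
      by_cases h : k < s.reg 25 + 1
      · rw [show LProg.exec (.ite _ _ _) s' = _ from if_pos (hcond.mpr h)]
        have hsum := exec_accumulate (s := s') (i := 24) (N := 10) (p := body) 7
          (fun z => if hz : z < n then -M ⟨k, hk⟩ ⟨z, hz⟩ * v ⟨z, hz⟩ else 0) (by
            intro z t hz hA' hiz
            rw [he.size] at hz
            have het : Env A B t := he.of_agree hA' (by simp [regs, hbody])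
              (by simp [idxs, hbody]) (by simp [flds, hbody])
            have h20' : t.reg 20 = s.reg 20 := (hA'.reg 20 (by simp [regs, hbody])).trans h20
            have h23' : t.reg 23 = k := (hA'.reg 23 (by simp [regs, hbody])).trans hik
            have h2' : t.fld 2 = s.fld 2 := (hA'.fld 2 (by simp [flds, hbody])).trans h2
            have h10' : t.fld 10 = s.fld 10 := (hA'.fld 10 (by simp [flds, hbody])).trans h10
            have hE := entry_mul_add M ⟨k, hk⟩ ⟨z, hz⟩
            have hvz := hv ⟨z, hz⟩
            simp only at hE hvz
            simp only [hbody, exec, Mem.setFld_self, FldExpr.eval, IdxExpr.eval,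
              Function.update_self, h20', h23', hiz, h2', h10', hoff _ het, het.mulDim _ hh,
              het.mulN k hk, hM _ (mul_add_lt hk hz), hE, hvz, hz, dif_pos]
            ring)
        rw [he.size] at hsum
        have hAacc := exec_agree (accumulate 7 24 10 body) s'
        have h23 : ((accumulate 7 24 10 body).exec s').reg 23 = k :=
          (hAacc.reg 23 (by simp [regs, accumulate, hbody])).trans hik
        have h12 : ((accumulate 7 24 10 body).exec s').fld 12 = s'.fld 12 :=
          hAacc.fld 12 (by simp [flds, accumulate, hbody])
        change (LProg.exec (.setFld 12 _ _) ((accumulate 7 24 10 body).exec s')).fld 12 = _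
        simp only [exec, Mem.setFld_self, FldExpr.eval, IdxExpr.eval, h23, h12, hsum, Nat.zero_add]
        congr 1
        rw [Finset.sum_range]
        simp [Matrix.mulVec, dotProduct, negTrunc, Nat.lt_succ_iff.mp h]
      · rw [show LProg.exec (.ite _ _ _) s' = _ from if_neg fun h' => h (hcond.mp h')]
        simp only [exec, Mem.setFld_self, FldExpr.eval, IdxExpr.eval, hik, Nat.zero_add]
        congr 1
        simp [Matrix.mulVec, dotProduct, negTrunc, Nat.lt_succ_iff.not.mp h])
  have := key.1 a (by rw [hs.size]; exact a.2)
  rw [Nat.zero_add, dif_pos a.2] at this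
  exact this

theorem exec_powerStep (hs : Env A B s) (hoff : ∀ s', Env A B s' → off.eval s' = c)
    (hh : s.reg 20 ≤ n * n + n * n)
    (hM : ∀ q < n * n, s.fld 2 ((n * n + n * n) * s.reg 20 + c + q) = entry M q)
    {v : Fin n → K} (hv : ∀ a : Fin n, s.fld 10 a = v a) (k : Fin n) (hk : s.reg 25 = k) :
    (∀ a : Fin n, ((powerStep off).exec s).fld 10 a = (negTrunc M (k + 1)).mulVec v a) ∧
    ((powerStep off).exec s).fld 11 = Function.update (s.fld 11) (s.reg 26) (v k) := by
  set s₁ := (LProg.setFld 11 (.reg 26) (.cell 10 (.reg 25))).exec s with hs₁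
  have hA₁ : Agree [] [] [11] s s₁ := Agree.setFld ..
  have henv₁ : Env A B s₁ := hs.of_agree hA₁ (by decide) (by decide) (by decide)
  have h20 : s₁.reg 20 = s.reg 20 := hA₁.reg 20 (by decide)
  have hmv := exec_truncMulVec henv₁ hoff (by rw [h20]; exact hh)
    (by rw [h20, hA₁.fld 2 (by decide)]; exact hM) (by rw [hA₁.fld 10 (by decide)]; exact hv)
  rw [hA₁.reg 25 (by decide), hk] at hmv
  set s₂ := (truncMulVec off).exec s₁ with hs₂
  have hA₂ : Agree _ _ _ s₁ s₂ := exec_agree _ _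
  have henv₂ : Env A B s₂ := henv₁.of_agree hA₂ (by simp [truncMulVec, regs, accumulate])
    (by simp [truncMulVec, idxs, accumulate]) (by simp [truncMulVec, flds, accumulate])
  have key := exec_fill (s := s₂) (i := 23) (N := 10)
    (p := .setFld 10 (.reg 23) (.cell 12 (.reg 23))) 10 0 (fun k => s₂.fld 12 k) (by
      intro k s' _ hA hik _ _
      simp only [exec, Mem.setFld_self, FldExpr.eval, IdxExpr.eval, hik, hA.fld 12 (by decide),
        Nat.zero_add])
  constructor
  · intro a
    have := key.1 a (by rw [henv₂.size]; exact a.2)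
    rw [Nat.zero_add] at this
    exact this.trans (hmv a)
  · have h11 : ((powerStep off).exec s).fld 11 = s₂.fld 11 :=
      (exec_agree (.loop 23 10 (.setFld 10 (.reg 23) (.cell 12 (.reg 23)))) s₂).fld 11 (by decide)
    rw [h11, hA₂.fld 11 (by simp [truncMulVec, flds, accumulate])]
    simp only [hs₁, exec, Mem.setFld_self, FldExpr.eval, IdxExpr.eval, hk, hv]

theorem exec_diagCoeffs (hs : Env A B s) (hoff : ∀ s', Env A B s' → off.eval s' = c)
    (hh : s.reg 20 ≤ n * n + n * n)
    (hM : ∀ q < n * n, s.fld 2 ((n * n + n * n) * s.reg 20 + c + q) = entry M q)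
    (k : Fin n) (hk : s.reg 25 = k) {l : ℕ} (hl : l < n + 1) :
    ((diagCoeffs off).exec s).fld 11 l = coeff l (diagSeries M k) := by
  set P₁ : LProg := .loop 23 10 (.setFld 10 (.reg 23) .zero) with hP₁
  set s₁ := P₁.exec s with hs₁
  have hA₁ : Agree P₁.regs P₁.idxs P₁.flds s s₁ := exec_agree _ _
  have key := exec_fill (s := s) (i := 23) (N := 10) (p := .setFld 10 (.reg 23) .zero) 10 0
    (fun _ => 0) (by
      intro k s' _ hA hik _ _
      simp only [exec, Mem.setFld_self, FldExpr.eval, IdxExpr.eval, hik, Nat.zero_add])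
  rw [hs.size] at key
  set s₂ := (LProg.setFld 10 (.reg 25) .one).exec s₁ with hs₂
  have hA₂ : Agree P₁.regs P₁.idxs P₁.flds s s₂ :=
    hA₁.trans ((Agree.setFld s₁ 10 _ _).mono (by simp) (by simp) (by simp [hP₁, flds]))
  have henv₂ : Env A B s₂ := hs.of_agree hA₂ (by decide) (by decide) (by decide)
  have h20 : s₂.reg 20 = s.reg 20 := hA₂.reg 20 (by decide)
  have h25 : s₂.reg 25 = k := (hA₂.reg 25 (by decide)).trans hk
  have h2 : s₂.fld 2 = s.fld 2 := hA₂.fld 2 (by decide)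
  have hcol : ∀ a : Fin n, s₂.fld 10 a = (1 : Matrix (Fin n) (Fin n) K) a k := by
    intro a
    have h1 := key.1 a a.2
    rw [Nat.zero_add] at h1
    have h25₁ : s₁.reg 25 = k := (hA₁.reg 25 (by decide)).trans hk
    simp only [hs₂, exec, Mem.setFld_self, FldExpr.eval, IdxExpr.eval, h25₁]
    by_cases hak : a = k
    · subst hak; simp
    · rw [Function.update_of_ne fun h => hak (Fin.ext h), Matrix.one_apply_ne hak]
      exact h1
  have hloop := exec_loop_induction (s := s₂) (i := 26) (N := 14) (p := powerStep off)
    (fun l t => (∀ a : Fin n, t.fld 10 a = (negTrunc M (k + 1) ^ l) a k) ∧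
      ∀ i < l, t.fld 11 i = (negTrunc M (k + 1) ^ i) k k)
    (fun _ _ _ h => h) ⟨by simpa using hcol, by simp⟩ (by
      rintro l t _ hA hil ⟨hv, hd⟩
      have het : Env A B t := henv₂.of_agree hA (by simp [powerStep, truncMulVec, regs, accumulate])
        (by simp [powerStep, truncMulVec, idxs, accumulate])
        (by simp [powerStep, truncMulVec, flds, accumulate])
      have h20' : t.reg 20 = s.reg 20 :=
        (hA.reg 20 (by simp [powerStep, truncMulVec, regs, accumulate])).trans h20
      have h25' : t.reg 25 = k :=
        (hA.reg 25 (by simp [powerStep, truncMulVec, regs, accumulate])).trans h25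
      have h2' : t.fld 2 = s.fld 2 :=
        (hA.fld 2 (by simp [powerStep, truncMulVec, flds, accumulate])).trans h2
      obtain ⟨e1, e2⟩ := exec_powerStep het hoff (by rw [h20']; exact hh)
        (by rw [h20', h2']; exact hM) hv k h25'
      refine ⟨fun a => ?_, fun i hi => ?_⟩
      · rw [e1 a, pow_succ', Matrix.mul_apply]
        rfl
      · rw [e2, hil]
        by_cases h : i = l
        · subst h; simp
        · rw [Function.update_of_ne h]
          exact hd i (by omega))
  rw [henv₂.succ] at hloop
  refine (hloop.2 l hl).trans ?_
  simp [diagSeries]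

theorem exec_mulSeries (hs : Env A B s) {o : ℕ} (ho : o = 8 ∨ o = 9) {F G : PowerSeries K}
    (hF : ∀ j < n + 1, s.fld o j = coeff j F) (hG : ∀ j < n + 1, s.fld 11 j = coeff j G)
    {j : ℕ} (hj : j < n + 1) : ((mulSeries o).exec s).fld o j = coeff j (F * G) := by
  have ho7 : o ≠ 7 := by omega
  have ho13 : o ≠ 13 := by omega
  set body : LProg := .ite (.idxLt (.reg 27) (.reg 26)) .skip
      (.setFld 7 (.const 0) (.add (.cell 7 (.const 0))
        (.mul (.cell o (.reg 26)) (.cell 11 (.sub (.reg 27) (.reg 26)))))) with hbody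
  set P₁ : LProg := .loop 27 14 (.seq (accumulate 7 26 14 body)
    (.setFld 13 (.reg 27) (.cell 7 (.const 0)))) with hP₁
  set s₁ := P₁.exec s with hs₁
  have hA₁ : Agree P₁.regs P₁.idxs P₁.flds s s₁ := exec_agree _ _
  have henv₁ : Env A B s₁ := hs.of_agree hA₁ (by simp [hP₁, regs, accumulate, hbody])
    (by simp [hP₁, idxs, accumulate, hbody]) (by simp [hP₁, flds, accumulate, hbody])
  have key := exec_fill (s := s) (i := 27) (N := 14)
    (p := .seq (accumulate 7 26 14 body) (.setFld 13 (.reg 27) (.cell 7 (.const 0)))) 13 0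
    (fun j => coeff j (F * G)) (by
      intro j s' hj hA hij _ _
      rw [hs.succ] at hj
      have he : Env A B s' := hs.of_agree hA (by simp [regs, accumulate, hbody])
        (by simp [idxs, accumulate, hbody]) (by simp [flds, accumulate, hbody])
      have ho' : s'.fld o = s.fld o := hA.fld o (by simp [flds, accumulate, hbody, ho7, ho13])
      have h11 : s'.fld 11 = s.fld 11 := hA.fld 11 (by simp [flds, accumulate, hbody])
      have hsum := exec_accumulate (s := s') (i := 26) (N := 14) (p := body) 7
        (fun i => if i ≤ j then coeff i F * coeff (j - i) G else 0) (by
          intro i t hi hA' hii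
          rw [he.succ] at hi
          have h27 : t.reg 27 = j := (hA'.reg 27 (by simp [regs, hbody])).trans hij
          have ho'' : t.fld o = s.fld o := (hA'.fld o (by simp [flds, hbody, ho7])).trans ho'
          have h11' : t.fld 11 = s.fld 11 := (hA'.fld 11 (by simp [flds, hbody])).trans h11
          have hcond : (Cond.idxLt (.reg 27) (.reg 26)).holds t ↔ j < i := by
            simp only [Cond.holds, IdxExpr.eval, hii, h27]
          by_cases h : j < i
          · rw [hbody, show LProg.exec (.ite _ _ _) t = _ from if_pos (hcond.mpr h),
              if_neg (by omega), add_zero]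
            rfl
          · rw [hbody, show LProg.exec (.ite _ _ _) t = _ from if_neg fun h' => h (hcond.mp h'),
              if_pos (by omega)]
            simp only [exec, Mem.setFld_self, FldExpr.eval, IdxExpr.eval, Function.update_self,
              hii, h27, ho'', h11', hF i hi, hG (j - i) (by omega)])
      rw [he.succ] at hsum
      have hAacc := exec_agree (accumulate 7 26 14 body) s'
      have h27 : ((accumulate 7 26 14 body).exec s').reg 27 = j :=
        (hAacc.reg 27 (by simp [regs, accumulate, hbody])).trans hij
      have h13 : ((accumulate 7 26 14 body).exec s').fld 13 = s'.fld 13 :=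
        hAacc.fld 13 (by simp [flds, accumulate, hbody])
      change (LProg.exec (.setFld 13 _ _) ((accumulate 7 26 14 body).exec s')).fld 13 = _
      simp only [exec, Mem.setFld_self, FldExpr.eval, IdxExpr.eval, h27, h13, hsum, Nat.zero_add]
      congr 1
      rw [coeff_mul, Finset.Nat.sum_antidiagonal_eq_sum_range_succ
        (fun a b => coeff a F * coeff b G), ← Finset.sum_filter]
      refine Finset.sum_congr (Finset.ext fun i => ?_) fun _ _ => rfl
      simp only [Finset.mem_filter, Finset.mem_range]
      omega)
  have key₂ := exec_fill (s := s₁) (i := 27) (N := 14)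
    (p := .setFld o (.reg 27) (.cell 13 (.reg 27))) o 0 (fun k => s₁.fld 13 k) (by
      intro k s' _ hA hik _ _
      simp only [exec, Mem.setFld_self, FldExpr.eval, IdxExpr.eval, hik,
        hA.fld 13 (by simp [flds]; omega), Nat.zero_add])
  rw [henv₁.succ] at key₂
  rw [hs.succ] at key
  have h1 := key.1 j hj
  have h2 := key₂.1 j hj
  rw [Nat.zero_add] at h1 h2
  exact h2.trans h1

theorem exec_detCoeffs (hs : Env A B s) (hoff : ∀ s', Env A B s' → off.eval s' = c)
    (hh : s.reg 20 ≤ n * n + n * n)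
    (hM : ∀ q < n * n, s.fld 2 ((n * n + n * n) * s.reg 20 + c + q) = entry M q)
    {o : ℕ} (ho : o = 8 ∨ o = 9) {j : ℕ} (hj : j < n + 1) :
    ((detCoeffs off o).exec s).fld o j = coeff j (detSeries M n) := by
  have ho7 : o ≠ 7 := by omega
  set P₁ : LProg := .loop 27 14 (.setFld o (.reg 27) .zero) with hP₁
  set s₁ := P₁.exec s with hs₁
  have hA₁ : Agree P₁.regs P₁.idxs P₁.flds s s₁ := exec_agree _ _
  have key := exec_fill (s := s) (i := 27) (N := 14) (p := .setFld o (.reg 27) .zero) o 0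
    (fun _ => 0) (by
      intro k s' _ hA hik _ _
      simp only [exec, Mem.setFld_self, FldExpr.eval, IdxExpr.eval, hik, Nat.zero_add])
  rw [hs.succ] at key
  set s₂ := (LProg.setFld o (.const 0) .one).exec s₁ with hs₂
  have hA₂ : Agree P₁.regs P₁.idxs P₁.flds s s₂ :=
    hA₁.trans ((Agree.setFld s₁ o _ _).mono (by simp) (by simp) (by simp [hP₁, flds]))
  have henv₂ : Env A B s₂ := hs.of_agree hA₂ (by simp [hP₁, regs])
    (by simp [hP₁, idxs]) (by simp [hP₁, flds]; omega)
  have h20 : s₂.reg 20 = s.reg 20 := hA₂.reg 20 (by simp [hP₁, regs])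
  have h2 : s₂.fld 2 = s.fld 2 := hA₂.fld 2 (by simp [hP₁, flds]; omega)
  have hone : ∀ j < n + 1, s₂.fld o j = coeff j (1 : PowerSeries K) := by
    intro j hj
    have h1 := key.1 j hj
    rw [Nat.zero_add] at h1
    simp only [hs₂, exec, Mem.setFld_self, FldExpr.eval, IdxExpr.eval, coeff_one]
    by_cases h : j = 0
    · subst h; simp
    · rw [Function.update_of_ne h, if_neg h]
      exact h1
  have hloop := exec_loop_induction (s := s₂) (i := 25) (N := 10)
    (p := .seq (diagCoeffs off) (mulSeries o))
    (fun k t => ∀ j < n + 1, t.fld o j = coeff j (detSeries M k))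
    (fun _ _ _ h => h) (by simpa [detSeries] using hone) (by
      intro k t hk hA hik hser
      rw [henv₂.size] at hk
      have het : Env A B t := henv₂.of_agree hA
        (by simp [diagCoeffs, mulSeries, powerStep, truncMulVec, regs, accumulate])
        (by simp [diagCoeffs, mulSeries, powerStep, truncMulVec, idxs, accumulate])
        (by simp [diagCoeffs, mulSeries, powerStep, truncMulVec, flds, accumulate]; omega)
      have h20' : t.reg 20 = s.reg 20 := (hA.reg 20 (by
        simp [diagCoeffs, mulSeries, powerStep, truncMulVec, regs, accumulate])).trans h20
      have h2' : t.fld 2 = s.fld 2 := (hA.fld 2 (by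
        simp [diagCoeffs, mulSeries, powerStep, truncMulVec, flds, accumulate]; omega)).trans h2
      have hd := fun l (hl : l < n + 1) => exec_diagCoeffs het hoff (by rw [h20']; exact hh)
        (by rw [h20', h2']; exact hM) ⟨k, hk⟩ hik hl
      have hA' := exec_agree (diagCoeffs off) t
      have het' : Env A B ((diagCoeffs off).exec t) := het.of_agree hA'
        (by simp [diagCoeffs, powerStep, truncMulVec, regs, accumulate])
        (by simp [diagCoeffs, powerStep, truncMulVec, idxs, accumulate])
        (by simp [diagCoeffs, powerStep, truncMulVec, flds, accumulate])
      have hot : ((diagCoeffs off).exec t).fld o = t.fld o := hA'.fld o (by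
        simp [diagCoeffs, powerStep, truncMulVec, flds, accumulate]; omega)
      intro j hj
      rw [show detSeries M (k + 1) = detSeries M k * diagSeries M k from
        Finset.prod_range_succ _ _]
      exact exec_mulSeries het' ho (by rw [hot]; exact hser) hd hj)
  rw [henv₂.size] at hloop
  exact hloop j hj

end Series

/-! ### The comparison on the machine -/

/-- The degree and the word of a separating invariant are recorded. A whole slot is copied, since the
length of the word is not among the loop bounds. -/
def recordWitness : LProg :=
  .seq (.setReg 33 (.const 1)) (.seq (.setReg 1 (.reg 27)) (.seq (.setReg 2 (.cell 2 (.reg 20)))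
    (.loop 23 13 (.setIdx 0 (.reg 23) (.cell 1 (.add (.cell 5 (.reg 20)) (.reg 23)))))))

/-- Search for the first degree in which the power series in the arrays `8` and `9` differ. -/
def compareSeries : LProg :=
  .loop 27 14 (.ite (.fldZero (.sub (.cell 8 (.reg 27)) (.cell 9 (.reg 27)))) .skip
    (.ite (.idxEq (.reg 33) (.const 0)) recordWitness .skip))

/-- Comparison of the characteristic polynomials for all words in the queue. -/
def comparePivots : LProg :=
  .seq (.setReg 33 (.const 0)) (.seq (.loop 20 13 (.ite (.idxLt (.reg 20) (.reg 30))
      (.seq (detCoeffs (.const 0) 8) (.seq (detCoeffs (.reg 12) 9) compareSeries)) .skip))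
    (.setReg 0 (.sub (.const 1) (.reg 33))))

section Compare

open PowerSeries

variable {A B : Tuple K n m} {s : Mem K}

/-- A separating invariant has been recorded. -/
structure Witness (A B : Tuple K n m) (s : Mem K) : Prop where
  flag : s.reg 33 = 1
  pos : 1 ≤ s.reg 1
  le : s.reg 1 ≤ n
  word : ∃ w : List (Fin m), HoldsWord s w ∧ IsPivot (blockDiag A B) w ∧
    charCoeff (s.reg 1) (wordProd A w) ≠ charCoeff (s.reg 1) (wordProd B w)

theorem Witness.of_agree {s' : Mem K} {R I F : List ℕ} (h : Witness A B s) (hA : Agree R I F s s')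
    (h33 : 33 ∉ R) (h1 : 1 ∉ R) (h2 : 2 ∉ R) (h0 : 0 ∉ I) : Witness A B s' := by
  obtain ⟨a, b, c, w, d, e, f⟩ := h
  rw [← hA.reg 1 h1] at b c f
  exact ⟨(hA.reg 33 h33).trans a, b, c, w, ⟨(hA.reg 2 h2).trans d.1,
    fun k hk => by rw [hA.idx 0 h0]; exact d.2 k hk⟩, e, f⟩

theorem exec_recordWitness (hs : Env A B s) {w : List (Fin m)} (hw : HoldsSlot A B s (s.reg 20) w)
    (hh : s.reg 20 ≤ n * n + n * n) (hwl : w.length ≤ n * n + n * n)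
    (hpiv : IsPivot (blockDiag A B) w) (hpos : 1 ≤ s.reg 27) (hle : s.reg 27 ≤ n)
    (hne : charCoeff (s.reg 27) (wordProd A w) ≠ charCoeff (s.reg 27) (wordProd B w)) :
    Witness A B (recordWitness.exec s) := by
  set s₁ : Mem K := (LProg.seq (.setReg 33 (.const 1)) (.seq (.setReg 1 (.reg 27))
    (.setReg 2 (.cell 2 (.reg 20))))).exec s with hs₁
  have hA₁ : Agree _ _ _ s s₁ := exec_agree _ _
  have henv₁ : Env A B s₁ := hs.of_agree hA₁ (by decide) (by decide) (by decide)
  have h33 : s₁.reg 33 = 1 := rfl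
  have h1 : s₁.reg 1 = s.reg 27 := rfl
  have h2 : s₁.reg 2 = w.length := hw.len
  have key := exec_loop_idx (s := s₁) (i := 23) (N := 13)
    (p := .setIdx 0 (.reg 23) (.cell 1 (.add (.cell 5 (.reg 20)) (.reg 23)))) 0
    (fun k => k) (fun k => s.idx 1 ((n * n + n * n) * s.reg 20 + k))
    (fun _ _ _ _ h => h) (by
      intro k s' _ hA hik _
      have h20 : s'.reg 20 = s.reg 20 :=
        (hA.reg 20 (by decide)).trans (hA₁.reg 20 (by decide))
      have hi1 : s'.idx 1 = s.idx 1 := (hA.idx 1 (by decide)).trans (hA₁.idx 1 (by decide))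
      have hi5 : s'.idx 5 = s.idx 5 := (hA.idx 5 (by decide)).trans (hA₁.idx 5 (by decide))
      simp only [exec, Mem.setIdx_self, IdxExpr.eval, hik, h20, hi1, hi5, hs.mulDim _ hh])
  rw [henv₁.dim] at key
  have hA₂ := exec_agree
    (.loop 23 13 (.setIdx 0 (.reg 23) (.cell 1 (.add (.cell 5 (.reg 20)) (.reg 23))))) s₁
  have hr1 := (hA₂.reg 1 (by decide)).trans h1
  have hfin : recordWitness.exec s = LProg.exec (.loop 23 13
    (.setIdx 0 (.reg 23) (.cell 1 (.add (.cell 5 (.reg 20)) (.reg 23))))) s₁ := rfl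
  rw [hfin]
  refine ⟨(hA₂.reg 33 (by decide)).trans h33, hr1 ▸ hpos, hr1 ▸ hle, w,
    ⟨(hA₂.reg 2 (by decide)).trans h2, fun k hk => ?_⟩, hpiv, hr1 ▸ hne⟩
  exact (key.1 k (by omega)).trans (hw.word k hk)

theorem exec_compareSeries (hs : Env A B s) {w : List (Fin m)}
    (hw : HoldsSlot A B s (s.reg 20) w) (hh : s.reg 20 ≤ n * n + n * n)
    (hwl : w.length ≤ n * n + n * n) (hpiv : IsPivot (blockDiag A B) w)
    (hA8 : ∀ j < n + 1, s.fld 8 j = coeff j (detSeries (wordProd A w) n))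
    (hB9 : ∀ j < n + 1, s.fld 9 j = coeff j (detSeries (wordProd B w) n))
    (h0 : s.reg 33 = 0 ∨ Witness A B s) :
    ((compareSeries.exec s).reg 33 = 0 ∧ s.reg 33 = 0 ∧
      ∀ j, charCoeff j (wordProd A w) = charCoeff j (wordProd B w)) ∨
    Witness A B (compareSeries.exec s) := by
  have hloop := exec_loop_induction (s := s) (i := 27) (N := 14)
    (p := .ite (.fldZero (.sub (.cell 8 (.reg 27)) (.cell 9 (.reg 27)))) .skip
      (.ite (.idxEq (.reg 33) (.const 0)) recordWitness .skip))
    (fun j t => (t.reg 33 = 0 ∧ s.reg 33 = 0 ∧ ∀ i < j,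
      coeff i (detSeries (wordProd A w) n) = coeff i (detSeries (wordProd B w) n)) ∨ Witness A B t)
    (fun j t v h => h.imp (fun h => ⟨(Mem.setReg_of_ne _ _ (by decide)).trans h.1, h.2⟩)
      fun h => h.of_agree (Agree.setReg t 27 v) (by decide) (by decide) (by decide) (by decide))
    (h0.imp_left fun h => ⟨h, h, by simp⟩) (by
      intro j t hj hA hij hinv
      rw [hs.succ] at hj
      have het : Env A B t := hs.of_agree hA (by decide) (by decide) (by decide)
      have h20 : t.reg 20 = s.reg 20 := hA.reg 20 (by decide)
      have h8 : t.fld 8 = s.fld 8 := hA.fld 8 (by decide)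
      have h9 : t.fld 9 = s.fld 9 := hA.fld 9 (by decide)
      have hcond : (Cond.fldZero (.sub (.cell 8 (.reg 27)) (.cell 9 (.reg 27)))).holds t ↔
          coeff j (detSeries (wordProd A w) n) = coeff j (detSeries (wordProd B w) n) := by
        simp only [Cond.holds, FldExpr.eval, IdxExpr.eval, hij, h8, h9, hA8 j hj, hB9 j hj,
          sub_eq_zero]
      have hcond' : (Cond.idxEq (.reg 33) (.const 0)).holds t ↔ t.reg 33 = 0 := by
        simp only [Cond.holds, IdxExpr.eval]
      by_cases hc : (Cond.fldZero (.sub (.cell 8 (.reg 27)) (.cell 9 (.reg 27)))).holds t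
      · rw [show LProg.exec (.ite _ _ _) t = LProg.exec .skip t from if_pos hc]
        refine hinv.imp_left fun h => ⟨h.1, h.2.1, fun i hi => ?_⟩
        rcases Nat.lt_succ_iff_lt_or_eq.mp hi with h' | rfl
        · exact h.2.2 i h'
        · exact hcond.mp hc
      · rw [show LProg.exec (.ite _ _ _) t = LProg.exec (.ite _ _ _) t from if_neg hc]
        rcases hinv with ⟨h33, -, hlt⟩ | hwit
        · rw [show LProg.exec (.ite (.idxEq (.reg 33) (.const 0)) recordWitness .skip) t
            = recordWitness.exec t from if_pos (hcond'.mpr h33)]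
          refine Or.inr (exec_recordWitness het (w := w) ?_ (by rw [h20]; exact hh) hwl hpiv ?_
            (by omega) ?_)
          · rw [h20]
            exact hw.congr (hA.fld 2 (by decide)) (hA.idx 1 (by decide)) (hA.idx 2 (by decide))
          · -- both series have constant coefficient `1`
            rw [hij]
            refine Nat.pos_of_ne_zero fun hj0 => hc (hcond.mpr ?_)
            rw [hj0, coeff_detSeries_zero, coeff_detSeries_zero]
          · rw [hij]
            exact charCoeff_ne_of_coeff_detSeries_ne hlt fun h => hc (hcond.mpr h)
        · rw [show LProg.exec (.ite (.idxEq (.reg 33) (.const 0)) recordWitness .skip) t = t from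
            if_neg fun h => by rw [hcond', hwit.flag] at h; exact one_ne_zero h]
          exact Or.inr hwit)
  rw [hs.succ] at hloop
  exact hloop.imp_left fun h => ⟨h.1, h.2.1, charCoeff_eq_of_coeff_detSeries_eq fun i hi =>
    h.2.2 i (by omega)⟩

theorem exec_comparePivots (hs : Env A B s) {Q : List (List (Fin m))} (hQ : QueueMem A B s Q)
    (hlen : ∀ (k : ℕ) (w : List (Fin m)), Q[k]? = some w → w.length ≤ k)
    (hpiv : ∀ w ∈ Q, IsPivot (blockDiag A B) w) :
    ((comparePivots.exec s).reg 0 = 1 ∧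
      ∀ w ∈ Q, ∀ j, charCoeff j (wordProd A w) = charCoeff j (wordProd B w)) ∨
    ((comparePivots.exec s).reg 0 = 0 ∧ Witness A B (comparePivots.exec s)) := by
  set s₁ : Mem K := (LProg.setReg 33 (.const 0)).exec s with hs₁
  have hA₁ : Agree [33] [] [] s s₁ := Agree.setReg ..
  have henv₁ : Env A B s₁ := hs.of_agree hA₁ (by decide) (by decide) (by decide)
  have hQ₁ : QueueMem A B s₁ Q := hQ.congr rfl rfl rfl rfl rfl
  have hQl := hQ.length_le
  set body : LProg := .ite (.idxLt (.reg 20) (.reg 30))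
      (.seq (detCoeffs (.const 0) 8) (.seq (detCoeffs (.reg 12) 9) compareSeries)) .skip with hbody
  have hloop := exec_loop_induction (s := s₁) (i := 20) (N := 13) (p := body)
    (fun h t => (t.reg 33 = 0 ∧ ∀ k < h, ∀ w, Q[k]? = some w →
      ∀ j, charCoeff j (wordProd A w) = charCoeff j (wordProd B w)) ∨ Witness A B t)
    (fun j t v h => h.imp (fun h => ⟨(Mem.setReg_of_ne _ _ (by decide)).trans h.1, h.2⟩)
      fun h => h.of_agree (Agree.setReg t 20 v) (by decide) (by decide) (by decide) (by decide))
    (Or.inl ⟨Mem.setReg_self .., by simp⟩) (by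
      intro h t _ hA hih hinv
      have het : Env A B t := henv₁.of_agree hA (by decide) (by decide) (by decide)
      have hQt : QueueMem A B t Q := hQ₁.congr (hA.reg 30 (by decide)) (hA.fld 2 (by decide))
        (hA.fld 6 (by decide)) (hA.idx 1 (by decide)) (hA.idx 2 (by decide))
      have hcond : (Cond.idxLt (.reg 20) (.reg 30)).holds t ↔ h < Q.length := by
        simp only [Cond.holds, IdxExpr.eval, hih, hQt.count]
      by_cases hlt : h < Q.length
      · rw [hbody, show LProg.exec (.ite _ _ _) t = _ from if_pos (hcond.mpr hlt)]
        obtain ⟨w, hw⟩ : ∃ w, Q[h]? = some w := ⟨_, List.getElem?_eq_getElem hlt⟩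
        have hslot := hQt.slot h w hw
        have hwl := hlen h w hw
        set t₁ := (detCoeffs (.const 0) 8).exec t with ht₁
        set t₂ := (detCoeffs (.reg 12) 9).exec t₁ with ht₂
        have hB₁ : Agree _ _ _ t t₁ := exec_agree _ _
        have hB₂ : Agree _ _ _ t₁ t₂ := exec_agree _ _
        have het₁ : Env A B t₁ := het.of_agree hB₁ (by decide) (by decide) (by decide)
        have het₂ : Env A B t₂ := het₁.of_agree hB₂ (by decide) (by decide) (by decide)
        have h20₁ : t₁.reg 20 = h := (hB₁.reg 20 (by decide)).trans hih
        have h20₂ : t₂.reg 20 = h := (hB₂.reg 20 (by decide)).trans h20₁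
        have hslot₁ : HoldsSlot A B t₁ h w := hslot.congr (hB₁.fld 2 (by decide))
          (hB₁.idx 1 (by decide)) (hB₁.idx 2 (by decide))
        have hslot₂ : HoldsSlot A B t₂ h w := hslot₁.congr (hB₂.fld 2 (by decide))
          (hB₂.idx 1 (by decide)) (hB₂.idx 2 (by decide))
        have h8 := fun j (hj : j < n + 1) => exec_detCoeffs (M := wordProd A w) het
          (off := .const 0) (c := 0) (fun _ _ => rfl) (by omega) (by
            intro q hq
            have := hslot.vec ⟨q, by omega⟩
            rw [wordVec_apply, if_pos hq] at this
            rw [hih, ← this, Nat.add_zero]) (.inl rfl) hj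
        have h9 := fun j (hj : j < n + 1) => exec_detCoeffs (M := wordProd B w) het₁
          (off := .reg 12) (c := n * n) (fun _ h => h.sq) (by omega) (by
            intro q hq
            have := hslot₁.vec ⟨n * n + q, by omega⟩
            rw [wordVec_apply, if_neg (by simp), Nat.add_sub_cancel_left] at this
            rw [h20₁, ← this, Nat.add_assoc]) (.inr rfl) hj
        have hfin := exec_compareSeries het₂ (w := w) (by rw [h20₂]; exact hslot₂) (by omega)
          (by omega) (hpiv w (List.mem_of_getElem? hw))
          (fun j hj => by rw [hB₂.fld 8 (by decide)]; exact h8 j hj) h9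
          (hinv.imp (fun h => ((hB₂.reg 33 (by decide)).trans (hB₁.reg 33 (by decide))).trans h.1)
            fun h => (h.of_agree hB₁ (by decide) (by decide) (by decide) (by decide)).of_agree hB₂
              (by decide) (by decide) (by decide) (by decide))
        change ((compareSeries.exec t₂).reg 33 = 0 ∧ _) ∨ Witness A B (compareSeries.exec t₂)
        rcases hinv with ⟨-, hall⟩ | hwit
        · refine hfin.imp_left fun h' => ⟨h'.1, fun k hk u hu => ?_⟩
          rcases Nat.lt_succ_iff_lt_or_eq.mp hk with hk' | rfl
          · exact hall k hk' u hu
          · rw [hw] at hu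
            exact Option.some.inj hu ▸ h'.2.2
        · rcases hfin with ⟨-, h33, -⟩ | h'
          · rw [hB₂.reg 33 (by decide), hB₁.reg 33 (by decide), hwit.flag] at h33
            exact absurd h33 one_ne_zero
          · exact Or.inr h'
      · rw [hbody, show LProg.exec (.ite _ _ _) t = LProg.exec .skip t from
          if_neg fun h' => hlt (hcond.mp h')]
        refine hinv.imp_left fun h' => ⟨h'.1, fun k hk w hw => ?_⟩
        have := (List.getElem?_eq_some_iff.mp hw).1
        exact h'.2 k (by omega) w hw)
  rw [henv₁.dim] at hloop
  set s₂ := (LProg.loop 20 13 body).exec s₁ with hs₂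
  have hfin : comparePivots.exec s = s₂.setReg 0 (1 - s₂.reg 33) := rfl
  rw [hfin, Mem.setReg_self]
  rcases hloop with ⟨h33, hall⟩ | hwit
  · refine Or.inl ⟨by rw [h33], fun w hw => ?_⟩
    obtain ⟨k, hk⟩ := List.mem_iff_getElem?.mp hw
    have := (List.getElem?_eq_some_iff.mp hk).1
    exact hall k (by omega) w hk
  · exact Or.inr ⟨by rw [hwit.flag],
      hwit.of_agree (Agree.setReg s₂ 0 _) (by decide) (by decide) (by decide) (by decide)⟩

end Compare

/-! ### Tables and the whole computation -/

/-- The sizes `n`, `m`, `n ^ 2`, `2 n ^ 2`, `n + 1` and `2 n ^ 2 + 1`, in the registers `10` to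
`15`. They bound the loops of the rest of the computation. -/
def computeSizes : LProg :=
  .seq (.loop 20 0 (.setReg 12 (.add (.reg 12) (.reg 0))))
    (.seq (.setReg 10 (.reg 0)) (.seq (.setReg 11 (.reg 1))
      (.seq (.setReg 13 (.add (.reg 12) (.reg 12))) (.seq (.setReg 14 (.add (.reg 0) (.const 1)))
        (.setReg 15 (.add (.reg 13) (.const 1)))))))

/-- The multiples of register `c`, written to array `a`. -/
def tabulateMultiples (a N c : ℕ) : LProg :=
  .seq (.setReg 28 (.const 0)) (.loop 20 N (.seq (.setIdx a (.reg 20) (.reg 28))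
    (.setReg 28 (.add (.reg 28) (.reg c)))))

/-- The start of the row and the column of each position of an `n × n` matrix. -/
def tabulateRowsCols : LProg :=
  .seq (.seq (.setReg 28 (.const 0)) (.setReg 29 (.const 0)))
    (.loop 20 12 (.seq (.seq (.setIdx 8 (.reg 20) (.reg 28)) (.seq (.setIdx 9 (.reg 20) (.reg 29))
      (.setReg 29 (.add (.reg 29) (.const 1)))))
      (.ite (.idxEq (.reg 29) (.reg 10))
        (.seq (.setReg 29 (.const 0)) (.setReg 28 (.add (.reg 28) (.reg 10)))) .skip)))

/-- Multiplication and division tables, since indices can only be added. -/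
def computeTables : LProg :=
  .seq (tabulateMultiples 3 10 10) (.seq (tabulateMultiples 4 11 12)
    (.seq (tabulateMultiples 5 15 13) tabulateRowsCols))

/-- The computation proper. -/
def decideClosureEquiv : LProg :=
  .seq computeTables (.seq findPivots comparePivots)

theorem exec_tabulateMultiples (s : Mem K) (a N c : ℕ) (h28 : c ≠ 28) (h20 : c ≠ 20) :
    ∀ k < ((LProg.setReg 28 (.const 0)).exec s).reg N,
      ((tabulateMultiples a N c).exec s).idx a k = s.reg c * k := by
  have hloop := exec_loop_induction (s := (LProg.setReg 28 (.const 0)).exec s) (i := 20) (N := N)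
    (p := .seq (.setIdx a (.reg 20) (.reg 28)) (.setReg 28 (.add (.reg 28) (.reg c))))
    (fun k t => t.reg 28 = s.reg c * k ∧ ∀ j < k, t.idx a j = s.reg c * j)
    (fun k t v h => ⟨(Mem.setReg_of_ne _ _ (by decide)).trans h.1, h.2⟩)
    ⟨Mem.setReg_self .., by simp⟩ (by
      rintro k t _ hA hik ⟨h1, h2⟩
      have hc : t.reg c = s.reg c := (hA.reg c (by simp [regs, h28, h20])).trans
        (Mem.setReg_of_ne _ _ h28)
      simp only [exec, IdxExpr.eval, Mem.setReg_self, Mem.setIdx_reg, Mem.setReg_idx,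
        Mem.setIdx_self, hik, h1, hc]
      refine ⟨by ring, fun j hj => ?_⟩
      by_cases hjk : j = k
      · subst hjk; simp
      · rw [Function.update_of_ne hjk]
        exact h2 j (by omega))
  exact hloop.2

theorem exec_tabulateRowsCols (s : Mem K) (h10 : s.reg 10 = n) (h12 : s.reg 12 = n * n) :
    ∀ q < n * n, (tabulateRowsCols.exec s).idx 8 q = n * (q / n) ∧
      (tabulateRowsCols.exec s).idx 9 q = q % n := by
  set s₁ : Mem K := (LProg.seq (.setReg 28 (.const 0)) (.setReg 29 (.const 0))).exec s with hs₁
  have hA₁ : Agree [28, 29] [] [] s s₁ :=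
    exec_agree (.seq (.setReg 28 (.const 0)) (.setReg 29 (.const 0))) s
  set step : LProg := .seq (.setIdx 8 (.reg 20) (.reg 28)) (.seq (.setIdx 9 (.reg 20) (.reg 29))
      (.setReg 29 (.add (.reg 29) (.const 1)))) with hstep
  have hloop := exec_loop_induction (s := s₁) (i := 20) (N := 12)
    (p := .seq step (.ite (.idxEq (.reg 29) (.reg 10))
        (.seq (.setReg 29 (.const 0)) (.setReg 28 (.add (.reg 28) (.reg 10)))) .skip))
    (fun k t => t.reg 28 = n * (k / n) ∧ t.reg 29 = k % n ∧
      ∀ q < k, t.idx 8 q = n * (q / n) ∧ t.idx 9 q = q % n)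
    (fun k t v h => ⟨(Mem.setReg_of_ne _ _ (by decide)).trans h.1,
      (Mem.setReg_of_ne _ _ (by decide)).trans h.2.1, h.2.2⟩)
    ⟨by simp [hs₁, exec, IdxExpr.eval, Mem.setReg], by simp [hs₁, exec, IdxExpr.eval, Mem.setReg],
      by simp⟩ (by
      rintro k t hk hA hik ⟨h28, h29, hall⟩
      rw [hA₁.reg 12 (by decide), h12] at hk
      have hn : 0 < n := Nat.pos_of_ne_zero fun h0 => by simp [h0] at hk
      set t₁ := step.exec t with ht₁
      have hA' : Agree [29] [8, 9] [] t t₁ := exec_agree step t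
      have h10t : t₁.reg 10 = n := (hA'.reg 10 (by decide)).trans ((hA.reg 10 (by decide)).trans
        ((hA₁.reg 10 (by decide)).trans h10))
      have h28t : t₁.reg 28 = n * (k / n) := (hA'.reg 28 (by decide)).trans h28
      have h29t : t₁.reg 29 = k % n + 1 := (Mem.setReg_self ..).trans
        (congrArg (· + 1) h29)
      have hi8 : t₁.idx 8 = Function.update (t.idx 8) k (n * (k / n)) := by
        rw [← h28, ← hik]; rfl
      have hi9 : t₁.idx 9 = Function.update (t.idx 9) k (k % n) := by
        rw [← h29, ← hik]; rfl
      have hall' : ∀ q < k + 1, t₁.idx 8 q = n * (q / n) ∧ t₁.idx 9 q = q % n := by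
        intro q hq
        rw [hi8, hi9]
        by_cases hqk : q = k
        · subst hqk; simp
        · rw [Function.update_of_ne hqk, Function.update_of_ne hqk]
          exact hall q (by omega)
      have hdm := Nat.div_add_mod k n
      have hlt := Nat.mod_lt k hn
      have hcond : (Cond.idxEq (.reg 29) (.reg 10)).holds t₁ ↔ k % n + 1 = n := by
        simp only [Cond.holds, IdxExpr.eval, h29t, h10t]
      generalize k / n = d at *
      generalize k % n = r at *
      subst hdm
      rw [Nat.add_assoc]
      by_cases hr : r + 1 = n
      · have hstp : LProg.exec (.seq step (.ite (.idxEq (.reg 29) (.reg 10))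
          (.seq (.setReg 29 (.const 0)) (.setReg 28 (.add (.reg 28) (.reg 10)))) .skip)) t
          = (t₁.setReg 29 0).setReg 28 (t₁.reg 28 + t₁.reg 10) := if_pos (hcond.mpr hr)
        rw [hstp, hr, Mem.setReg_self, Mem.setReg_of_ne _ _ (by decide), Mem.setReg_self, h28t,
          h10t, Nat.mul_add_div hn, Nat.div_self hn, Nat.mul_add_mod, Nat.mod_self]
        refine ⟨by ring, rfl, fun q hq => hall' q (by omega)⟩
      · have hstp : LProg.exec (.seq step (.ite (.idxEq (.reg 29) (.reg 10))
          (.seq (.setReg 29 (.const 0)) (.setReg 28 (.add (.reg 28) (.reg 10)))) .skip)) t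
          = t₁ := if_neg fun h => hr (hcond.mp h)
        rw [hstp, h28t, h29t, Nat.mul_add_div hn, Nat.div_eq_of_lt (by omega), Nat.mul_add_mod,
          Nat.mod_eq_of_lt (by omega)]
        exact ⟨rfl, rfl, fun q hq => hall' q (by omega)⟩)
  rw [hA₁.reg 12 (by decide), h12] at hloop
  exact hloop.2.2

theorem exec_computeSizes (A B : Tuple K n m) :
    let s := computeSizes.exec (input A B)
    s.reg 10 = n ∧ s.reg 11 = m ∧ s.reg 12 = n * n ∧ s.reg 13 = n * n + n * n ∧
      s.reg 14 = n + 1 ∧ s.reg 15 = n * n + n * n + 1 := by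
  have hloop := exec_loop_induction (s := input A B) (i := 20) (N := 0)
    (p := .setReg 12 (.add (.reg 12) (.reg 0))) (fun k t => t.reg 12 = n * k)
    (fun k t v h => (Mem.setReg_of_ne _ _ (by decide)).trans h) rfl (by
      intro k t _ hA _ h
      refine (Mem.setReg_self ..).trans ?_
      have h0 : t.reg 0 = n := hA.reg 0 (by decide)
      simp only [IdxExpr.eval, h, h0]
      ring)
  set s₁ := LProg.exec (.loop 20 0 (.setReg 12 (.add (.reg 12) (.reg 0)))) (input A B) with hs₁
  have hA : Agree [20, 12] [] [] (input A B) s₁ :=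
    exec_agree (.loop 20 0 (.setReg 12 (.add (.reg 12) (.reg 0)))) (input A B)
  have h0 : s₁.reg 0 = n := hA.reg 0 (by decide)
  have h1 : s₁.reg 1 = m := hA.reg 1 (by decide)
  have h12 : s₁.reg 12 = n * n := hloop
  refine ⟨h0, h1, h12, ?_, ?_, ?_⟩
  · rw [← h12]; rfl
  · exact congrArg (· + 1) h0
  · rw [← h12]; rfl

theorem exec_computeTables (A B : Tuple K n m) :
    Env A B (computeTables.exec (computeSizes.exec (input A B))) ∧
      (computeTables.exec (computeSizes.exec (input A B))).fld 6 = fun _ => 0 := by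
  obtain ⟨h10, h11, h12, h13, h14, h15⟩ := exec_computeSizes A B
  have hA₀ := exec_agree computeSizes (input A B)
  set s₀ := computeSizes.exec (input A B) with hs₀
  set s₁ := (tabulateMultiples 3 10 10).exec s₀ with hs₁
  set s₂ := (tabulateMultiples 4 11 12).exec s₁ with hs₂
  set s₃ := (tabulateMultiples 5 15 13).exec s₂ with hs₃
  have hA₁ : Agree _ _ _ s₀ s₁ := exec_agree _ _
  have hA₂ : Agree _ _ _ s₁ s₂ := exec_agree _ _
  have hA₃ : Agree _ _ _ s₂ s₃ := exec_agree _ _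
  have hA₄ := exec_agree tabulateRowsCols s₃
  have e1 := exec_tabulateMultiples s₀ 3 10 10 (by decide) (by decide)
  have e2 := exec_tabulateMultiples s₁ 4 11 12 (by decide) (by decide)
  have e3 := exec_tabulateMultiples s₂ 5 15 13 (by decide) (by decide)
  have e4 := exec_tabulateRowsCols (n := n) s₃
    (by rw [hA₃.reg 10 (by decide), hA₂.reg 10 (by decide), hA₁.reg 10 (by decide), h10])
    (by rw [hA₃.reg 12 (by decide), hA₂.reg 12 (by decide), hA₁.reg 12 (by decide), h12])
  rw [exec, Mem.setReg_of_ne _ _ (by decide), h10, ← hs₁] at e1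
  rw [exec, Mem.setReg_of_ne _ _ (by decide), hA₁.reg 11 (by decide), hA₁.reg 12 (by decide), h11,
    h12, ← hs₂] at e2
  rw [exec, Mem.setReg_of_ne _ _ (by decide), hA₂.reg 15 (by decide), hA₁.reg 15 (by decide),
    hA₂.reg 13 (by decide), hA₁.reg 13 (by decide), h13, h15, ← hs₃] at e3
  have hfin : computeTables.exec s₀ = tabulateRowsCols.exec s₃ := rfl
  rw [hfin]
  have hreg : ∀ r ∈ [10, 11, 12, 13, 14], (tabulateRowsCols.exec s₃).reg r = s₀.reg r := by
    intro r hr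
    have hr' : r ≠ 20 ∧ r ≠ 28 ∧ r ≠ 29 := by
      simp only [List.mem_cons, List.not_mem_nil, or_false] at hr
      omega
    rw [hA₄.reg r (by simp [tabulateRowsCols, regs, hr']),
      hA₃.reg r (by simp [tabulateMultiples, regs, hr']),
      hA₂.reg r (by simp [tabulateMultiples, regs, hr']),
      hA₁.reg r (by simp [tabulateMultiples, regs, hr'])]
  have hfld : ∀ a, (tabulateRowsCols.exec s₃).fld a = (input A B).fld a := fun a =>
    (hA₄.fld a (by simp [tabulateRowsCols, flds])).trans <|
      (hA₃.fld a (by simp [tabulateMultiples, flds])).trans <|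
      (hA₂.fld a (by simp [tabulateMultiples, flds])).trans <|
      (hA₁.fld a (by simp [tabulateMultiples, flds])).trans <|
      hA₀.fld a (by simp [computeSizes, flds])
  refine ⟨⟨?_, ?_, ?_, ?_, ?_, fun x hx => ?_, fun x hx => ?_, fun x hx => ?_,
    fun q hq => (e4 q hq).1, fun q hq => (e4 q hq).2, hfld 0, hfld 1⟩, hfld 6⟩
  · rw [hreg 10 (by decide), h10]
  · rw [hreg 11 (by decide), h11]
  · rw [hreg 12 (by decide), h12]
  · rw [hreg 13 (by decide), h13]
  · rw [hreg 14 (by decide), h14]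
  · rw [hA₄.idx 3 (by decide), hA₃.idx 3 (by decide), hA₂.idx 3 (by decide)]
    exact e1 x hx
  · rw [hA₄.idx 4 (by decide), hA₃.idx 4 (by decide)]
    exact e2 x hx
  · rw [hA₄.idx 5 (by decide)]
    exact e3 x (by omega)

/-- The final state: either no pivot separates `A` from `B`, or a separating one is recorded. -/
theorem exec_decideClosureEquiv (A B : Tuple K n m) :
    let s := decideClosureEquiv.exec (computeSizes.exec (input A B))
    (s.reg 0 = 1 ∧ ∀ w, IsPivot (blockDiag A B) w →
      ∀ j, charCoeff j (wordProd A w) = charCoeff j (wordProd B w)) ∨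
    (s.reg 0 = 0 ∧ Witness A B s) := by
  obtain ⟨henv, h6⟩ := exec_computeTables A B
  obtain ⟨Q, hpiv, hlen, hQ⟩ := exec_findPivots henv h6
  have henv' := henv.of_agree (exec_agree findPivots _) (by decide) (by decide) (by decide)
  refine (exec_comparePivots henv' hQ hlen fun w hw => (hpiv w).mp hw).imp_left fun h => ?_
  exact ⟨h.1, fun w hw => h.2 w ((hpiv w).mpr hw)⟩

end ArithRAM

open ArithRAM LProg in
/-- One program, working over all algebraically closed fields of all characteristics and for all
`n` and `m`, decides in a number of steps polynomial in `n` and `m` whether `A ∼_C B` (answer in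
register `0`), and if not, writes down a separating invariant `σ_{j,w}` (`j` in register `1`). -/
theorem theorem1p8 :
    ∃ (P : ArithRAM.Prog) (b : Polynomial ℕ),
      ∀ (K : Type*) [Field K] [IsAlgClosed K] (n m : ℕ) (A B : MatInv.Tuple K n m),
        ∃ (t : ℕ) (s : ArithRAM.Mem K),
          ArithRAM.Runs P (ArithRAM.input A B) t s ∧ t ≤ b.eval (n + m) ∧
          (MatInv.ClosureEquiv A B → s.reg 0 = 1) ∧
          (¬ MatInv.ClosureEquiv A B →
            s.reg 0 = 0 ∧
            1 ≤ s.reg 1 ∧ s.reg 1 ≤ n ∧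
            ∃ w : List (Fin m),
              ArithRAM.HoldsWord s w ∧
              MatInv.IsPivot (MatInv.blockDiag A B) w ∧
              MatInv.sigma K n (s.reg 1) w ∈ MatInv.invariantRing K n m ∧
              MatInv.evalAt A (MatInv.sigma K n (s.reg 1) w) ≠
                MatInv.evalAt B (MatInv.sigma K n (s.reg 1) w)) := by
  -- `2 x ^ 2 + x + 1` with `x = n + m` bounds all sizes computed by the first part
  refine ⟨.seq computeSizes.compile decideClosureEquiv.compile, computeSizes.timeBound +
    decideClosureEquiv.timeBound.comp (2 * Polynomial.X ^ 2 + Polynomial.X + 1), ?_⟩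
  intro K _ _ n m A B
  obtain ⟨h10, h11, h12, h13, h14, h15⟩ := exec_computeSizes A B
  obtain ⟨t₁, hrun₁, ht₁⟩ := runs_compile computeSizes (by decide) (by decide) (n + m) (input A B)
    (by
      intro N hN
      obtain rfl : N = 0 := by simpa [computeSizes, bounds] using hN
      exact Nat.le_add_right n m)
  obtain ⟨t₂, hrun₂, ht₂⟩ := runs_compile decideClosureEquiv (by decide) (by decide)
    (2 * (n + m) ^ 2 + (n + m) + 1) (computeSizes.exec (input A B)) (by
      intro N hN
      have hsub : ∀ N ∈ decideClosureEquiv.bounds, N ∈ [10, 11, 12, 13, 14, 15] := by decide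
      have hsq : n * n ≤ (n + m) ^ 2 := by nlinarith
      have hN' := hsub N hN
      simp only [List.mem_cons, List.not_mem_nil, or_false] at hN'
      rcases hN' with rfl | rfl | rfl | rfl | rfl | rfl <;> omega)
  refine ⟨t₁ + t₂, _, .seq hrun₁ hrun₂, ?_, ?_⟩
  · simp only [Polynomial.eval_add, Polynomial.eval_comp, Polynomial.eval_mul, Polynomial.eval_pow,
      Polynomial.eval_X, Polynomial.eval_one, Polynomial.eval_ofNat]
    omega
  · rcases exec_decideClosureEquiv A B with ⟨h, hall⟩ | ⟨h, hwit⟩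
    · exact ⟨fun _ => h, fun hne => absurd (MatInv.closureEquiv_of_pivots A B hall) hne⟩
    · obtain ⟨w, hw, hpiv, hne⟩ := hwit.word
      refine ⟨fun heq => absurd (heq.charCoeff_eq _ _) hne, fun _ => ⟨h, hwit.pos, hwit.le, w, hw,
        hpiv, MatInv.sigma_mem_invariantRing K n _ w, ?_⟩⟩
      rwa [MatInv.evalAt_sigma, MatInv.evalAt_sigma]
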